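/- Let $G$ be a discrete group and write $Z^2(G,U(1))$ (additively) for the group of $2$-cocycles of $G$ with values in $U(1)$ (trivial action). For $\alpha\in Z^2(G,U(1))$ and a finite subgroup $H\subseteq G$ let $R_\alpha(H)$ be the Grothendieck group of isomorphism classes of finite-dimensional complex $\alpha$-twisted representations of $H$, i.e. maps $\rho:H\to GL(V)$ with $\rho(x)\rho(y)=\alpha(x,y)\rho(xy)$ and $\rho(1)=I$. Let $\mathcal R_\alpha$ be the contravariant functor $G/H\mapsto R_\alpha(H)$ on the category of orbits $G/H$ with $H$ finite; a $G$-map $G/H\to G/K$, $eH\mapsto gK$, induces restriction to $g^{-1}Hg\subseteq K$ followed by twisted conjugation, $x\in H$ acting by $\bar g^{-1}\bar x\bar g=\alpha(x,g)\,\alpha(g,g^{-1}xg)^{-1}\,\overline{g^{-1}xg}$. For a proper $G$-CW complex $X$ (all stabilizers finite) let $\underline C_n(X)(G/H)=H_n((X^{(n)})^H,(X^{(n-1)})^H;\mathbb Z)$, with boundary the connecting homomorphisms of the triples, and let $H^n_G(X;\mathcal R_\alpha)$ be the cohomology of the cochain complex $\mathrm{Hom}(\underline C_*(X),\mathcal R_\alpha)$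 of groups of natural transformations. **Theorem.** There are homomorphisms, for all $\alpha,\beta\in Z^2(G,U(1))$, all $n,m\ge 0$ and all proper $G$-CW complexes $X$, $$\cup: H^n_G(X;\mathcal R_\alpha)\otimes H^m_G(X;\mathcal R_\beta)\to H^{n+m}_G(X;\mathcal R_{\alpha+\beta}),$$ with the following properties. 1. $\cup$ is the cup product, defined as in singular cohomology. Call a cocycle $s\in\mathrm{Hom}(S_n(X^{(-)}),\mathcal R_\alpha)$ on the singular chains $G/H\mapsto S_n(X^H)$ a representative of $x\in H^n_G(X;\mathcal R_\alpha)$ if $s$ and $x$ have the same image in the cohomology of $\mathrm{Hom}(F_*,\mathcal R_\alpha)$, where $F_n(G/H)=\{c\in S_n((X^{(n)})^H):\partial c\in S_{n-1}((X^{(n-1)})^H)\}$, which is contained in $S_n(X^H)$ and maps onto $\underline C_n(X)(G/H)$. Every class has a representative; and if $s,t$ represent $x\in H^n_G(X;\mathcal R_\alpha)$ and $y\in H^m_G(X;\mathcal R_\beta)$, then $x\cup y$ is represented by the cochain which sends a singular $(n+m)$-simplex $\sigma$ of $X^H$ to the product of $s(\text{front } n\text{-face of }\sigma)$ and $t(\text{back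 } m\text{-face of }\sigma)$ under the map $R_\alpha(H)\otimes R_\beta(H)\to R_{\alpha+\beta}(H)$ induced by the tensor product of representations. 2. $\cup$ is natural in $X$: $f^*(x\cup y)=f^*x\cup f^*y$ for every cellular $G$-map $f:X\to X'$; and likewise for an arbitrary continuous $G$-map $f$, where $x'=f^*x$ means that for some representative $s$ of $x$ the pulled back cocycle $f^*s$ represents $x'$. 3. $\cup$ is graded commutative: $x\cup y=(-1)^{nm}\,y\cup x$ for $x\in H^n_G(X;\mathcal R_\alpha)$, $y\in H^m_G(X;\mathcal R_\beta)$. -/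

import Mathlib

universe u v w w₁ w₂

open scoped TensorProduct

noncomputable section

open CategoryTheory Opposite

namespace TwistedBredon

/-! ### Cocycles and twisted representations -/

/-- The group `Z²(G, U(1))` of 2-cocycles of `G` with values in the circle group (trivial action);
the group law is pointwise multiplication in `U(1)`, written additively. -/
def Z2 (G : Type v) [Group G] : AddSubgroup (G → G → Additive Circle) where
  carrier := {α | ∀ x y z, α x y + α (x * y) z = α y z + α x (y * z)}
  zero_mem' := by intro x y z; simp
  add_mem' := by
    intro a b ha hb x y z
    have h1 := ha x y z
    have h2 := hb x y z
    simp only [Pi.add_apply]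
    rw [add_add_add_comm, h1, h2, add_add_add_comm]
  neg_mem' := by
    intro a ha x y z
    have h1 := ha x y z
    simp only [Pi.neg_apply]
    rw [← neg_add, h1, neg_add]

/-- The complex number underlying an element of `U(1)`. -/
def toC (a : Additive Circle) : ℂ := (a.toMul : ℂ)

theorem toC_zero : toC 0 = 1 := by simp [toC]

theorem toC_add (a b : Additive Circle) : toC (a + b) = toC a * toC b := by simp [toC]

theorem toC_ne_zero (a : Additive Circle) : toC a ≠ 0 := by simp [toC]

/-- A (finite-dimensional, complex) `α`-twisted representation of the subgroup `H` of `G`: a map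
`ρ : H → GL(V)` with `ρ(x)ρ(y) = α(x,y)ρ(xy)` and `ρ(1) = 1`. -/
structure TwistedRep {G : Type v} [Group G] (α : Z2 G) (H : Subgroup G) : Type (max 1 v) where
  V : Type
  [addCommGroup : AddCommGroup V]
  [module : Module ℂ V]
  [finite : FiniteDimensional ℂ V]
  ρ : H → V ≃ₗ[ℂ] V
  map_one : ρ 1 = LinearEquiv.refl ℂ V
  map_mul : ∀ (x y : H) (v : V), ρ x (ρ y v) = toC (α.1 x y) • ρ (x * y) v

attribute [instance] TwistedRep.addCommGroup TwistedRep.module TwistedRep.finite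

namespace TwistedRep

variable {G : Type v} [Group G] {α β : Z2 G} {H : Subgroup G}

/-- Linear equivalence of twisted representations. -/
def Iso (R S : TwistedRep α H) : Prop :=
  ∃ f : R.V ≃ₗ[ℂ] S.V, ∀ (x : H) (v : R.V), f (R.ρ x v) = S.ρ x (f v)

instance setoid (α : Z2 G) (H : Subgroup G) : Setoid (TwistedRep α H) where
  r := Iso
  iseqv :=
    { refl := fun R => ⟨LinearEquiv.refl ℂ R.V, fun _ _ => rfl⟩
      symm := by
        rintro R S ⟨f, hf⟩
        refine ⟨f.symm, fun x v => ?_⟩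
        rw [LinearEquiv.symm_apply_eq, hf, LinearEquiv.apply_symm_apply]
      trans := by
        rintro R S T ⟨f, hf⟩ ⟨g, hg⟩
        refine ⟨f.trans g, fun x v => ?_⟩
        simp [hf, hg] }

/-- The zero representation. -/
def zero (α : Z2 G) (H : Subgroup G) : TwistedRep α H where
  V := PUnit
  ρ := fun _ => LinearEquiv.refl ℂ _
  map_one := rfl
  map_mul := fun _ _ _ => rfl

/-- Direct sum. -/
def sum (R S : TwistedRep α H) : TwistedRep α H where
  V := R.V × S.V
  ρ := fun x => (R.ρ x).prodCongr (S.ρ x)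
  map_one := by ext v <;> simp [R.map_one, S.map_one]
  map_mul := by
    rintro x y ⟨v, w⟩
    simp [R.map_mul, S.map_mul]

/-- The tensor product of an `α`-twisted and a `β`-twisted representation. -/
def tensor (R : TwistedRep α H) (S : TwistedRep β H) : TwistedRep (α + β) H where
  V := R.V ⊗[ℂ] S.V
  ρ := fun x => TensorProduct.congr (R.ρ x) (S.ρ x)
  map_one := by simp [R.map_one, S.map_one]
  map_mul := by
    intro x y v
    induction v using TensorProduct.induction_on with
    | zero => simp
    | tmul a b =>
      simp only [TensorProduct.congr_tmul, R.map_mul, S.map_mul, AddSubgroup.coe_add,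
        Pi.add_apply, toC_add, TensorProduct.smul_tmul_smul]
    | add a b ha hb => simp only [map_add, smul_add, ha, hb]

theorem conj_cocycle (α : Z2 G) {x y g x' y' : G} (hx : x * g = g * x') (hy : y * g = g * y') :
    (α.1 x g - α.1 g x') + ((α.1 y g - α.1 g y') + α.1 x' y') =
      α.1 x y + (α.1 (x * y) g - α.1 g (x' * y')) := by
  have h1 := α.2 x y g
  have h2 := α.2 x g y'
  have h3 := α.2 g x' y'
  rw [hx] at h2
  rw [hy] at h1
  have h1' : α.1 x y + α.1 (x * y) g - (α.1 y g + α.1 x (g * y')) = 0 := by rw [h1, sub_self]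
  have h2' : α.1 x g + α.1 (g * x') y' - (α.1 g y' + α.1 x (g * y')) = 0 := by rw [h2, sub_self]
  have h3' : α.1 g x' + α.1 (g * x') y' - (α.1 x' y' + α.1 g (x' * y')) = 0 := by
    rw [h3, sub_self]
  rw [← sub_eq_zero, ← sub_zero (0 : Additive Circle)]
  nth_rewrite 2 [← h1']
  rw [← sub_zero (0 : Additive Circle)]
  nth_rewrite 2 [← h3']
  rw [← h2']
  abel

theorem conj_mul (α : Z2 G) {x x' x'' g k : G} (h : x * g = g * x') (h' : x' * k = k * x'') :
    α.1 x (g * k) - α.1 (g * k) x'' =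
      (α.1 x g - α.1 g x') + (α.1 x' k - α.1 k x'') := by
  have h1 := α.2 x g k
  have h2 := α.2 g x' k
  have h3 := α.2 g k x''
  rw [h] at h1
  rw [h'] at h2
  have h1' : α.1 x g + α.1 (g * x') k - (α.1 g k + α.1 x (g * k)) = 0 := by rw [h1, sub_self]
  have h2' : α.1 g x' + α.1 (g * x') k - (α.1 x' k + α.1 g (k * x'')) = 0 := by
    rw [h2, sub_self]
  have h3' : α.1 g k + α.1 (g * k) x'' - (α.1 k x'' + α.1 g (k * x'')) = 0 := by
    rw [h3, sub_self]
  rw [← sub_eq_zero, ← sub_zero (0 : Additive Circle)]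
  nth_rewrite 2 [← h1']
  rw [← sub_zero (0 : Additive Circle)]
  nth_rewrite 2 [← h3']
  rw [← h2']
  abel

theorem cocycle_one (α : Z2 G) (x : G) : α.1 x 1 = α.1 1 x := by
  have h1 : α.1 x 1 = α.1 1 1 := by simpa using α.2 x 1 1
  have h2 : α.1 1 1 = α.1 1 x := by simpa using α.2 1 1 x
  rw [h1, h2]

/-- For `g` with `g⁻¹Ag ⊆ B`, a twisted representation of `B` is restricted to `g⁻¹Ag` and then
transported to `A` by conjugation with `g`, in the twisted sense: `x ∈ A` acts as
`ḡ⁻¹ x̄ ḡ = α(x,g) α(g,g⁻¹xg)⁻¹ \overline{g⁻¹xg}`, computed in the twisted group algebra. -/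
def res {A B : Subgroup G} (g : G) (hg : ∀ a ∈ A, g⁻¹ * a * g ∈ B) (R : TwistedRep α B) :
    TwistedRep α A where
  V := R.V
  ρ := fun x => (R.ρ ⟨g⁻¹ * x * g, hg x x.2⟩).trans
    (LinearEquiv.smulOfNeZero ℂ R.V (toC (α.1 x g - α.1 g (g⁻¹ * x * g))) (toC_ne_zero _))
  map_one := by
    have h : (⟨g⁻¹ * ((1 : A) : G) * g, hg _ (1 : A).2⟩ : B) = 1 := by ext; simp
    rw [h, R.map_one]
    ext v
    have : α.1 ((1 : A) : G) g - α.1 g (g⁻¹ * ((1 : A) : G) * g) = 0 := by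
      simp [cocycle_one α g]
    simp only [this]
    simp [LinearEquiv.smulOfNeZero, LinearEquiv.smulOfUnit, toC_zero]
  map_mul := by
    intro x y v
    have h : (⟨g⁻¹ * x * g, hg x x.2⟩ : B) * ⟨g⁻¹ * y * g, hg y y.2⟩ =
        ⟨g⁻¹ * ((x * y : A) : G) * g, hg _ (x * y).2⟩ := by
      ext; simp [mul_assoc]
    have key := conj_cocycle α (x := (x : G)) (y := (y : G)) (g := g) (x' := g⁻¹ * x * g)
      (y' := g⁻¹ * y * g) (by group) (by group)
    have h' : g⁻¹ * x * g * (g⁻¹ * y * g) = g⁻¹ * ((x * y : A) : G) * g := congrArg Subtype.val h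
    rw [h'] at key
    have key' := congrArg toC key
    simp only [toC_add] at key'
    change toC _ • R.ρ _ (toC _ • R.ρ _ v) = toC _ • toC _ • R.ρ _ v
    rw [map_smul, R.map_mul, h, smul_smul, smul_smul, smul_smul]
    exact congrArg (fun c : ℂ => c • R.ρ _ v) ((mul_assoc _ _ _).trans key')

theorem res_apply {A B : Subgroup G} (g : G) (hg : ∀ a ∈ A, g⁻¹ * a * g ∈ B) (R : TwistedRep α B)
    (x : A) (v : R.V) : (res g hg R).ρ x v =
      toC (α.1 x g - α.1 g (g⁻¹ * x * g)) • R.ρ ⟨g⁻¹ * x * g, hg x x.2⟩ v := rfl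

theorem ρ_congr {B : Subgroup G} (R : TwistedRep α B) {x y : B} (h : (x : G) = y) (v : R.V) :
    R.ρ x v = R.ρ y v := by
  rw [Subtype.ext h]

theorem res_iso {A B : Subgroup G} (g : G) (hg : ∀ a ∈ A, g⁻¹ * a * g ∈ B)
    {R S : TwistedRep α B} (h : Iso R S) : Iso (res g hg R) (res g hg S) := by
  obtain ⟨f, hf⟩ := h
  refine ⟨f, fun x (v : R.V) => ?_⟩
  change f (toC _ • R.ρ _ v) = toC _ • S.ρ _ (f v)
  rw [map_smul, hf]

/-- Conjugating by `1` does nothing. -/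
theorem res_one (hg : ∀ a ∈ H, (1 : G)⁻¹ * a * 1 ∈ H) (R : TwistedRep α H) :
    Iso (res 1 hg R) R := by
  refine ⟨LinearEquiv.refl ℂ R.V, fun x (v : R.V) => ?_⟩
  change toC (α.1 x 1 - α.1 1 ((1 : G)⁻¹ * x * 1)) • R.ρ _ v = R.ρ x v
  have h : α.1 x 1 - α.1 1 ((1 : G)⁻¹ * x * 1) = 0 := by simp [cocycle_one α (x : G)]
  rw [h, toC_zero, one_smul]
  exact ρ_congr R (by simp) v

/-- Restriction is compatible with composition. -/
theorem res_comp {A B C : Subgroup G} (g k : G) (hg : ∀ a ∈ A, g⁻¹ * a * g ∈ B)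
    (hk : ∀ b ∈ B, k⁻¹ * b * k ∈ C) (hgk : ∀ a ∈ A, (g * k)⁻¹ * a * (g * k) ∈ C)
    (R : TwistedRep α C) : Iso (res (g * k) hgk R) (res g hg (res k hk R)) := by
  refine ⟨LinearEquiv.refl ℂ R.V, fun x (v : R.V) => ?_⟩
  have e : (g * k)⁻¹ * (x : G) * (g * k) = k⁻¹ * (g⁻¹ * x * g) * k := by group
  have key := congrArg toC (conj_mul α (x := (x : G)) (x' := g⁻¹ * x * g)
    (x'' := k⁻¹ * (g⁻¹ * x * g) * k) (g := g) (k := k) (by group) (by group))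
  rw [toC_add] at key
  change toC (α.1 x (g * k) - α.1 (g * k) ((g * k)⁻¹ * x * (g * k))) • R.ρ _ v =
    toC _ • toC _ • R.ρ _ v
  rw [smul_smul, ← key]
  exact congrArg₂ (fun a b => toC (α.1 x (g * k) - α.1 (g * k) a) • b) e (ρ_congr R e v)

/-- Conjugating by an element of the group itself does nothing up to isomorphism. -/
theorem res_inner (b : G) (hb : b ∈ H) (hg : ∀ a ∈ H, b⁻¹ * a * b ∈ H) (R : TwistedRep α H) :
    Iso (res b hg R) R := by
  refine ⟨R.ρ ⟨b, hb⟩, fun x (v : R.V) => ?_⟩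
  change R.ρ ⟨b, hb⟩ (toC (α.1 x b - α.1 b (b⁻¹ * x * b)) • R.ρ ⟨b⁻¹ * x * b, hg x x.2⟩ v) =
    R.ρ x (R.ρ ⟨b, hb⟩ v)
  rw [map_smul, R.map_mul, R.map_mul, smul_smul, ← toC_add, sub_add_cancel]
  exact congrArg _ (ρ_congr R (by simp [mul_assoc]) v)

/-- Restriction along `g` depends only on the coset `gB`. -/
theorem res_coset {A B : Subgroup G} (g g' : G) (hg : ∀ a ∈ A, g⁻¹ * a * g ∈ B)
    (hg' : ∀ a ∈ A, g'⁻¹ * a * g' ∈ B) (h : (g : G ⧸ B) = (g' : G ⧸ B)) (R : TwistedRep α B) :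
    Iso (res g' hg' R) (res g hg R) := by
  have hb : g⁻¹ * g' ∈ B := QuotientGroup.eq.1 h
  have hb' : ∀ a ∈ B, (g⁻¹ * g')⁻¹ * a * (g⁻¹ * g') ∈ B := fun a ha =>
    B.mul_mem (B.mul_mem (B.inv_mem hb) ha) hb
  obtain ⟨b, rfl⟩ : ∃ b, g' = g * b := ⟨g⁻¹ * g', by group⟩
  simp only [inv_mul_cancel_left] at hb hb'
  exact (setoid α A).trans (res_comp g b hg hb' hg' R) (res_iso g hg (res_inner b hb hb' R))

theorem res_zero {A B : Subgroup G} (g : G) (hg : ∀ a ∈ A, g⁻¹ * a * g ∈ B) :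
    Iso (res g hg (zero α B)) (zero α A) :=
  ⟨LinearEquiv.refl ℂ PUnit, fun _ _ => rfl⟩

theorem res_sum {A B : Subgroup G} (g : G) (hg : ∀ a ∈ A, g⁻¹ * a * g ∈ B)
    (R S : TwistedRep α B) : Iso (res g hg (sum R S)) (sum (res g hg R) (res g hg S)) :=
  ⟨LinearEquiv.refl ℂ (R.V × S.V), fun _ _ => rfl⟩

theorem res_tensor {A B : Subgroup G} (g : G) (hg : ∀ a ∈ A, g⁻¹ * a * g ∈ B)
    (R : TwistedRep α B) (S : TwistedRep β B) :
    Iso (res g hg (tensor R S)) (tensor (res g hg R) (res g hg S)) := by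
  refine ⟨LinearEquiv.refl ℂ (R.V ⊗[ℂ] S.V), fun x (v : R.V ⊗[ℂ] S.V) => ?_⟩
  have hx := hg x x.2
  let e₁ : R.V ≃ₗ[ℂ] R.V := (res g hg R).ρ x
  let e₂ : S.V ≃ₗ[ℂ] S.V := (res g hg S).ρ x
  have h₁ : ∀ a : R.V, e₁ a = toC (α.1 x g - α.1 g (g⁻¹ * x * g)) • R.ρ ⟨g⁻¹ * x * g, hx⟩ a :=
    fun _ => rfl
  have h₂ : ∀ a : S.V, e₂ a = toC (β.1 x g - β.1 g (g⁻¹ * x * g)) • S.ρ ⟨g⁻¹ * x * g, hx⟩ a :=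
    fun _ => rfl
  change toC ((α + β).1 x g - (α + β).1 g (g⁻¹ * x * g)) •
    (TensorProduct.congr (R.ρ ⟨g⁻¹ * x * g, hx⟩) (S.ρ ⟨g⁻¹ * x * g, hx⟩)) v =
    (TensorProduct.congr e₁ e₂) v
  induction v using TensorProduct.induction_on with
  | zero => simp only [map_zero, smul_zero]
  | tmul a b =>
    rw [TensorProduct.congr_tmul, TensorProduct.congr_tmul, h₁, h₂, TensorProduct.smul_tmul_smul,
      ← toC_add]
    congr 2
    simp only [AddSubgroup.coe_add, Pi.add_apply]
    abel
  | add a b ha hb => simp only [map_add, smul_add, ha, hb]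

theorem sum_iso {R R' S S' : TwistedRep α H} (h : Iso R R') (h' : Iso S S') :
    Iso (sum R S) (sum R' S') := by
  obtain ⟨f, hf⟩ := h
  obtain ⟨g, hg⟩ := h'
  exact ⟨f.prodCongr g, fun x v => Prod.ext (hf x v.1) (hg x v.2)⟩

theorem tensor_iso {R R' : TwistedRep α H} {S S' : TwistedRep β H} (h : Iso R R')
    (h' : Iso S S') : Iso (tensor R S) (tensor R' S') := by
  obtain ⟨f, hf⟩ := h
  obtain ⟨g, hg⟩ := h'
  refine ⟨TensorProduct.congr f g, fun x (v : R.V ⊗[ℂ] S.V) => ?_⟩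
  change TensorProduct.congr f g (TensorProduct.congr (R.ρ x) (S.ρ x) v) =
    TensorProduct.congr (R'.ρ x) (S'.ρ x) (TensorProduct.congr f g v)
  induction v using TensorProduct.induction_on with
  | zero => simp only [map_zero]
  | tmul a b => simp only [TensorProduct.congr_tmul, hf, hg]
  | add a b ha hb => simp only [map_add, ha, hb]

end TwistedRep

/-! ### The twisted representation group -/

section RepGroup

variable {G : Type v} [Group G] (α β : Z2 G) (H : Subgroup G)

/-- The monoid `M_α(H)` of isomorphism classes of `α`-twisted representations of `H`, under direct
sum. -/
def RepMonoid : Type (max 1 v) := Quotient (TwistedRep.setoid α H)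

variable {α H} in
/-- The isomorphism class of a twisted representation. -/
def RepMonoid.mk (R : TwistedRep α H) : RepMonoid α H := Quotient.mk _ R

instance : Zero (RepMonoid α H) := ⟨Quotient.mk _ (TwistedRep.zero α H)⟩

instance : Add (RepMonoid α H) :=
  ⟨Quotient.map₂ TwistedRep.sum fun _ _ h _ _ h' => TwistedRep.sum_iso h h'⟩

instance : AddCommMonoid (RepMonoid α H) where
  add_assoc := by
    rintro ⟨R⟩ ⟨S⟩ ⟨T⟩
    exact Quotient.sound ⟨LinearEquiv.prodAssoc ℂ R.V S.V T.V, fun _ _ => rfl⟩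
  zero_add := by
    rintro ⟨R⟩
    exact Quotient.sound ⟨LinearEquiv.uniqueProd (R := ℂ) (M := R.V) (M₂ := PUnit), fun _ _ => rfl⟩
  add_zero := by
    rintro ⟨R⟩
    exact Quotient.sound ⟨LinearEquiv.prodUnique (R := ℂ) (M := R.V) (M₂ := PUnit), fun _ _ => rfl⟩
  add_comm := by
    rintro ⟨R⟩ ⟨S⟩
    exact Quotient.sound ⟨LinearEquiv.prodComm ℂ R.V S.V, fun _ _ => rfl⟩
  nsmul := nsmulRec

/-- The `α`-twisted representation group `R_α(H)`: the Grothendieck group of `M_α(H)`. -/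
def RepGroup : Type (max 1 v) := Algebra.GrothendieckAddGroup (RepMonoid α H)

instance : AddCommGroup (RepGroup α H) :=
  inferInstanceAs (AddCommGroup (Algebra.GrothendieckAddGroup (RepMonoid α H)))

variable {α β H}

/-- The canonical map `M_α(H) → R_α(H)`. -/
def RepGroup.of : RepMonoid α H →+ RepGroup α H :=
  Algebra.GrothendieckAddGroup.of (M := RepMonoid α H)

/-- The class in `R_α(H)` of a twisted representation. -/
def repClass (R : TwistedRep α H) : RepGroup α H :=
  RepGroup.of (RepMonoid.mk R)

theorem repClass_eq {R S : TwistedRep α H} (h : TwistedRep.Iso R S) :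
    repClass R = repClass S :=
  congrArg (RepGroup.of (α := α) (H := H)) (Quotient.sound h)

/-- Two homomorphisms out of `R_α(H)` that agree on representations are equal. -/
theorem RepGroup.hom_ext {P : Type w} [AddCommGroup P] {f g : RepGroup α H →+ P}
    (h : ∀ R : TwistedRep α H, f (repClass R) = g (repClass R)) : f = g := by
  apply (Algebra.GrothendieckAddGroup.lift (M := RepMonoid α H)).symm.injective
  ext ⟨R⟩
  exact h R

/-- A homomorphism from `M_α(H)` to a group extends to `R_α(H)`. -/
def RepGroup.lift {P : Type w} [AddCommGroup P] (f : RepMonoid α H →+ P) : RepGroup α H →+ P :=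
  Algebra.GrothendieckAddGroup.lift f

theorem RepGroup.lift_class {P : Type w} [AddCommGroup P] (f : RepMonoid α H →+ P)
    (R : TwistedRep α H) : RepGroup.lift f (repClass R) = f (RepMonoid.mk R) :=
  DFunLike.congr_fun ((Algebra.GrothendieckAddGroup.lift (M := RepMonoid α H)).symm_apply_apply f)
    (RepMonoid.mk R)

/-- The homomorphism `R_α(B) → R_α(A)` induced by `TwistedRep.res g`. -/
def RepGroup.res {A B : Subgroup G} (g : G) (hg : ∀ a ∈ A, g⁻¹ * a * g ∈ B) :
    RepGroup α B →+ RepGroup α A :=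
  RepGroup.lift
    { toFun := Quotient.lift (fun R => repClass (TwistedRep.res g hg R))
        fun _ _ h => repClass_eq (TwistedRep.res_iso g hg h)
      map_zero' := (repClass_eq (TwistedRep.res_zero g hg)).trans
        (RepGroup.of (α := α) (H := A)).map_zero
      map_add' := by
        rintro ⟨R⟩ ⟨S⟩
        exact (repClass_eq (TwistedRep.res_sum g hg R S)).trans
          ((RepGroup.of (α := α) (H := A)).map_add
            (Quotient.mk _ (TwistedRep.res g hg R) : RepMonoid α A)
            (Quotient.mk _ (TwistedRep.res g hg S) : RepMonoid α A)) }

theorem RepGroup.res_class {A B : Subgroup G} (g : G) (hg : ∀ a ∈ A, g⁻¹ * a * g ∈ B)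
    (R : TwistedRep α B) :
    RepGroup.res g hg (repClass R) = repClass (TwistedRep.res g hg R) :=
  RepGroup.lift_class _ R

/-- The tensor product, as a biadditive map on isomorphism classes. -/
def RepMonoid.tensor : RepMonoid α H →+ RepMonoid β H →+ RepMonoid (α + β) H where
  toFun := fun a =>
    { toFun := fun b => Quotient.map₂ TwistedRep.tensor
        (fun _ _ h _ _ h' => TwistedRep.tensor_iso h h') a b
      map_zero' := by
        obtain ⟨R⟩ := a
        refine Quotient.sound ⟨LinearEquiv.ofSubsingleton (R.V ⊗[ℂ] PUnit) PUnit, fun x v => ?_⟩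
        exact Subsingleton.elim (α := PUnit) _ _
      map_add' := by
        obtain ⟨R⟩ := a
        rintro ⟨S⟩ ⟨T⟩
        refine Quotient.sound ⟨TensorProduct.prodRight ℂ ℂ R.V S.V T.V,
          fun x (v : R.V ⊗[ℂ] (S.V × T.V)) => ?_⟩
        change TensorProduct.prodRight ℂ ℂ R.V S.V T.V
          (TensorProduct.congr (R.ρ x) ((S.ρ x).prodCongr (T.ρ x)) v) =
          ((TensorProduct.congr (R.ρ x) (S.ρ x)).prodCongr (TensorProduct.congr (R.ρ x) (T.ρ x)))
            (TensorProduct.prodRight ℂ ℂ R.V S.V T.V v)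
        induction v using TensorProduct.induction_on with
        | zero => simp only [map_zero]
        | tmul a b => simp
        | add a b ha hb => simp only [map_add, ha, hb] }
  map_zero' := by
    ext ⟨S⟩
    refine Quotient.sound ⟨LinearEquiv.ofSubsingleton (PUnit ⊗[ℂ] S.V) PUnit, fun x v => ?_⟩
    exact Subsingleton.elim (α := PUnit) _ _
  map_add' := by
    rintro ⟨R⟩ ⟨S⟩
    ext ⟨T⟩
    refine Quotient.sound ⟨TensorProduct.prodLeft ℂ ℂ R.V S.V T.V,
      fun x (v : (R.V × S.V) ⊗[ℂ] T.V) => ?_⟩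
    change TensorProduct.prodLeft ℂ ℂ R.V S.V T.V
      (TensorProduct.congr ((R.ρ x).prodCongr (S.ρ x)) (T.ρ x) v) =
      ((TensorProduct.congr (R.ρ x) (T.ρ x)).prodCongr (TensorProduct.congr (S.ρ x) (T.ρ x)))
        (TensorProduct.prodLeft ℂ ℂ R.V S.V T.V v)
    induction v using TensorProduct.induction_on with
    | zero => simp only [map_zero]
    | tmul a b =>
      obtain ⟨a₁, a₂⟩ := a
      simp
    | add a b ha hb => simp only [map_add, ha, hb]

/-- The pairing `R_α(H) × R_β(H) → R_{α+β}(H)` induced by the tensor product. -/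
def RepGroup.tensor : RepGroup α H →+ RepGroup β H →+ RepGroup (α + β) H :=
  (RepGroup.lift (RepGroup.lift
    ((AddMonoidHom.compHom (RepGroup.of (α := α + β) (H := H))).comp
      RepMonoid.tensor)).flip).flip

theorem RepGroup.tensor_class (R : TwistedRep α H) (S : TwistedRep β H) :
    RepGroup.tensor (repClass R) (repClass S) = repClass (TwistedRep.tensor R S) := by
  rw [RepGroup.tensor, AddMonoidHom.flip_apply, RepGroup.lift_class, AddMonoidHom.flip_apply,
    RepGroup.lift_class]
  rfl

/-- The tensor pairing commutes with restriction. -/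
theorem RepGroup.res_tensor {A B : Subgroup G} (g : G) (hg : ∀ a ∈ A, g⁻¹ * a * g ∈ B)
    (a : RepGroup α B) (b : RepGroup β B) :
    RepGroup.res g hg (RepGroup.tensor a b) =
      RepGroup.tensor (RepGroup.res g hg a) (RepGroup.res g hg b) := by
  have h : (AddMonoidHom.compHom (RepGroup.res (α := α + β) g hg)).comp RepGroup.tensor =
      (RepGroup.tensor.compl₂ (RepGroup.res g hg)).comp (RepGroup.res (α := α) g hg) := by
    refine RepGroup.hom_ext fun R => RepGroup.hom_ext fun S => ?_
    change RepGroup.res g hg (RepGroup.tensor (repClass R) (repClass S)) =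
      RepGroup.tensor (RepGroup.res g hg (repClass R)) (RepGroup.res g hg (repClass S))
    rw [RepGroup.tensor_class, RepGroup.res_class, RepGroup.res_class, RepGroup.res_class,
      RepGroup.tensor_class]
    exact repClass_eq (TwistedRep.res_tensor g hg R S)
  exact DFunLike.congr_fun (DFunLike.congr_fun h a) b

end RepGroup

/-! ### The orbit category and coefficient systems -/

/-- Objects of the orbit category: the orbits `G/H` for the finite subgroups `H` of `G`. -/
structure Orb (G : Type v) [Group G] : Type v where
  H : Subgroup G
  finite : Finite H

/-- Morphisms of the orbit category: the `G`-maps `G/H → G/K`. -/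
instance (G : Type v) [Group G] : Category.{v} (Orb G) where
  Hom A B := (G ⧸ A.H) →[G] (G ⧸ B.H)
  id A := MulActionHom.id G
  comp f g := MulActionHom.comp g f

/-- Coefficient systems: contravariant functors from the orbit category to abelian groups. -/
abbrev Coeff (G : Type v) [Group G] := (Orb G)ᵒᵖ ⥤ AddCommGrpCat.{w}

section Orbit

variable {G : Type v} [Group G] {A B C : Orb G}

/-- A `G`-map `G/H → G/K`, as a function. -/
def Orb.app (φ : A ⟶ B) : (G ⧸ A.H) →[G] (G ⧸ B.H) := φ

/-- An element `g` with `φ(eH) = gK`. -/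
def Orb.rep (φ : A ⟶ B) : G := (Orb.app φ ((1 : G) : G ⧸ A.H)).out

theorem Orb.rep_spec (φ : A ⟶ B) :
    Orb.app φ ((1 : G) : G ⧸ A.H) = ((Orb.rep φ : G) : G ⧸ B.H) :=
  (QuotientGroup.out_eq' _).symm

theorem Orb.app_coe (φ : A ⟶ B) (g : G) :
    Orb.app φ (g : G ⧸ A.H) = ((g * Orb.rep φ : G) : G ⧸ B.H) := by
  have h := map_smul (Orb.app φ) g ((1 : G) : G ⧸ A.H)
  rw [Orb.rep_spec, MulAction.Quotient.smul_coe, MulAction.Quotient.smul_coe] at h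
  simpa using h

theorem Orb.rep_conj (φ : A ⟶ B) : ∀ a ∈ A.H, (Orb.rep φ)⁻¹ * a * Orb.rep φ ∈ B.H := by
  intro a ha
  have h1 : ((a : G) : G ⧸ A.H) = ((1 : G) : G ⧸ A.H) := by
    rw [QuotientGroup.eq]; simpa using ha
  have h2 := congrArg (Orb.app φ) h1
  rw [Orb.app_coe, Orb.app_coe, eq_comm, QuotientGroup.eq] at h2
  simpa [mul_assoc] using h2

theorem Orb.rep_id : ((Orb.rep (𝟙 A) : G) : G ⧸ A.H) = ((1 : G) : G ⧸ A.H) :=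
  (Orb.rep_spec (𝟙 A)).symm

theorem Orb.rep_comp (φ : A ⟶ B) (ψ : B ⟶ C) :
    ((Orb.rep (φ ≫ ψ) : G) : G ⧸ C.H) = ((Orb.rep φ * Orb.rep ψ : G) : G ⧸ C.H) := by
  rw [← Orb.rep_spec, ← Orb.app_coe, ← Orb.rep_spec]
  rfl

end Orbit

section Coefficients

variable {G : Type v} [Group G]

theorem RepGroup.res_coset {α : Z2 G} {A B : Subgroup G} (g g' : G)
    (hg : ∀ a ∈ A, g⁻¹ * a * g ∈ B) (hg' : ∀ a ∈ A, g'⁻¹ * a * g' ∈ B)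
    (h : (g : G ⧸ B) = (g' : G ⧸ B)) (x : RepGroup α B) :
    RepGroup.res g hg x = RepGroup.res g' hg' x := by
  refine DFunLike.congr_fun (RepGroup.hom_ext fun R => ?_) x
  rw [RepGroup.res_class, RepGroup.res_class]
  exact repClass_eq (TwistedRep.res_coset g' g hg' hg h.symm R)

theorem RepGroup.res_one {α : Z2 G} {A : Subgroup G} (hg : ∀ a ∈ A, (1 : G)⁻¹ * a * 1 ∈ A)
    (x : RepGroup α A) : RepGroup.res 1 hg x = x := by
  refine DFunLike.congr_fun (g := AddMonoidHom.id _) (RepGroup.hom_ext fun R => ?_) x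
  rw [RepGroup.res_class]
  exact repClass_eq (TwistedRep.res_one hg R)

theorem RepGroup.res_comp {α : Z2 G} {A B C : Subgroup G} (g k : G)
    (hg : ∀ a ∈ A, g⁻¹ * a * g ∈ B) (hk : ∀ b ∈ B, k⁻¹ * b * k ∈ C)
    (hgk : ∀ a ∈ A, (g * k)⁻¹ * a * (g * k) ∈ C) (x : RepGroup α C) :
    RepGroup.res (g * k) hgk x = RepGroup.res g hg (RepGroup.res k hk x) := by
  refine DFunLike.congr_fun
    (g := (RepGroup.res g hg).comp (RepGroup.res k hk)) (RepGroup.hom_ext fun R => ?_) x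
  rw [AddMonoidHom.comp_apply, RepGroup.res_class, RepGroup.res_class, RepGroup.res_class]
  exact repClass_eq (TwistedRep.res_comp g k hg hk hgk R)

/-- The coefficient system `R_α`: its value at `G/H` is `R_α(H)`, and a `G`-map `G/H → G/K` with
`eH ↦ gK` induces restriction to `g⁻¹Hg ⊆ K` followed by (twisted) conjugation by `g`. This does
not depend on the choice of `g` in its coset, by `RepGroup.res_coset`. -/
def repCoeff (α : Z2 G) : Coeff.{v, max 1 v} G where
  obj A := AddCommGrpCat.of (RepGroup α A.unop.H)
  map φ := AddCommGrpCat.ofHom (RepGroup.res (Orb.rep φ.unop) (Orb.rep_conj φ.unop))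
  map_id A := by
    ext x
    have h1 : ∀ a ∈ A.unop.H, (1 : G)⁻¹ * a * 1 ∈ A.unop.H := fun a ha => by simpa using ha
    exact (RepGroup.res_coset _ 1 _ h1 Orb.rep_id x).trans (RepGroup.res_one h1 x)
  map_comp {A B C} φ ψ := by
    ext x
    have h : ∀ a ∈ C.unop.H, (Orb.rep ψ.unop * Orb.rep φ.unop)⁻¹ * a *
        (Orb.rep ψ.unop * Orb.rep φ.unop) ∈ A.unop.H := by
      intro a ha
      have := Orb.rep_conj φ.unop _ (Orb.rep_conj ψ.unop a ha)
      simpa [mul_assoc] using this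
    exact (RepGroup.res_coset _ _ _ h (Orb.rep_comp ψ.unop φ.unop) x).trans
      (RepGroup.res_comp _ _ _ _ h x)

/-- The abelian group `Hom(F, M)` of natural transformations between two coefficient systems
(which may take values in different universes). -/
def NatHom (F : Coeff.{v, w₁} G) (M : Coeff.{v, w₂} G) :
    AddSubgroup (∀ A : Orb G, F.obj (op A) →+ M.obj (op A)) where
  carrier := {f | ∀ (A B : Orb G) (φ : A ⟶ B) (x : F.obj (op B)),
    f A (F.map φ.op x) = M.map φ.op (f B x)}
  zero_mem' := by
    intro A B φ x
    simp
  add_mem' := by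
    intro f g hf hg A B φ x
    simp [hf A B φ x, hg A B φ x]
  neg_mem' := by
    intro f hf A B φ x
    simp [hf A B φ x]

/-- Precomposition with a morphism of coefficient systems. -/
def NatHom.precomp {F F' : Coeff.{v, w₁} G} (θ : F ⟶ F') (M : Coeff.{v, w₂} G) :
    NatHom F' M →+ NatHom F M where
  toFun f := ⟨fun A => (f.1 A).comp (θ.app (op A)).hom, fun A B φ x => by
    have h := ConcreteCategory.congr_hom (θ.naturality φ.op) x
    have h' := f.2 A B φ (θ.app (op B) x)
    simp only [AddMonoidHom.comp_apply]
    exact (congrArg (f.1 A) h).trans h'⟩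
  map_zero' := by ext; simp
  map_add' f g := by ext; simp

theorem NatHom.precomp_comp {F F' F'' : Coeff.{v, w₁} G} (θ : F ⟶ F') (θ' : F' ⟶ F'')
    (M : Coeff.{v, w₂} G) (f : NatHom F'' M) :
    NatHom.precomp θ M (NatHom.precomp θ' M f) = NatHom.precomp (θ ≫ θ') M f := by
  ext; rfl

/-! ### Cohomology of a chain complex of coefficient systems -/

variable (K L : ChainComplex (Coeff.{v, w₁} G) ℕ) (M : Coeff.{v, w₂} G)

/-- The coboundary `δ = Hom(∂, id)` of the cochain complex `Hom(K, M)`. -/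
def delta (n : ℕ) : NatHom (K.X n) M →+ NatHom (K.X (n + 1)) M :=
  NatHom.precomp (K.d (n + 1) n) M

/-- The cocycles of `Hom(K, M)`. -/
def cocycles (n : ℕ) : AddSubgroup (NatHom (K.X n) M) := (delta K M n).ker

/-- The coboundaries of `Hom(K, M)`. -/
def coboundaries : (n : ℕ) → AddSubgroup (NatHom (K.X n) M)
  | 0 => ⊥
  | n + 1 => (delta K M n).range

/-- The cohomology of the cochain complex `Hom(K, M)`. -/
def Coh (n : ℕ) : Type (max v w₁ w₂) :=
  cocycles K M n ⧸ (coboundaries K M n).addSubgroupOf (cocycles K M n)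

instance (n : ℕ) : AddCommGroup (Coh K M n) :=
  inferInstanceAs
    (AddCommGroup (cocycles K M n ⧸ (coboundaries K M n).addSubgroupOf (cocycles K M n)))

variable {K L M}

/-- The cohomology class of a cocycle. -/
def Coh.mk {n : ℕ} : cocycles K M n →+ Coh K M n :=
  QuotientAddGroup.mk' ((coboundaries K M n).addSubgroupOf (cocycles K M n))

theorem precomp_delta (θ : K ⟶ L) (n : ℕ) (f : NatHom (L.X n) M) :
    NatHom.precomp (θ.f (n + 1)) M (delta L M n f) = delta K M n (NatHom.precomp (θ.f n) M f) := by
  rw [delta, delta, NatHom.precomp_comp, NatHom.precomp_comp, θ.comm]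

theorem precomp_mem_cocycles (θ : K ⟶ L) {n : ℕ} {f : NatHom (L.X n) M}
    (hf : f ∈ cocycles L M n) : NatHom.precomp (θ.f n) M f ∈ cocycles K M n := by
  have h : delta L M n f = 0 := hf
  change delta K M n _ = 0
  rw [← precomp_delta, h, map_zero]

/-- The map in cohomology induced by a chain map. -/
def Coh.map (θ : K ⟶ L) (M : Coeff.{v, w₂} G) (n : ℕ) : Coh L M n →+ Coh K M n :=
  QuotientAddGroup.map _ _
    (((NatHom.precomp (θ.f n) M).comp (cocycles L M n).subtype).codRestrict (cocycles K M n)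
      fun f => precomp_mem_cocycles θ f.2)
    (by
      rintro ⟨f, hf⟩ h
      change NatHom.precomp (θ.f n) M f ∈ coboundaries K M n
      change f ∈ coboundaries L M n at h
      cases n with
      | zero =>
        have h0 : f = 0 := h
        rw [h0, map_zero]
        exact zero_mem _
      | succ n =>
        obtain ⟨e, rfl⟩ : ∃ e, delta L M n e = f := h
        exact ⟨NatHom.precomp (θ.f n) M e, (precomp_delta θ n e).symm⟩)

theorem Coh.map_mk (θ : K ⟶ L) {n : ℕ} (f : NatHom (L.X n) M) (hf : f ∈ cocycles L M n) :
    Coh.map θ M n (Coh.mk ⟨f, hf⟩) =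
      Coh.mk ⟨NatHom.precomp (θ.f n) M f, precomp_mem_cocycles θ hf⟩ := rfl

end Coefficients

/-! ### Singular chains -/

section Singular

variable (X : Type u) [TopologicalSpace X]

/-- The group of singular `n`-chains of `X` (with integer coefficients). -/
abbrev SingChain (n : ℕ) : Type u := C(stdSimplex ℝ (Fin (n + 1)), X) →₀ ℤ

/-- The affine map of standard simplices given by a map of vertices. -/
def simplexMap {m n : ℕ} (f : Fin (m + 1) → Fin (n + 1)) :
    C(stdSimplex ℝ (Fin (m + 1)), stdSimplex ℝ (Fin (n + 1))) :=
  ⟨stdSimplex.map f, stdSimplex.continuous_map f⟩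

theorem simplexMap_comp {l m n : ℕ} (f : Fin (l + 1) → Fin (m + 1))
    (g : Fin (m + 1) → Fin (n + 1)) :
    (simplexMap g).comp (simplexMap f) = simplexMap (g ∘ f) := by
  ext1 x
  exact stdSimplex.map_comp_apply f g x

variable {X}

/-- The homomorphism on singular chains given by precomposition with a map of simplices. -/
def precompChain {m n : ℕ} (θ : C(stdSimplex ℝ (Fin (m + 1)), stdSimplex ℝ (Fin (n + 1)))) :
    SingChain X n →+ SingChain X m :=
  Finsupp.mapDomain.addMonoidHom fun σ => σ.comp θ

theorem precompChain_single {m n : ℕ}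
    (θ : C(stdSimplex ℝ (Fin (m + 1)), stdSimplex ℝ (Fin (n + 1))))
    (σ : C(stdSimplex ℝ (Fin (n + 1)), X)) (k : ℤ) :
    precompChain θ (Finsupp.single σ k) = Finsupp.single (σ.comp θ) k :=
  Finsupp.mapDomain_single

/-- The boundary of singular chains, `∂σ = ∑ᵢ (-1)ⁱ σ ∘ dᵢ`. -/
def bdry (n : ℕ) : SingChain X (n + 1) →+ SingChain X n :=
  ∑ i : Fin (n + 2), (-1 : ℤ) ^ (i : ℕ) • precompChain (simplexMap i.succAbove)

theorem bdry_single (n : ℕ) (σ : C(stdSimplex ℝ (Fin (n + 2)), X)) (k : ℤ) :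
    bdry n (Finsupp.single σ k) = ∑ i : Fin (n + 2),
      (-1 : ℤ) ^ (i : ℕ) • Finsupp.single (σ.comp (simplexMap i.succAbove)) k := by
  simp only [bdry, AddMonoidHom.finsetSum_apply, AddMonoidHom.smul_apply, precompChain_single]

theorem bdry_bdry (n : ℕ) (c : SingChain X (n + 2)) : bdry n (bdry (n + 1) c) = 0 := by
  suffices h : (bdry n).comp (bdry (X := X) (n + 1)) = 0 from DFunLike.congr_fun h c
  refine Finsupp.addHom_ext fun σ k => ?_
  rw [AddMonoidHom.comp_apply, AddMonoidHom.zero_apply, bdry_single, map_sum]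
  simp only [map_zsmul, bdry_single, Finset.smul_sum]
  rw [← Finset.sum_product' (f := fun (j : Fin (n + 3)) (i : Fin (n + 2)) =>
    (-1 : ℤ) ^ (j : ℕ) • (-1 : ℤ) ^ (i : ℕ) •
      Finsupp.single ((σ.comp (simplexMap j.succAbove)).comp (simplexMap i.succAbove)) k)]
  let P := Fin (n + 3) × Fin (n + 2)
  let S : Finset P := {ji : P | (ji.1 : ℕ) ≤ (ji.2 : ℕ)}
  rw [Finset.univ_product_univ, ← Finset.sum_add_sum_compl S, ← eq_neg_iff_add_eq_zero,
    ← Finset.sum_neg_distrib]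
  let φ : ∀ ji : P, ji ∈ S → P := fun ji hij =>
    (ji.2.succ, Fin.castLT ji.1 (lt_of_le_of_lt (Finset.mem_filter.mp hij).right (Fin.is_lt ji.2)))
  apply Finset.sum_bij φ
  · intro ij hij
    simp_rw [S, φ, Finset.compl_filter, Finset.mem_filter_univ, Fin.val_succ,
      Fin.val_castLT] at hij ⊢
    lia
  · rintro ⟨j, i⟩ hij ⟨j', i'⟩ hij' h
    rw [Prod.mk_inj] at h ⊢
    obtain ⟨h1, h2⟩ := h
    have h3 := congrArg Fin.val h2
    simp only [Fin.val_castLT] at h3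
    exact ⟨Fin.ext h3, Fin.succ_injective _ h1⟩
  · rintro ⟨j', i'⟩ hij'
    simp_rw [S, Finset.compl_filter, Finset.mem_filter_univ, not_le] at hij'
    refine ⟨(Fin.castSucc i', j'.pred <| ?_), ?_, ?_⟩
    · rintro rfl
      simp only [Fin.val_zero, not_lt_zero] at hij'
    · simpa [S] using! Nat.le_sub_one_of_lt hij'
    · simp only [φ, Fin.castLT_castSucc, Fin.succ_pred]
  · rintro ⟨j, i⟩ hij
    have hle : (j : ℕ) ≤ (i : ℕ) := (Finset.mem_filter.mp hij).2
    have hcomp : (simplexMap j.succAbove).comp (simplexMap i.succAbove) =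
        (simplexMap (n := n + 2) i.succ.succAbove).comp
          (simplexMap (m := n) (Fin.castLT j (lt_of_le_of_lt hle i.is_lt)).succAbove) := by
      rw [simplexMap_comp, simplexMap_comp]
      congr 1
      funext x
      apply Fin.ext
      simp only [Function.comp_apply, Fin.succAbove, Fin.lt_def, Fin.val_castSucc, Fin.val_succ,
        Fin.val_castLT]
      split_ifs <;> simp_all <;> lia
    simp only [φ, Fin.val_succ, Fin.val_castLT, ContinuousMap.comp_assoc, hcomp]
    rw [smul_smul, smul_smul, ← neg_smul]
    congr 1
    rw [pow_succ]
    ring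

/-- The boundary as a map from degree `n` to degree `n - 1`, zero for `n = 0`. -/
def bdry' : (n : ℕ) → SingChain X n →+ SingChain X (n - 1)
  | 0 => 0
  | n + 1 => bdry n

/-- The subgroup `S_n(U)` of the singular `n`-chains of `X` spanned by the simplices that lie in the
subset `U`, that is, the singular `n`-chains of the subspace `U`. -/
def chainsIn (n : ℕ) (U : Set X) : AddSubgroup (SingChain X n) :=
  AddSubgroup.closure ((fun σ => Finsupp.single σ 1) '' {σ | Set.range σ ⊆ U})

theorem single_mem_chainsIn {n : ℕ} {U : Set X} {σ : C(stdSimplex ℝ (Fin (n + 1)), X)}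
    (h : Set.range σ ⊆ U) : (Finsupp.single σ 1 : SingChain X n) ∈ chainsIn n U :=
  AddSubgroup.subset_closure ⟨σ, h, rfl⟩

theorem chainsIn_le_iff {n : ℕ} {U : Set X} {P : AddSubgroup (SingChain X n)} :
    chainsIn n U ≤ P ↔ ∀ σ : C(stdSimplex ℝ (Fin (n + 1)), X), Set.range σ ⊆ U →
      (Finsupp.single σ 1 : SingChain X n) ∈ P := by
  rw [chainsIn, AddSubgroup.closure_le]
  constructor
  · intro h σ hσ
    exact h ⟨σ, hσ, rfl⟩
  · rintro h _ ⟨σ, hσ, rfl⟩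
    exact h σ hσ

theorem chainsIn_mono {n : ℕ} {U V : Set X} (h : U ⊆ V) : chainsIn n U ≤ chainsIn n V :=
  chainsIn_le_iff.2 fun _ hσ => single_mem_chainsIn (hσ.trans h)

theorem bdry_mem_chainsIn {n : ℕ} {U : Set X} {c : SingChain X (n + 1)}
    (hc : c ∈ chainsIn (n + 1) U) : bdry n c ∈ chainsIn n U := by
  suffices h : chainsIn (n + 1) U ≤ (chainsIn n U).comap (bdry n) from h hc
  refine chainsIn_le_iff.2 fun σ hσ => ?_
  rw [AddSubgroup.mem_comap, bdry_single]
  refine sum_mem fun i _ => zsmul_mem (single_mem_chainsIn ?_) _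
  rintro _ ⟨x, rfl⟩
  exact hσ ⟨_, rfl⟩

variable {Y : Type w} [TopologicalSpace Y] {Z : Type w₁} [TopologicalSpace Z]

/-- The map on singular chains induced by a continuous map. -/
def push (f : C(X, Y)) (n : ℕ) : SingChain X n →+ SingChain Y n :=
  Finsupp.mapDomain.addMonoidHom fun σ => f.comp σ

theorem push_single (f : C(X, Y)) {n : ℕ} (σ : C(stdSimplex ℝ (Fin (n + 1)), X)) (k : ℤ) :
    push f n (Finsupp.single σ k) = Finsupp.single (f.comp σ) k :=
  Finsupp.mapDomain_single

theorem push_id (n : ℕ) (c : SingChain X n) : push (ContinuousMap.id X) n c = c :=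
  DFunLike.congr_fun (f := push (ContinuousMap.id X) n) (g := AddMonoidHom.id _)
    (Finsupp.addHom_ext fun σ k => by rw [push_single]; rfl) c

theorem push_comp (g : C(Y, Z)) (f : C(X, Y)) (n : ℕ) (c : SingChain X n) :
    push (g.comp f) n c = push g n (push f n c) :=
  DFunLike.congr_fun (f := push (g.comp f) n) (g := (push g n).comp (push f n))
    (Finsupp.addHom_ext fun σ k => by
      rw [AddMonoidHom.comp_apply, push_single, push_single, push_single]; rfl) c

theorem push_bdry (f : C(X, Y)) (n : ℕ) (c : SingChain X (n + 1)) :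
    push f n (bdry n c) = bdry n (push f (n + 1) c) :=
  DFunLike.congr_fun (f := (push f n).comp (bdry n)) (g := (bdry n).comp (push f (n + 1)))
    (Finsupp.addHom_ext fun σ k => by
      rw [AddMonoidHom.comp_apply, AddMonoidHom.comp_apply, push_single, bdry_single, bdry_single,
        map_sum]
      simp only [map_zsmul, push_single]
      rfl) c

theorem push_bdry' (f : C(X, Y)) (n : ℕ) (c : SingChain X n) :
    push f (n - 1) (bdry' n c) = bdry' n (push f n c) := by
  cases n with
  | zero => simp [bdry']
  | succ n => exact push_bdry f n c

theorem push_mem_chainsIn {f : C(X, Y)} {U : Set X} {V : Set Y} (h : Set.MapsTo f U V) {n : ℕ}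
    {c : SingChain X n} (hc : c ∈ chainsIn n U) : push f n c ∈ chainsIn n V := by
  suffices h : chainsIn n U ≤ (chainsIn n V).comap (push f n) from h hc
  refine chainsIn_le_iff.2 fun σ hσ => ?_
  rw [AddSubgroup.mem_comap, push_single]
  refine single_mem_chainsIn ?_
  rintro _ ⟨x, rfl⟩
  exact h (hσ ⟨x, rfl⟩)

theorem push_congr {f g : C(X, Y)} {U : Set X} (h : Set.EqOn f g U) {n : ℕ}
    {c : SingChain X n} (hc : c ∈ chainsIn n U) : push f n c = push g n c := by
  suffices h : chainsIn n U ≤ (push f n - push g n).ker by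
    have h' := h hc
    rwa [AddMonoidHom.mem_ker, AddMonoidHom.sub_apply, sub_eq_zero] at h'
  refine chainsIn_le_iff.2 fun σ hσ => ?_
  rw [AddMonoidHom.mem_ker, AddMonoidHom.sub_apply, sub_eq_zero, push_single, push_single]
  congr 1
  ext x
  exact h (hσ ⟨x, rfl⟩)

end Singular

/-! ### Coefficient systems built from subgroups and subquotients of a `G`-module -/

section SubQuot

variable {G : Type v} [Group G] {V : Type u} [AddCommGroup V] {V' : Type u} [AddCommGroup V']

/-- Let `G` act on `V` through `ρ` and let `P(G/H) ⊆ V` be subgroups such that `g ∈ G` maps `P(G/K)`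
to `P(G/H)` if `g⁻¹Hg ⊆ K`, and such that `H` acts trivially on `P(G/H)`. Then `P` is a coefficient
system, where a `G`-map `G/H → G/K` with `eH ↦ gK` acts as `g`. -/
structure IsSubCoeff (ρ : G →* AddMonoid.End V) (P : Orb G → AddSubgroup V) : Prop where
  smul_mem : ∀ (A B : Orb G) (g : G), (∀ a ∈ A.H, g⁻¹ * a * g ∈ B.H) →
    ∀ x ∈ P B, ρ g x ∈ P A
  smul_eq : ∀ (B : Orb G), ∀ b ∈ B.H, ∀ x ∈ P B, ρ b x = x

theorem IsSubCoeff.smul_congr {ρ : G →* AddMonoid.End V} {P : Orb G → AddSubgroup V}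
    (h : IsSubCoeff ρ P) {B : Orb G} {g g' : G} (hg : (g : G ⧸ B.H) = (g' : G ⧸ B.H)) {x : V}
    (hx : x ∈ P B) : ρ g x = ρ g' x := by
  have hb := h.smul_eq B _ (QuotientGroup.eq.1 hg) x hx
  have e : ρ (g * (g⁻¹ * g')) x = ρ g (ρ (g⁻¹ * g') x) := by rw [map_mul]; rfl
  rw [hb, mul_inv_cancel_left] at e
  exact e.symm

/-- The coefficient system given by subgroups `P(G/H)` of a `G`-module. -/
def subCoeff (ρ : G →* AddMonoid.End V) (P : Orb G → AddSubgroup V) (h : IsSubCoeff ρ P) :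
    Coeff.{v, u} G where
  obj A := AddCommGrpCat.of (P A.unop)
  map {B A} φ := AddCommGrpCat.ofHom
    (((ρ (Orb.rep φ.unop) : V →+ V).comp (P B.unop).subtype).codRestrict (P A.unop)
      fun x => h.smul_mem _ _ _ (Orb.rep_conj φ.unop) x x.2)
  map_id A := by
    ext x
    change ρ (Orb.rep (𝟙 A.unop)) x.1 = x.1
    rw [h.smul_congr Orb.rep_id x.2, map_one]
    rfl
  map_comp {C B A} φ ψ := by
    ext x
    change ρ (Orb.rep (ψ.unop ≫ φ.unop)) x.1 = ρ (Orb.rep ψ.unop) (ρ (Orb.rep φ.unop) x.1)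
    rw [h.smul_congr (Orb.rep_comp ψ.unop φ.unop) x.2, map_mul]
    rfl

/-- The coefficient system of subquotients `P(G/H) / Q(G/H)` of a `G`-module. -/
def quotCoeff (ρ : G →* AddMonoid.End V) (P Q : Orb G → AddSubgroup V) (h : IsSubCoeff ρ P)
    (hQ : ∀ (A B : Orb G) (g : G), (∀ a ∈ A.H, g⁻¹ * a * g ∈ B.H) → ∀ x ∈ Q B, ρ g x ∈ Q A) :
    Coeff.{v, u} G where
  obj A := AddCommGrpCat.of (P A.unop ⧸ (Q A.unop).addSubgroupOf (P A.unop))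
  map {B A} φ := AddCommGrpCat.ofHom (QuotientAddGroup.map _ _
    ((subCoeff ρ P h).map φ).hom fun x hx => hQ _ _ _ (Orb.rep_conj φ.unop) x.1 hx)
  map_id A := by
    ext x
    exact congrArg (QuotientAddGroup.mk' _)
      (ConcreteCategory.congr_hom ((subCoeff ρ P h).map_id A) x)
  map_comp {C B A} φ ψ := by
    ext x
    exact congrArg (QuotientAddGroup.mk' _)
      (ConcreteCategory.congr_hom ((subCoeff ρ P h).map_comp φ ψ) x)

variable {ρ : G →* AddMonoid.End V} {P Q : Orb G → AddSubgroup V} {h : IsSubCoeff ρ P}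
  {hQ : ∀ (A B : Orb G) (g : G), (∀ a ∈ A.H, g⁻¹ * a * g ∈ B.H) → ∀ x ∈ Q B, ρ g x ∈ Q A}
  {ρ' : G →* AddMonoid.End V'} {P' Q' : Orb G → AddSubgroup V'} {h' : IsSubCoeff ρ' P'}
  {hQ' : ∀ (A B : Orb G) (g : G), (∀ a ∈ A.H, g⁻¹ * a * g ∈ B.H) → ∀ x ∈ Q' B, ρ' g x ∈ Q' A}

/-- The projection `P → P/Q`. -/
def subToQuot (hQ : ∀ (A B : Orb G) (g : G), (∀ a ∈ A.H, g⁻¹ * a * g ∈ B.H) →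
    ∀ x ∈ Q B, ρ g x ∈ Q A) : subCoeff ρ P h ⟶ quotCoeff ρ P Q h hQ where
  app _ := AddCommGrpCat.ofHom (QuotientAddGroup.mk' _)
  naturality _ _ _ := rfl

/-- The morphism of coefficient systems induced by an equivariant homomorphism. -/
def subMap (f : V →+ V') (hf : ∀ g x, f (ρ g x) = ρ' g (f x))
    (hP : ∀ A, ∀ x ∈ P A, f x ∈ P' A) : subCoeff ρ P h ⟶ subCoeff ρ' P' h' where
  app A := AddCommGrpCat.ofHom
    ((f.comp (P A.unop).subtype).codRestrict (P' A.unop) fun x => hP _ x x.2)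
  naturality _ _ φ := by
    ext x
    exact Subtype.ext (hf _ _)

/-- The morphism of subquotients induced by an equivariant homomorphism. -/
def quotMap (f : V →+ V') (hf : ∀ g x, f (ρ g x) = ρ' g (f x))
    (hP : ∀ A, ∀ x ∈ P A, f x ∈ P' A) (hPQ : ∀ A, ∀ x ∈ Q A, f x ∈ Q' A) :
    quotCoeff ρ P Q h hQ ⟶ quotCoeff ρ' P' Q' h' hQ' where
  app A := AddCommGrpCat.ofHom (QuotientAddGroup.map _ _
    ((subMap (h := h) (h' := h') f hf hP).app A).hom fun x hx => hPQ _ x.1 hx)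
  naturality A B φ := by
    ext x
    induction x using QuotientAddGroup.induction_on with
    | H x => exact congrArg (QuotientAddGroup.mk' _)
              (ConcreteCategory.congr_hom
                ((subMap (h := h) (h' := h') f hf hP).naturality φ) x)

end SubQuot

/-! ### Proper `G`-CW complexes -/

open Topology.RelCWComplex (cell openCell skeletonLT) in
/-- A proper `G`-CW complex for a discrete group `G`: a Hausdorff space with a CW structure and a
`G`-action by homeomorphisms that permutes the open cells, such that an element of `G` which maps
some point of an open cell into that same cell fixes that point (so that, the open cells being
permuted, an element mapping an open cell to itself is the identity on it, and the cells form
equivariant cells `G/H × Dⁿ`); proper means that all stabilizers are finite. -/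
structure ProperGCW (G : Type v) [Group G] : Type (max (u + 1) v) where
  carrier : Type u
  [top : TopologicalSpace carrier]
  [t2 : T2Space carrier]
  [action : MulAction G carrier]
  [continuous_smul : ContinuousConstSMul G carrier]
  [cw : Topology.CWComplex (Set.univ : Set carrier)]
  smul_openCell : ∀ (g : G) (n : ℕ) (e : cell (Set.univ : Set carrier) n),
    ∃ e' : cell (Set.univ : Set carrier) n, (fun x => g • x) '' openCell n e = openCell n e'
  smul_eq : ∀ (g : G) (n : ℕ) (e : cell (Set.univ : Set carrier) n),
    ∀ x ∈ openCell n e, g • x ∈ openCell n e → g • x = x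
  finite_stabilizer : ∀ x : carrier, Finite (MulAction.stabilizer G x)

attribute [instance] ProperGCW.top ProperGCW.t2 ProperGCW.action ProperGCW.continuous_smul
  ProperGCW.cw

instance (G : Type v) [Group G] : CoeSort (ProperGCW.{u} G) (Type u) := ⟨ProperGCW.carrier⟩

section Complexes

variable {G : Type v} [Group G] (X Y : ProperGCW.{u} G)

/-- The union of all cells of dimension less than `n`, i.e. the skeleton `X^{(n-1)}`. -/
def ProperGCW.skelLT (n : ℕ) : Set X :=
  (Topology.RelCWComplex.skeletonLT (Set.univ : Set X) (n : ℕ∞) :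
    Topology.RelCWComplex.Subcomplex (Set.univ : Set X))

/-- The fixed point set `X^H`. -/
def ProperGCW.fixed (A : Orb G) : Set X := {x | ∀ h ∈ A.H, h • x = x}

/-- The action of `g` as a continuous map. -/
def ProperGCW.smulMap (g : G) : C(X, X) := ⟨fun x => g • x, continuous_const_smul g⟩

/-- The action of `G` on singular chains. -/
def ProperGCW.actChain (n : ℕ) : G →* AddMonoid.End (SingChain X n) where
  toFun g := push (X.smulMap g) n
  map_one' := by
    ext1 c
    have h : X.smulMap 1 = ContinuousMap.id X := by ext x; exact one_smul G x
    rw [h]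
    exact push_id n c
  map_mul' g g' := by
    ext1 c
    have h : X.smulMap (g * g') = (X.smulMap g).comp (X.smulMap g') := by
      ext x; exact mul_smul g g' x
    rw [h]
    exact push_comp _ _ n c

variable {X Y}

theorem ProperGCW.smul_skelLT (g : G) (n : ℕ) :
    Set.MapsTo (X.smulMap g) (X.skelLT n) (X.skelLT n) := by
  intro x hx
  obtain ⟨m, hm, e, he⟩ := Topology.CWComplex.mem_skeletonLT_iff.1 hx
  obtain ⟨e', h'⟩ := X.smul_openCell g m e
  refine Topology.CWComplex.mem_skeletonLT_iff.2 ⟨m, hm, e', ?_⟩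
  rw [← h']
  exact ⟨x, he, rfl⟩

theorem ProperGCW.skelLT_succ (n : ℕ) : X.skelLT n ⊆ X.skelLT (n + 1) :=
  Topology.RelCWComplex.skeletonLT_mono (by exact_mod_cast Nat.le_succ n)

theorem ProperGCW.smul_fixed {A B : Orb G} {g : G} (hg : ∀ a ∈ A.H, g⁻¹ * a * g ∈ B.H) :
    Set.MapsTo (X.smulMap g) (X.fixed B) (X.fixed A) := by
  intro x hx a ha
  have h := hx _ (hg a ha)
  change a • g • x = g • x
  rw [← inv_smul_eq_iff] at *
  rw [smul_smul, smul_smul] at *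
  simpa [mul_assoc, mul_smul, inv_smul_eq_iff, eq_comm] using h

theorem ProperGCW.smul_inter (n : ℕ) {A B : Orb G} {g : G} (hg : ∀ a ∈ A.H, g⁻¹ * a * g ∈ B.H) :
    Set.MapsTo (X.smulMap g) (X.skelLT n ∩ X.fixed B) (X.skelLT n ∩ X.fixed A) :=
  fun _ hx => ⟨smul_skelLT g n hx.1, smul_fixed hg hx.2⟩

theorem ProperGCW.isSubCoeff {n : ℕ} {P : Orb G → AddSubgroup (SingChain X n)}
    (h : ∀ (A B : Orb G) (g : G), (∀ a ∈ A.H, g⁻¹ * a * g ∈ B.H) →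
      ∀ c ∈ P B, push (X.smulMap g) n c ∈ P A)
    (hP : ∀ A, P A ≤ chainsIn n (X.fixed A)) : IsSubCoeff (X.actChain n) P where
  smul_mem := h
  smul_eq B b hb c hc := by
    have e : Set.EqOn (X.smulMap b) (ContinuousMap.id X) (X.fixed B) := fun x hx => hx b hb
    exact (push_congr e (hP B hc)).trans (push_id n c)

/-! #### Singular chains -/

variable (X)

theorem ProperGCW.sing_isSubCoeff (n : ℕ) :
    IsSubCoeff (X.actChain n) fun A => chainsIn n (X.fixed A) :=
  isSubCoeff (fun _ _ _ hg _ hc => push_mem_chainsIn (smul_fixed hg) hc) fun _ => le_rfl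

/-- The coefficient system `G/H ↦ S_n(X^H)` of singular chains. -/
def ProperGCW.singCoeff (n : ℕ) : Coeff.{v, u} G :=
  subCoeff (X.actChain n) (fun A => chainsIn n (X.fixed A)) (X.sing_isSubCoeff n)

/-- The boundary of singular chains, as a morphism of coefficient systems. -/
def ProperGCW.singD (n : ℕ) : X.singCoeff (n + 1) ⟶ X.singCoeff n :=
  subMap (bdry n) (fun _ c => (push_bdry _ n c).symm) fun _ _ hc => bdry_mem_chainsIn hc

/-- The chain complex of coefficient systems `G/H ↦ S_*(X^H)`. -/
def ProperGCW.sing : ChainComplex (Coeff.{v, u} G) ℕ :=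
  ChainComplex.of X.singCoeff X.singD fun n => by
    ext A x
    exact Subtype.ext (bdry_bdry n x.1)

theorem ProperGCW.sing_d (n : ℕ) : X.sing.d (n + 1) n = X.singD n :=
  ChainComplex.of_d X.singCoeff X.singD n

/-! #### Cellular chains -/

/-- The relative singular cycles of the pair `((X^{(n)})^H, (X^{(n-1)})^H)`. -/
def ProperGCW.relCycles (n : ℕ) (A : Orb G) : AddSubgroup (SingChain X n) :=
  chainsIn n (X.skelLT (n + 1) ∩ X.fixed A) ⊓
    (chainsIn (n - 1) (X.skelLT n ∩ X.fixed A)).comap (bdry' n)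

theorem ProperGCW.mem_relCycles {n : ℕ} {A : Orb G} {c : SingChain X n} : c ∈ X.relCycles n A ↔
    c ∈ chainsIn n (X.skelLT (n + 1) ∩ X.fixed A) ∧
      bdry' n c ∈ chainsIn (n - 1) (X.skelLT n ∩ X.fixed A) := Iff.rfl

/-- The relative singular boundaries of the pair `((X^{(n)})^H, (X^{(n-1)})^H)`. -/
def ProperGCW.relBoundaries (n : ℕ) (A : Orb G) : AddSubgroup (SingChain X n) :=
  (chainsIn (n + 1) (X.skelLT (n + 1) ∩ X.fixed A)).map (bdry n) ⊔
    chainsIn n (X.skelLT n ∩ X.fixed A)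

theorem ProperGCW.relCycles_isSubCoeff (n : ℕ) : IsSubCoeff (X.actChain n) (X.relCycles n) := by
  refine isSubCoeff (fun A B g hg c hc => X.mem_relCycles.2
    ⟨push_mem_chainsIn (smul_inter _ hg) hc.1, ?_⟩)
    fun A c hc => chainsIn_mono Set.inter_subset_right hc.1
  rw [← push_bdry']
  exact push_mem_chainsIn (smul_inter _ hg) hc.2

variable {X} in
theorem ProperGCW.push_mem_relBoundaries (n : ℕ) (A B : Orb G) (f : C(X, Y))
    (hf : ∀ k, Set.MapsTo f (X.skelLT k ∩ X.fixed B) (Y.skelLT k ∩ Y.fixed A))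
    (c : SingChain X n) (hc : c ∈ X.relBoundaries n B) : push f n c ∈ Y.relBoundaries n A := by
  obtain ⟨_, ⟨e, he, rfl⟩, d, hd, rfl⟩ := AddSubgroup.mem_sup.1 hc
  rw [map_add, push_bdry]
  exact AddSubgroup.mem_sup.2 ⟨_, ⟨_, push_mem_chainsIn (hf _) he, rfl⟩, _,
    push_mem_chainsIn (hf _) hd, rfl⟩

theorem ProperGCW.smul_relBoundaries (n : ℕ) (A B : Orb G) (g : G)
    (hg : ∀ a ∈ A.H, g⁻¹ * a * g ∈ B.H) (c : SingChain X n) (hc : c ∈ X.relBoundaries n B) :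
    X.actChain n g c ∈ X.relBoundaries n A :=
  push_mem_relBoundaries n A B _ (fun _ => smul_inter _ hg) c hc

theorem ProperGCW.bdry_mem_relCycles (n : ℕ) (A : Orb G) (c : SingChain X (n + 1))
    (hc : c ∈ X.relCycles (n + 1) A) : bdry n c ∈ X.relCycles n A := by
  refine X.mem_relCycles.2 ⟨hc.2, ?_⟩
  cases n with
  | zero => exact AddSubgroup.zero_mem _
  | succ n =>
    rw [bdry', bdry_bdry]
    exact AddSubgroup.zero_mem _

theorem ProperGCW.bdry_mem_relBoundaries (n : ℕ) (A : Orb G) (c : SingChain X (n + 1))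
    (hc : c ∈ X.relBoundaries (n + 1) A) : bdry n c ∈ X.relBoundaries n A := by
  obtain ⟨_, ⟨e, he, rfl⟩, d, hd, rfl⟩ := AddSubgroup.mem_sup.1 hc
  rw [map_add, bdry_bdry, zero_add]
  exact AddSubgroup.mem_sup_left ⟨d, hd, rfl⟩

/-- The coefficient system of relative cycles of `((X^{(n)})^H, (X^{(n-1)})^H)`. -/
def ProperGCW.filtCoeff (n : ℕ) : Coeff.{v, u} G :=
  subCoeff (X.actChain n) (X.relCycles n) (X.relCycles_isSubCoeff n)

/-- The coefficient system `G/H ↦ C_n(X)(G/H) = H_n((X^{(n)})^H, (X^{(n-1)})^H; ℤ)`. -/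
def ProperGCW.cellCoeff (n : ℕ) : Coeff.{v, u} G :=
  quotCoeff (X.actChain n) (X.relCycles n) (X.relBoundaries n) (X.relCycles_isSubCoeff n)
    (X.smul_relBoundaries n)

/-- The boundary on relative cycles, as a morphism of coefficient systems. -/
def ProperGCW.filtD (n : ℕ) : X.filtCoeff (n + 1) ⟶ X.filtCoeff n :=
  subMap (bdry n) (fun _ c => (push_bdry _ n c).symm) (X.bdry_mem_relCycles n)

/-- The boundary of cellular chains, i.e. the connecting homomorphism of the triple
`((X^{(n+1)})^H, (X^{(n)})^H, (X^{(n-1)})^H)`: it sends the class of a relative cycle `c` to the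
class of `∂c`. -/
def ProperGCW.cellD (n : ℕ) : X.cellCoeff (n + 1) ⟶ X.cellCoeff n :=
  quotMap (bdry n) (fun _ c => (push_bdry _ n c).symm) (X.bdry_mem_relCycles n)
    (X.bdry_mem_relBoundaries n)

/-- The subcomplex of `S_*(X^H)` of the chains `c` in `S_n((X^{(n)})^H)` with `∂c` in
`S_{n-1}((X^{(n-1)})^H)`. -/
def ProperGCW.filt : ChainComplex (Coeff.{v, u} G) ℕ :=
  ChainComplex.of X.filtCoeff X.filtD fun n => by
    ext A x
    exact Subtype.ext (bdry_bdry n x.1)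

theorem ProperGCW.filt_d (n : ℕ) : X.filt.d (n + 1) n = X.filtD n :=
  ChainComplex.of_d X.filtCoeff X.filtD n

/-- The cellular chain complex of coefficient systems of `X`. -/
def ProperGCW.cellular : ChainComplex (Coeff.{v, u} G) ℕ :=
  ChainComplex.of X.cellCoeff X.cellD fun n => by
    ext A x
    induction x using QuotientAddGroup.induction_on with
    | H x => exact congrArg (QuotientAddGroup.mk' _) (Subtype.ext (bdry_bdry n x.1))

theorem ProperGCW.cellular_d (n : ℕ) : X.cellular.d (n + 1) n = X.cellD n :=
  ChainComplex.of_d X.cellCoeff X.cellD n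

/-- The inclusion of the subcomplex `X.filt` into the singular chains. -/
def ProperGCW.filtToSing : X.filt ⟶ X.sing :=
  ChainComplex.ofHom
    (fun n => (subMap (AddMonoidHom.id _) (fun _ _ => rfl)
      fun _ _ hc => chainsIn_mono Set.inter_subset_right (X.mem_relCycles.1 hc).1 :
        X.filtCoeff n ⟶ X.singCoeff n))
    fun n => by
      rw [sing_d, filt_d]
      rfl

/-- The projection of `X.filt` to the cellular chains. -/
def ProperGCW.filtToCellular : X.filt ⟶ X.cellular :=
  ChainComplex.ofHom
    (fun n => (subToQuot (X.smul_relBoundaries n) : X.filtCoeff n ⟶ X.cellCoeff n))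
    fun n => by
      rw [cellular_d, filt_d]
      rfl

/-- The Bredon cohomology `H^n_G(X; M)`: the cohomology of the cochain complex
`C^n_G(X; M) = Hom(C_n(X), M)`. -/
abbrev Bredon (M : Coeff.{v, w} G) (n : ℕ) : Type (max v u w) := Coh X.cellular M n

/-- The `α`-twisted Bredon cohomology `H^n_G(X; R_α)`. -/
abbrev TwistedCoh (α : Z2 G) (n : ℕ) : Type (max 1 u v) := Bredon X (repCoeff α) n

variable {X}

/-- The identification of twisted Bredon cohomology groups coming from equalities of the twisting
and of the degree. -/
def TwistedCoh.cast {α α' : Z2 G} {n n' : ℕ} (hα : α = α') (hn : n = n') :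
    TwistedCoh X α n →+ TwistedCoh X α' n' := by
  subst hα
  subst hn
  exact AddMonoidHom.id _

/-! #### Equivariant maps -/

variable (X Y) in
/-- Continuous `G`-maps. -/
structure GMap where
  toMap : C(X, Y)
  map_smul : ∀ (g : G) (x : X), toMap (g • x) = g • toMap x

/-- A `G`-map is cellular if it maps each skeleton to the corresponding skeleton. -/
def GMap.IsCellular (f : GMap X Y) : Prop :=
  ∀ n, Set.MapsTo f.toMap (X.skelLT n) (Y.skelLT n)

theorem GMap.map_fixed (f : GMap X Y) (A : Orb G) :
    Set.MapsTo f.toMap (X.fixed A) (Y.fixed A) := fun x hx h hh => by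
  rw [← f.map_smul, hx h hh]

theorem GMap.push_smul (f : GMap X Y) (n : ℕ) (g : G) (c : SingChain X n) :
    push f.toMap n (X.actChain n g c) = Y.actChain n g (push f.toMap n c) := by
  have h : f.toMap.comp (X.smulMap g) = (Y.smulMap g).comp f.toMap := by
    ext x; exact f.map_smul g x
  change push f.toMap n (push (X.smulMap g) n c) = push (Y.smulMap g) n (push f.toMap n c)
  rw [← push_comp, h, push_comp]

/-- The chain map on singular chains induced by a `G`-map. -/
def GMap.sing (f : GMap X Y) : X.sing ⟶ Y.sing :=
  ChainComplex.ofHom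
    (fun n => (subMap (push f.toMap n) (f.push_smul n)
      fun A _ hc => push_mem_chainsIn (f.map_fixed A) hc : X.singCoeff n ⟶ Y.singCoeff n))
    fun n => by
      rw [ProperGCW.sing_d, ProperGCW.sing_d]
      ext A x
      exact Subtype.ext (push_bdry f.toMap n x.1).symm

theorem GMap.push_mem_relCycles (f : GMap X Y) (hf : f.IsCellular) (n : ℕ) (A : Orb G)
    (c : SingChain X n) (hc : c ∈ X.relCycles n A) : push f.toMap n c ∈ Y.relCycles n A := by
  have h : ∀ k, Set.MapsTo f.toMap (X.skelLT k ∩ X.fixed A) (Y.skelLT k ∩ Y.fixed A) :=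
    fun k x hx => ⟨hf k hx.1, f.map_fixed A hx.2⟩
  refine Y.mem_relCycles.2 ⟨push_mem_chainsIn (h _) hc.1, ?_⟩
  rw [← push_bdry']
  exact push_mem_chainsIn (h _) hc.2

/-- The chain map on cellular chains induced by a cellular `G`-map. -/
def GMap.cellular (f : GMap X Y) (hf : f.IsCellular) : X.cellular ⟶ Y.cellular :=
  ChainComplex.ofHom
    (fun n => (quotMap (push f.toMap n) (f.push_smul n) (f.push_mem_relCycles hf n)
      fun A c hc => ProperGCW.push_mem_relBoundaries n A A f.toMap
        (fun k _ hx => ⟨hf k hx.1, f.map_fixed A hx.2⟩) c hc : X.cellCoeff n ⟶ Y.cellCoeff n))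
    fun n => by
      rw [ProperGCW.cellular_d, ProperGCW.cellular_d]
      ext A x
      induction x using QuotientAddGroup.induction_on with
      | H x => exact congrArg (QuotientAddGroup.mk' _) (Subtype.ext (push_bdry f.toMap n x.1).symm)

/-- The map `f^*` on Bredon cohomology induced by a cellular `G`-map `f`. -/
def GMap.pullback (f : GMap X Y) (hf : f.IsCellular) (M : Coeff.{v, w} G) (n : ℕ) :
    Bredon Y M n →+ Bredon X M n :=
  Coh.map (f.cellular hf) M n

/-! #### The cup product of singular cochains -/

/-- The front `n`-face of an `(n+m)`-simplex. -/
def frontFace (n m : ℕ) : C(stdSimplex ℝ (Fin (n + 1)), stdSimplex ℝ (Fin (n + m + 1))) :=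
  simplexMap fun i => Fin.castLE (by omega) i

/-- The back `m`-face of an `(n+m)`-simplex. -/
def backFace (n m : ℕ) : C(stdSimplex ℝ (Fin (m + 1)), stdSimplex ℝ (Fin (n + m + 1))) :=
  simplexMap fun i => Fin.natAdd n i

theorem range_comp_subset {Z : Type w} [TopologicalSpace Z] {k l : ℕ} {U : Set Z}
    {σ : C(stdSimplex ℝ (Fin (l + 1)), Z)}
    (h : Set.range σ ⊆ U) (θ : C(stdSimplex ℝ (Fin (k + 1)), stdSimplex ℝ (Fin (l + 1)))) :
    Set.range (σ.comp θ) ⊆ U := by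
  rintro _ ⟨x, rfl⟩
  exact h ⟨_, rfl⟩

variable {α β : Z2 G} {n m : ℕ}

/-- The value in `R_α(H)` of a singular cochain on a singular simplex in `X^H`. -/
def evalSimplex (s : NatHom (X.sing.X n) (repCoeff α)) (A : Orb G)
    (σ : C(stdSimplex ℝ (Fin (n + 1)), X)) (h : Set.range σ ⊆ X.fixed A) : RepGroup α A.H :=
  s.1 A (⟨Finsupp.single σ 1, single_mem_chainsIn h⟩ : chainsIn n (X.fixed A))

theorem evalSimplex_smul (s : NatHom (X.sing.X n) (repCoeff α)) {A B : Orb G} (φ : A ⟶ B)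
    (σ : C(stdSimplex ℝ (Fin (n + 1)), X)) (h : Set.range σ ⊆ X.fixed B)
    (h' : Set.range ((X.smulMap (Orb.rep φ)).comp σ) ⊆ X.fixed A) :
    evalSimplex s A ((X.smulMap (Orb.rep φ)).comp σ) h' =
      RepGroup.res (Orb.rep φ) (Orb.rep_conj φ) (evalSimplex s B σ h) := by
  refine Eq.trans ?_ (s.2 A B φ (⟨Finsupp.single σ 1, single_mem_chainsIn h⟩ :
    chainsIn n (X.fixed B)))
  refine congrArg (s.1 A) (Subtype.ext ?_)
  exact (push_single (X.smulMap (Orb.rep φ)) σ 1).symm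

open Classical in
/-- The value of the cup product of two singular cochains on a singular simplex of `X^H`: the tensor
product of the values on the front face and on the back face. -/
def cupVal (s : NatHom (X.sing.X n) (repCoeff α)) (t : NatHom (X.sing.X m) (repCoeff β))
    (A : Orb G) (σ : C(stdSimplex ℝ (Fin (n + m + 1)), X)) : RepGroup (α + β) A.H :=
  if h : Set.range σ ⊆ X.fixed A then
    RepGroup.tensor (evalSimplex s A (σ.comp (frontFace n m)) (range_comp_subset h _))
      (evalSimplex t A (σ.comp (backFace n m)) (range_comp_subset h _))
  else 0

/-- The linear extension of `cupVal` to chains. -/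
def cupLin (s : NatHom (X.sing.X n) (repCoeff α)) (t : NatHom (X.sing.X m) (repCoeff β))
    (A : Orb G) : SingChain X (n + m) →+ RepGroup (α + β) A.H :=
  Finsupp.liftAddHom fun σ => zmultiplesHom _ (cupVal s t A σ)

theorem cupLin_single (s : NatHom (X.sing.X n) (repCoeff α)) (t : NatHom (X.sing.X m) (repCoeff β))
    (A : Orb G) (σ : C(stdSimplex ℝ (Fin (n + m + 1)), X)) :
    cupLin s t A (Finsupp.single σ 1) = cupVal s t A σ := by
  simp [cupLin]

/-- The cup product of singular cochains with coefficients in `R_α` and `R_β`: on a singular simplex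
`σ` of `X^H` it is the product, under `R_α(H) ⊗ R_β(H) → R_{α+β}(H)`, of the value of `s` on the
front `n`-face and the value of `t` on the back `m`-face of `σ`. -/
def cupCochain (s : NatHom (X.sing.X n) (repCoeff α)) (t : NatHom (X.sing.X m) (repCoeff β)) :
    NatHom (X.sing.X (n + m)) (repCoeff (α + β)) :=
  ⟨fun A => (cupLin s t A).comp (chainsIn (n + m) (X.fixed A)).subtype, by
    rintro A B φ ⟨c, hc⟩
    change cupLin s t A (push (X.smulMap (Orb.rep φ)) (n + m) c) =
      RepGroup.res (Orb.rep φ) (Orb.rep_conj φ) (cupLin s t B c)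
    suffices h : chainsIn (n + m) (X.fixed B) ≤
        ((cupLin s t A).comp (push (X.smulMap (Orb.rep φ)) (n + m)) -
          (RepGroup.res (Orb.rep φ) (Orb.rep_conj φ)).comp (cupLin s t B)).ker by
      have h' := h hc
      rwa [AddMonoidHom.mem_ker, AddMonoidHom.sub_apply, sub_eq_zero] at h'
    refine chainsIn_le_iff.2 fun σ hσ => ?_
    have hσ' : Set.range ((X.smulMap (Orb.rep φ)).comp σ) ⊆ X.fixed A := by
      rintro _ ⟨x, rfl⟩
      exact ProperGCW.smul_fixed (Orb.rep_conj φ) (hσ ⟨x, rfl⟩)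
    rw [AddMonoidHom.mem_ker, AddMonoidHom.sub_apply, sub_eq_zero, AddMonoidHom.comp_apply,
      AddMonoidHom.comp_apply, push_single, cupLin_single, cupLin_single, cupVal, cupVal,
      dif_pos hσ, dif_pos hσ', RepGroup.res_tensor,
      ← evalSimplex_smul s φ (σ.comp (frontFace n m)) _ (range_comp_subset hσ' (frontFace n m)),
      ← evalSimplex_smul t φ (σ.comp (backFace n m)) _ (range_comp_subset hσ' (backFace n m))]
    rfl⟩

/-- The singular cochain `s` is a cocycle which represents the Bredon cohomology class `x`, i.e. it
corresponds to `x` under the comparison of singular and cellular chains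
`S_*(X^H) ⟵ X.filt ⟶ C_*(X)(G/H)`. -/
def Represents {M : Coeff.{v, w} G} (s : NatHom (X.sing.X n) M) (x : Bredon X M n) : Prop :=
  ∃ hs : s ∈ cocycles X.sing M n,
    Coh.map X.filtToSing M n (Coh.mk ⟨s, hs⟩) = Coh.map X.filtToCellular M n x

/-- `x' = f^* x` for an arbitrary `G`-map `f`: some singular cocycle `s` represents `x` and its
pullback `f^* s` represents `x'`. -/
def IsPullback {M : Coeff.{v, w} G} (f : GMap X Y) (x : Bredon Y M n) (x' : Bredon X M n) : Prop :=
  ∃ s : NatHom (Y.sing.X n) M, Represents s x ∧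
    Represents (NatHom.precomp (f.sing.f n) M s) x'

end Complexes

end TwistedBredon

end

open TwistedBredon

/-!
Twisted Bredon cohomology is the cohomology of the singular cochains with values in `repCoeff α`, and
there the cup product can be written down on cochains.

The comparison with singular cochains. The cellular chains, the singular chains of the fixed point sets
and the filtered subcomplex `F_*` of the latter are complexes of projective coefficient systems, in the
form of the lifting property `HasLifting`. A system whose values have bases given by the fixed points
of a `G`-set with finite stabilizers is projective (`hasLifting_of_basis`), since it is a sum of free
systems on orbits. This covers the singular chains (`ProperGCW.hasLifting_chainsIn`), with the singular
simplices as basis, and the cellular chains (`ProperGCW.hasLifting_cellCoeff`), with the cells as basis.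
The terms of `F_*` are then obtained as direct summands (`ProperGCW.hasLifting_relCoeff`). The maps
`F_* → S_*` and `F_* → C_*` are quasi-isomorphisms at every orbit (`ProperGCW.isQuasiIso_filtToSing`,
`ProperGCW.isQuasiIso_filtToCellular`), and a quasi-isomorphism between bounded below complexes of
projectives induces isomorphisms in cohomology with any coefficients, because its mapping cone is
contractible (`exists_contraction`, `IsQuasiIso.bijective_map`). The resulting isomorphism is
`ProperGCW.toSing`; under it, representatives of a class are the cocycles of the corresponding singular
class (`represents_iff`).

The quasi-isomorphisms and the bases rest on the homology of pairs of consecutive skeleta of the fixed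
point sets, which are closed unions of cells. This is developed from singular chains: affine chains on
simplices are contracted by cones, which gives natural homotopies by acyclic models
(`exists_natural_homotopy`), hence homotopy invariance and, with barycentric subdivision, excision
(`relIso_excision`). These determine the local homology of a cube (`Hrel_cube`) and the effect of
attaching a cell (`Attaches.relAcyclic`, `IsCellCycle.exists_sub_mem`), and compactness of simplices
reduces arbitrary skeleta to finitely many cells (`relAcyclic_skel`, `exists_sub_sum_mem`,
`eq_zero_of_sum_mem`).

The product. The cup product of cochains satisfies the Leibniz rule (`delta_cupCochain`), so it descends
to classes (`exists_represents_cup`), and it commutes with pulling back along equivariant maps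
(`precomp_cupCochain`). For graded commutativity, the operator that reverses the vertices of simplices,
with the sign `(-1)^{n(n+1)/2}`, is a natural chain map and hence naturally homotopic to the identity
(`exists_homotopy_id`); so a cocycle and its reversal represent the same class. Reversal exchanges front
and back faces, and the tensor product of twisted representations is symmetric, which gives
`cupCochain_rev` and with it the commutation rule.
-/

open scoped TensorProduct

noncomputable section

open CategoryTheory Opposite

namespace TwistedBredon

/-! ### Affine simplices and cones -/

/-- The standard `n`-simplex. -/
abbrev Simplex (n : ℕ) : Type := stdSimplex ℝ (Fin (n + 1))

/-- A space in which any finite list of points spans an affine singular simplex. -/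
class AffineModel (M : Type*) [TopologicalSpace M] where
  /-- The affine simplex with given vertices. -/
  aff : ∀ {k : ℕ}, (Fin (k + 1) → M) → C(Simplex k, M)
  aff_vertex : ∀ {k : ℕ} (v : Fin (k + 1) → M) (i : Fin (k + 1)),
    aff v (stdSimplex.vertex i) = v i
  aff_comp_simplexMap : ∀ {k l : ℕ} (v : Fin (l + 1) → M) (f : Fin (k + 1) → Fin (l + 1)),
    (aff v).comp (simplexMap f) = aff (v ∘ f)

open AffineModel

theorem simplexMap_apply {m n : ℕ} (f : Fin (m + 1) → Fin (n + 1)) (x : Simplex m)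
    (j : Fin (n + 1)) : simplexMap f x j = ∑ i with f i = j, x i := by
  change stdSimplex.map f x j = _
  rw [stdSimplex.map_coe, FunOnFinite.linearMap_apply_apply]

theorem sum_simplexMap_smul {m n : ℕ} {E : Type*} [AddCommGroup E] [Module ℝ E]
    (f : Fin (m + 1) → Fin (n + 1)) (x : Simplex m) (w : Fin (n + 1) → E) :
    ∑ j, simplexMap f x j • w j = ∑ i, x i • w (f i) := by
  simp_rw [simplexMap_apply, Finset.sum_smul]
  rw [← Finset.sum_fiberwise Finset.univ f]
  refine Finset.sum_congr rfl fun j _ => Finset.sum_congr rfl fun i hi => ?_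
  rw [(Finset.mem_filter.1 hi).2]

/-- Convex combinations of points of a standard simplex. -/
def Simplex.comb {k n : ℕ} (v : Fin (k + 1) → Simplex n) : C(Simplex k, Simplex n) where
  toFun x := ⟨∑ i, x i • (v i).1, (convex_stdSimplex ℝ _).sum_mem (fun i _ => x.2.1 i) x.2.2
    fun i _ => (v i).2⟩
  continuous_toFun := by
    refine Continuous.subtype_mk (continuous_finsetSum _ fun i _ => ?_) _
    exact ((continuous_apply i).comp continuous_subtype_val).smul continuous_const

theorem Simplex.comb_val {k n : ℕ} (v : Fin (k + 1) → Simplex n) (x : Simplex k) :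
    (Simplex.comb v x).1 = ∑ i, x i • (v i).1 := rfl

instance (n : ℕ) : AffineModel (Simplex n) where
  aff v := Simplex.comb v
  aff_vertex v i := by
    refine Subtype.ext ?_
    rw [Simplex.comb_val]
    simp [Pi.single_apply]
  aff_comp_simplexMap v f := by
    ext1 x
    refine Subtype.ext ?_
    exact sum_simplexMap_smul f x fun j => (v j).1

instance (M N : Type*) [TopologicalSpace M] [TopologicalSpace N] [AffineModel M]
    [AffineModel N] : AffineModel (M × N) where
  aff v := (aff fun i => (v i).1).prodMk (aff fun i => (v i).2)
  aff_vertex v i := Prod.ext (aff_vertex _ i) (aff_vertex _ i)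
  aff_comp_simplexMap v f := by
    ext1 x
    exact Prod.ext (DFunLike.congr_fun (aff_comp_simplexMap (fun i => (v i).1) f) x)
      (DFunLike.congr_fun (aff_comp_simplexMap (fun i => (v i).2) f) x)

section Affine

variable {M N : Type*} [TopologicalSpace M] [TopologicalSpace N] [AffineModel M] [AffineModel N]

/-- Maps that carry affine simplices to affine simplices. -/
def IsAff (f : C(M, N)) : Prop :=
  ∀ (k : ℕ) (v : Fin (k + 1) → M), f.comp (aff v) = aff (f ∘ v)

theorem IsAff.prodMap {M' N' : Type*} [TopologicalSpace M'] [TopologicalSpace N'] [AffineModel M']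
    [AffineModel N'] {f : C(M, N)} {g : C(M', N')} (hf : IsAff f) (hg : IsAff g) :
    IsAff (f.prodMap g) := fun k v => by
  ext1 x
  exact Prod.ext (DFunLike.congr_fun (hf k fun i => (v i).1) x)
    (DFunLike.congr_fun (hg k fun i => (v i).2) x)

theorem IsAff.id : IsAff (ContinuousMap.id M) := fun _ _ => rfl

theorem isAff_comb {k n : ℕ} (v : Fin (k + 1) → Simplex n) : IsAff (Simplex.comb v) := by
  intro l w
  ext1 x
  refine Subtype.ext ?_
  change ∑ i, (∑ j, x j • (w j).1) i • (v i).1 = ∑ j, x j • ∑ i, (w j).1 i • (v i).1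
  simp_rw [Finset.smul_sum, Finset.sum_apply, Finset.sum_smul]
  rw [Finset.sum_comm]
  simp [smul_smul]

theorem simplexMap_eq_comb {m n : ℕ} (f : Fin (m + 1) → Fin (n + 1)) :
    simplexMap f = Simplex.comb fun i => stdSimplex.vertex (f i) := by
  ext1 x
  refine Subtype.ext ?_
  rw [Simplex.comb_val]
  funext j
  change simplexMap f x j = _
  rw [simplexMap_apply, Finset.sum_apply, Finset.sum_filter]
  refine Finset.sum_congr rfl fun i _ => ?_
  simp [Pi.single_apply, eq_comm]

theorem simplexMap_id (n : ℕ) : simplexMap (id : Fin (n + 1) → Fin (n + 1)) =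
    ContinuousMap.id _ := by
  ext1 x
  exact stdSimplex.map_id_apply x

variable (M) in
/-- The chains spanned by affine simplices. -/
def affChains (k : ℕ) : AddSubgroup (SingChain M k) :=
  AddSubgroup.closure (Set.range fun v : Fin (k + 1) → M => Finsupp.single (aff v) 1)

theorem single_aff_mem {k : ℕ} (v : Fin (k + 1) → M) :
    (Finsupp.single (aff v) 1 : SingChain M k) ∈ affChains M k :=
  AddSubgroup.subset_closure ⟨v, rfl⟩

theorem affChains_le_iff {k : ℕ} {P : AddSubgroup (SingChain M k)} :
    affChains M k ≤ P ↔ ∀ v : Fin (k + 1) → M, (Finsupp.single (aff v) 1 : SingChain M k) ∈ P := by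
  rw [affChains, AddSubgroup.closure_le]
  exact Set.range_subset_iff

theorem bdry_mem_affChains {k : ℕ} {c : SingChain M (k + 1)} (hc : c ∈ affChains M (k + 1)) :
    bdry k c ∈ affChains M k := by
  suffices h : affChains M (k + 1) ≤ (affChains M k).comap (bdry k) from h hc
  refine affChains_le_iff.2 fun v => ?_
  rw [AddSubgroup.mem_comap, bdry_single]
  refine sum_mem fun i _ => zsmul_mem ?_ _
  rw [aff_comp_simplexMap]
  exact single_aff_mem _

theorem IsAff.push_mem {f : C(M, N)} (hf : IsAff f) {k : ℕ} {c : SingChain M k}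
    (hc : c ∈ affChains M k) : push f k c ∈ affChains N k := by
  suffices h : affChains M k ≤ (affChains N k).comap (push f k) from h hc
  refine affChains_le_iff.2 fun v => ?_
  rw [AddSubgroup.mem_comap, push_single, hf]
  exact single_aff_mem _

/-- The cone with apex `b` on the affine simplex with the same vertices as a given simplex. -/
def cone (b : M) (k : ℕ) : SingChain M k →+ SingChain M (k + 1) :=
  Finsupp.mapDomain.addMonoidHom fun σ =>
    aff (Fin.cons b fun i => σ (stdSimplex.vertex i) : Fin (k + 2) → M)

theorem cone_single (b : M) {k : ℕ} (v : Fin (k + 1) → M) (a : ℤ) :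
    cone b k (Finsupp.single (aff v) a) = Finsupp.single (aff (Fin.cons b v : Fin (k + 2) → M)) a := by
  refine Finsupp.mapDomain_single.trans ?_
  simp only [aff_vertex]

theorem cone_mem (b : M) {k : ℕ} {c : SingChain M k} : cone b k c ∈ affChains M (k + 1) := by
  induction c using Finsupp.induction_linear with
  | zero => rw [map_zero]; exact zero_mem _
  | add x y hx hy => rw [map_add]; exact add_mem hx hy
  | single σ a =>
    have : cone b k (Finsupp.single σ a) = a • (Finsupp.single (aff
        (Fin.cons b fun i => σ (stdSimplex.vertex i) : Fin (k + 2) → M)) 1) := by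
      rw [Finsupp.smul_single, smul_eq_mul, mul_one]
      exact Finsupp.mapDomain_single
    rw [this]
    exact zsmul_mem (single_aff_mem _) _

/-- The cone contracts the complex of affine chains. -/
theorem bdry_cone (b : M) {k : ℕ} {c : SingChain M (k + 1)} (hc : c ∈ affChains M (k + 1)) :
    bdry (k + 1) (cone b (k + 1) c) = c - cone b k (bdry k c) := by
  suffices h : affChains M (k + 1) ≤ ((bdry (k + 1)).comp (cone b (k + 1)) -
      (AddMonoidHom.id _ - (cone b k).comp (bdry k))).ker by
    have h' := h hc
    rwa [AddMonoidHom.mem_ker, AddMonoidHom.sub_apply, sub_eq_zero] at h'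
  refine affChains_le_iff.2 fun v => ?_
  rw [AddMonoidHom.mem_ker, AddMonoidHom.sub_apply, sub_eq_zero]
  change bdry (k + 1) (cone b (k + 1) (Finsupp.single (aff v) 1)) =
    Finsupp.single (aff v) 1 - cone b k (bdry k (Finsupp.single (aff v) 1))
  rw [cone_single, bdry_single, bdry_single, Fin.sum_univ_succ, map_sum, sub_eq_add_neg,
    ← Finset.sum_neg_distrib]
  congr 1
  · rw [aff_comp_simplexMap]
    simp only [Fin.val_zero, pow_zero, one_smul]
    congr 2
  · refine Finset.sum_congr rfl fun i _ => ?_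
    rw [map_zsmul, aff_comp_simplexMap, aff_comp_simplexMap, cone_single, ← neg_smul]
    congr 1
    · rw [Fin.val_succ, pow_succ]; ring
    · congr 2
      funext j
      refine Fin.cases ?_ (fun j => ?_) j
      · simp
      · simp

theorem bdry_cone_of_cycle (b : M) {k : ℕ} {c : SingChain M (k + 1)}
    (hc : c ∈ affChains M (k + 1)) (h : bdry k c = 0) :
    bdry (k + 1) (cone b (k + 1) c) = c := by
  rw [bdry_cone b hc, h, map_zero, sub_zero]

end Affine

/-! ### Natural operators on singular chains -/

/-- The fundamental simplex of the standard `n`-simplex. -/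
def iota (n : ℕ) : SingChain (Simplex n) n := Finsupp.single (ContinuousMap.id _) 1

theorem iota_mem (n : ℕ) : iota n ∈ affChains (Simplex n) n := by
  have h : (aff fun i => stdSimplex.vertex i : C(Simplex n, Simplex n)) = ContinuousMap.id _ := by
    rw [← simplexMap_id, simplexMap_eq_comb]
    rfl
  rw [iota, ← h]
  exact single_aff_mem _

section NatOp

variable {X Y : Type*} [TopologicalSpace X] [TopologicalSpace Y] {J : Type*} [TopologicalSpace J]

/-- The natural operator `S_n(X) → S_k(X × J)` which sends `σ` to the image under `σ × id` of a
universal chain in `Δⁿ × J`. -/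
def natOp {n k : ℕ} (a : SingChain (Simplex n × J) k) : SingChain X n →+ SingChain (X × J) k :=
  Finsupp.liftAddHom fun σ => zmultiplesHom _ (push (σ.prodMap (ContinuousMap.id J)) k a)

theorem natOp_single {n k : ℕ} (a : SingChain (Simplex n × J) k) (σ : C(Simplex n, X)) :
    natOp a (Finsupp.single σ 1) = push (σ.prodMap (ContinuousMap.id J)) k a := by
  simp [natOp]

theorem hom_ext_single {n : ℕ} {P : Type*} [AddCommGroup P] {f g : SingChain X n →+ P}
    (h : ∀ σ : C(Simplex n, X), f (Finsupp.single σ 1) = g (Finsupp.single σ 1))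
    (c : SingChain X n) : f c = g c := by
  refine DFunLike.congr_fun (Finsupp.addHom_ext fun σ k => ?_) c
  have e : Finsupp.single σ k = k • (Finsupp.single σ 1 : SingChain X n) := by
    rw [Finsupp.smul_single, smul_eq_mul, mul_one]
  rw [e, map_zsmul, map_zsmul, h]

theorem push_natOp {n k : ℕ} (a : SingChain (Simplex n × J) k) (f : C(X, Y)) (c : SingChain X n) :
    push (f.prodMap (ContinuousMap.id J)) k (natOp a c) = natOp a (push f n c) :=
  hom_ext_single (f := (push (f.prodMap (ContinuousMap.id J)) k).comp (natOp a))
    (g := (natOp a).comp (push f n)) (fun σ => by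
      rw [AddMonoidHom.comp_apply, AddMonoidHom.comp_apply, push_single, natOp_single,
        natOp_single, ← push_comp]
      rfl) c

/-- A natural operator is determined by its values on the fundamental simplices. -/
theorem natOp_ext {n k : ℕ} {a : SingChain (Simplex n × J) k}
    {T : SingChain X n →+ SingChain (X × J) k}
    (h : ∀ σ : C(Simplex n, X), push (σ.prodMap (ContinuousMap.id J)) k a =
      T (Finsupp.single σ 1)) (c : SingChain X n) : natOp a c = T c :=
  hom_ext_single (fun σ => by rw [natOp_single, h]) c

theorem bdry_natOp {n k : ℕ} (a : SingChain (Simplex n × J) (k + 1)) (c : SingChain X n) :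
    bdry k (natOp a c) = natOp (bdry k a) c :=
  hom_ext_single (f := (bdry k).comp (natOp a)) (g := natOp (bdry k a)) (fun σ => by
      rw [AddMonoidHom.comp_apply, natOp_single, natOp_single, push_bdry]) c

/-- The composite of the boundary with the natural operator of `a` is again a natural operator; its
universal chain is the value on the fundamental simplex. -/
theorem natOp_natOp_bdry {n k : ℕ} (a : SingChain (Simplex n × J) k) (c : SingChain X (n + 1)) :
    natOp (natOp a (bdry n (iota (n + 1)))) c = natOp a (bdry n c) :=
  natOp_ext (T := (natOp a).comp (bdry n)) (fun σ => by
    rw [push_natOp, push_bdry, iota, push_single]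
    rfl) c

theorem natOp_sub {n k : ℕ} (a b : SingChain (Simplex n × J) k) (c : SingChain X n) :
    natOp (a - b) c = natOp a c - natOp b c :=
  hom_ext_single (f := natOp (a - b)) (g := natOp a - natOp b) (fun σ => by
    rw [AddMonoidHom.sub_apply, natOp_single, natOp_single, natOp_single, map_sub]) c

theorem natOp_mem_affChains [AffineModel J] {n m k : ℕ} {a : SingChain (Simplex n × J) k}
    (ha : a ∈ affChains (Simplex n × J) k) {c : SingChain (Simplex m) n}
    (hc : c ∈ affChains (Simplex m) n) : natOp a c ∈ affChains (Simplex m × J) k := by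
  suffices h : affChains (Simplex m) n ≤ (affChains (Simplex m × J) k).comap (natOp a) from h hc
  refine affChains_le_iff.2 fun v => ?_
  rw [AddSubgroup.mem_comap, natOp_single]
  exact (IsAff.prodMap (isAff_comb v) IsAff.id).push_mem ha

theorem mem_chainsIn_univ {n : ℕ} (c : SingChain X n) : c ∈ chainsIn n Set.univ := by
  induction c using Finsupp.induction_linear with
  | zero => exact zero_mem _
  | add x y hx hy => exact add_mem hx hy
  | single σ a =>
    have : Finsupp.single σ a = a • (Finsupp.single σ 1 : SingChain X n) := by
      rw [Finsupp.smul_single, smul_eq_mul, mul_one]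
    rw [this]
    exact zsmul_mem (single_mem_chainsIn (Set.subset_univ _)) _

theorem natOp_mem_chainsIn {n k : ℕ} (a : SingChain (Simplex n × J) k) {U : Set X}
    {c : SingChain X n} (hc : c ∈ chainsIn n U) : natOp a c ∈ chainsIn k (U ×ˢ Set.univ) := by
  suffices h : chainsIn n U ≤ (chainsIn k (U ×ˢ Set.univ)).comap (natOp a) from h hc
  refine chainsIn_le_iff.2 fun σ hσ => ?_
  rw [AddSubgroup.mem_comap, natOp_single]
  refine push_mem_chainsIn (U := Set.univ) ?_ (mem_chainsIn_univ a)
  exact fun x _ => ⟨hσ ⟨x.1, rfl⟩, Set.mem_univ _⟩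

/-- Acyclic models: a natural chain map given by affine universal chains `c n` in `Δⁿ × J` is
null-homotopic, through affine universal chains, as soon as it is null-homotopic in degree `0`. -/
theorem exists_natural_homotopy [AffineModel J] (j : J) (c : ∀ n, SingChain (Simplex n × J) n)
    (hc : ∀ n, c n ∈ affChains (Simplex n × J) n)
    (hd : ∀ n, bdry n (c (n + 1)) = natOp (c n) (bdry n (iota (n + 1))))
    (h₀ : SingChain (Simplex 0 × J) 1) (h₀_mem : h₀ ∈ affChains (Simplex 0 × J) 1)
    (h₀_bdry : bdry 0 h₀ = c 0) :
    ∃ h : ∀ n, SingChain (Simplex n × J) (n + 1), bdry 0 (h 0) = c 0 ∧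
      ∀ n, bdry (n + 1) (h (n + 1)) + natOp (h n) (bdry n (iota (n + 1))) = c (n + 1) := by
  -- The next chain of the homotopy is the cone on the cycle it has to bound.
  let h : ∀ n, SingChain (Simplex n × J) (n + 1) := fun n => Nat.rec h₀ (fun n hn =>
    cone (stdSimplex.vertex 0, j) (n + 1) (c (n + 1) - natOp hn (bdry n (iota (n + 1))))) n
  have hmem : ∀ n, h n ∈ affChains (Simplex n × J) (n + 1) := by
    intro n
    cases n with
    | zero => exact h₀_mem
    | succ n => exact cone_mem _
  refine ⟨h, h₀_bdry, fun n => ?_⟩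
  have hz : c (n + 1) - natOp (h n) (bdry n (iota (n + 1))) ∈
      affChains (Simplex (n + 1) × J) (n + 1) :=
    sub_mem (hc _) (natOp_mem_affChains (hmem n) (bdry_mem_affChains (iota_mem _)))
  suffices hh : ∀ n, bdry (n + 1) (h (n + 1)) =
      c (n + 1) - natOp (h n) (bdry n (iota (n + 1))) by
    rw [hh, sub_add_cancel]
  intro n
  induction n with
  | zero =>
    refine bdry_cone_of_cycle _ (sub_mem (hc _) (natOp_mem_affChains (hmem 0)
      (bdry_mem_affChains (iota_mem _)))) ?_
    rw [map_sub, hd, bdry_natOp]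
    change natOp (c 0) _ - natOp (bdry 0 h₀) _ = 0
    rw [h₀_bdry, sub_self]
  | succ n ih =>
    refine bdry_cone_of_cycle _ (sub_mem (hc _) (natOp_mem_affChains (hmem (n + 1))
      (bdry_mem_affChains (iota_mem _)))) ?_
    rw [map_sub, hd, bdry_natOp, ih, natOp_sub, natOp_natOp_bdry, bdry_bdry, map_zero, sub_zero,
      sub_self]

theorem natOp_homotopy {c : ∀ n, SingChain (Simplex n × J) n}
    {h : ∀ n, SingChain (Simplex n × J) (n + 1)}
    (hh : ∀ n, bdry (n + 1) (h (n + 1)) + natOp (h n) (bdry n (iota (n + 1))) = c (n + 1)) (n : ℕ)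
    (x : SingChain X (n + 1)) :
    bdry (n + 1) (natOp (h (n + 1)) x) + natOp (h n) (bdry n x) = natOp (c (n + 1)) x := by
  rw [← hh, bdry_natOp, ← natOp_natOp_bdry]
  refine hom_ext_single (f := natOp (bdry (n + 1) (h (n + 1))) +
    natOp (natOp (h n) (bdry n (iota (n + 1)))))
    (g := natOp (bdry (n + 1) (h (n + 1)) + natOp (h n) (bdry n (iota (n + 1))))) (fun σ => ?_) x
  rw [AddMonoidHom.add_apply, natOp_single, natOp_single, natOp_single, map_add]

end NatOp

section NatEnd

variable {X Y : Type*} [TopologicalSpace X] [TopologicalSpace Y] {J : Type*} [TopologicalSpace J]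

/-- The natural operator `S_n(X) → S_k(X)` given by a universal chain in `Δⁿ`. -/
def natEnd {n k : ℕ} (a : SingChain (Simplex n) k) : SingChain X n →+ SingChain X k :=
  Finsupp.liftAddHom fun σ => zmultiplesHom _ (push σ k a)

theorem natEnd_single {n k : ℕ} (a : SingChain (Simplex n) k) (σ : C(Simplex n, X)) :
    natEnd a (Finsupp.single σ 1) = push σ k a := by
  simp [natEnd]

theorem push_natEnd {n k : ℕ} (a : SingChain (Simplex n) k) (f : C(X, Y)) (c : SingChain X n) :
    push f k (natEnd a c) = natEnd a (push f n c) :=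
  hom_ext_single (f := (push f k).comp (natEnd a)) (g := (natEnd a).comp (push f n)) (fun σ => by
      rw [AddMonoidHom.comp_apply, AddMonoidHom.comp_apply, push_single, natEnd_single,
        natEnd_single, push_comp]) c

theorem natEnd_iota (n : ℕ) (c : SingChain X n) : natEnd (iota n) c = c :=
  hom_ext_single (f := natEnd (iota n)) (g := AddMonoidHom.id _) (fun σ => by
    rw [natEnd_single, iota, push_single]; rfl) c

theorem natEnd_mem_chainsIn {n k : ℕ} (a : SingChain (Simplex n) k) {U : Set X}
    {c : SingChain X n} (hc : c ∈ chainsIn n U) : natEnd a c ∈ chainsIn k U := by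
  suffices h : chainsIn n U ≤ (chainsIn k U).comap (natEnd a) from h hc
  refine chainsIn_le_iff.2 fun σ hσ => ?_
  rw [AddSubgroup.mem_comap, natEnd_single]
  exact push_mem_chainsIn (U := Set.univ) (fun x _ => hσ ⟨x, rfl⟩) (mem_chainsIn_univ a)

theorem natEnd_mem_affChains {n m k : ℕ} {a : SingChain (Simplex n) k}
    (ha : a ∈ affChains (Simplex n) k) {c : SingChain (Simplex m) n}
    (hc : c ∈ affChains (Simplex m) n) : natEnd a c ∈ affChains (Simplex m) k := by
  suffices h : affChains (Simplex m) n ≤ (affChains (Simplex m) k).comap (natEnd a) from h hc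
  refine affChains_le_iff.2 fun v => ?_
  rw [AddSubgroup.mem_comap, natEnd_single]
  exact (isAff_comb v).push_mem ha

theorem bdry_natEnd {n : ℕ} {a : SingChain (Simplex n) n} {b : SingChain (Simplex (n + 1)) (n + 1)}
    (h : bdry n b = natEnd a (bdry n (iota (n + 1)))) (c : SingChain X (n + 1)) :
    bdry n (natEnd b c) = natEnd a (bdry n c) :=
  hom_ext_single (f := (bdry n).comp (natEnd b)) (g := (natEnd a).comp (bdry n))
    (fun σ => by
      rw [AddMonoidHom.comp_apply, AddMonoidHom.comp_apply, natEnd_single, ← push_bdry, h,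
        push_natEnd, push_bdry, iota, push_single]
      rfl) c

/-- The embedding of `X` as a slice `X × {j}`. -/
def slice (X : Type*) [TopologicalSpace X] (j : J) : C(X, X × J) :=
  (ContinuousMap.id X).prodMk (ContinuousMap.const X j)

theorem natOp_push_slice {n k : ℕ} (j : J) (a : SingChain (Simplex n) k) (c : SingChain X n) :
    natOp (push (slice _ j) k a) c = push (slice X j) k (natEnd a c) :=
  natOp_ext (T := (push (slice X j) k).comp (natEnd a)) (fun σ => by
    rw [AddMonoidHom.comp_apply, natEnd_single, ← push_comp, ← push_comp]
    rfl) c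

theorem natOp_slice_sub_slice {n : ℕ} (i j : J) (c : SingChain X n) :
    natOp (push (slice _ i) n (iota n) - push (slice _ j) n (iota n)) c =
      push (slice X i) n c - push (slice X j) n c := by
  rw [natOp_sub, natOp_push_slice, natOp_push_slice, natEnd_iota]

theorem aff_const {M : Type*} [TopologicalSpace M] [AffineModel M] (k : ℕ) (x : M) :
    (aff fun _ : Fin (k + 1) => x) = ContinuousMap.const _ x := by
  have h := aff_comp_simplexMap (fun _ : Fin (0 + 1) => x) (fun _ : Fin (k + 1) => 0)
  refine h.symm.trans ?_
  ext1 y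
  have e : simplexMap (fun _ : Fin (k + 1) => (0 : Fin (0 + 1))) y = stdSimplex.vertex 0 :=
    Subsingleton.elim _ _
  rw [ContinuousMap.comp_apply, e, aff_vertex]
  rfl

theorem isAff_slice {M : Type*} [TopologicalSpace M] [AffineModel M] [AffineModel J] (j : J) :
    IsAff (slice M j) := fun k v => by
  ext1 x
  exact Prod.ext rfl (DFunLike.congr_fun (aff_const k j) x).symm

/-- A natural chain endomorphism of the singular chains given by affine universal chains, which is
the identity in degree `0`, is naturally chain homotopic to the identity. -/
theorem exists_homotopy_id {a : ∀ n, SingChain (Simplex n) n}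
    (hmem : ∀ n, a n ∈ affChains (Simplex n) n) (h₀ : a 0 = iota 0)
    (ha : ∀ n, bdry n (a (n + 1)) = natEnd (a n) (bdry n (iota (n + 1)))) :
    ∃ k : ∀ n, SingChain (Simplex n) (n + 1), ∀ {X : Type u} [TopologicalSpace X],
      (∀ x : SingChain X 0, bdry 0 (natEnd (k 0) x) = natEnd (a 0) x - x) ∧
      ∀ (n : ℕ) (x : SingChain X (n + 1)), bdry (n + 1) (natEnd (k (n + 1)) x) +
        natEnd (k n) (bdry n x) = natEnd (a (n + 1)) x - x := by
  let j : Simplex 0 := stdSimplex.vertex 0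
  obtain ⟨h, h0, hh⟩ := exists_natural_homotopy j (fun n => push (slice _ j) n (a n - iota n))
    (fun n => (isAff_slice j).push_mem (sub_mem (hmem n) (iota_mem n)))
    (fun n => by
      rw [natOp_push_slice, ← push_bdry, map_sub, ha]
      congr 1
      generalize bdry n (iota (n + 1)) = c
      refine hom_ext_single (f := natEnd (a n) - AddMonoidHom.id _)
        (g := natEnd (a n - iota n)) (fun σ => ?_) c
      rw [AddMonoidHom.sub_apply, natEnd_single, natEnd_single, map_sub, iota, push_single]
      rfl)
    0 (zero_mem _) (by rw [h₀, sub_self, map_zero, map_zero])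
  -- The homotopy is built with the one-point space `Simplex 0` in the place of `J`, and then projected
  -- from `X × J` back to `X`.
  have key : ∀ (n k : ℕ) {X : Type u} [TopologicalSpace X] (b : SingChain (Simplex n × Simplex 0) k)
      (x : SingChain X n), natEnd (push ContinuousMap.fst k b) x =
        push ContinuousMap.fst k (natOp b x) := fun n k X _ b x =>
    hom_ext_single (f := natEnd (push ContinuousMap.fst k b))
      (g := (push ContinuousMap.fst k).comp (natOp b)) (fun σ => by
        rw [AddMonoidHom.comp_apply, natEnd_single, natOp_single, ← push_comp, ← push_comp]
        rfl) x
  have key' : ∀ (n : ℕ) {X : Type u} [TopologicalSpace X] (x : SingChain X n),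
      push ContinuousMap.fst n (natOp (push (slice _ j) n (a n - iota n)) x) =
        natEnd (a n) x - x := fun n X _ x => by
    rw [natOp_push_slice, ← push_comp]
    refine (push_id n _).trans ?_
    refine hom_ext_single (f := natEnd (a n - iota n))
        (g := natEnd (a n) - AddMonoidHom.id _) (fun σ => ?_) x
    rw [AddMonoidHom.sub_apply, natEnd_single, natEnd_single, map_sub, iota, push_single]
    rfl
  refine ⟨fun n => push ContinuousMap.fst (n + 1) (h n), fun {X} _ => ⟨fun x => ?_, fun n x => ?_⟩⟩
  · rw [key, ← push_bdry, bdry_natOp, h0]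
    exact key' 0 x
  · rw [key, key, ← push_bdry, ← map_add, natOp_homotopy
      (c := fun n => push (slice _ j) n (a n - iota n)) hh]
    exact key' (n + 1) x

end NatEnd

/-! ### Homotopy invariance -/

section Homotopy

/-- The universal prism: the two ends of a cylinder `X × Δ¹` are naturally chain homotopic. -/
theorem exists_prism : ∃ h : ∀ n, SingChain (Simplex n × Simplex 1) (n + 1),
    ∀ {X : Type u} [TopologicalSpace X],
      (∀ x : SingChain X 0, bdry 0 (natOp (h 0) x) =
        push (slice X (stdSimplex.vertex 1)) 0 x - push (slice X (stdSimplex.vertex 0)) 0 x) ∧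
      ∀ (n : ℕ) (x : SingChain X (n + 1)), bdry (n + 1) (natOp (h (n + 1)) x) +
        natOp (h n) (bdry n x) = push (slice X (stdSimplex.vertex 1)) (n + 1) x -
          push (slice X (stdSimplex.vertex 0)) (n + 1) x := by
  let p : Fin 2 → Simplex 0 × Simplex 1 := fun i => (stdSimplex.vertex 0, stdSimplex.vertex i)
  let c : ∀ n, SingChain (Simplex n × Simplex 1) n := fun n =>
    push (slice _ (stdSimplex.vertex 1)) n (iota n) - push (slice _ (stdSimplex.vertex 0)) n (iota n)
  obtain ⟨h, h0, hh⟩ := exists_natural_homotopy (stdSimplex.vertex 0) c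
    (fun n => sub_mem ((isAff_slice _).push_mem (iota_mem n)) ((isAff_slice _).push_mem (iota_mem n)))
    (fun n => by rw [natOp_slice_sub_slice, map_sub, push_bdry, push_bdry])
    -- over a point, the two ends of the cylinder bound the affine path between them
    (Finsupp.single (aff p) 1) (single_aff_mem _) (by
      rw [bdry_single, Fin.sum_univ_two, aff_comp_simplexMap, aff_comp_simplexMap]
      have e : ∀ (i : Fin 2) (j : Fin 2), (∀ l, i.succAbove l = j) →
          aff (p ∘ i.succAbove) = (slice (Simplex 0) (stdSimplex.vertex j)).comp
            (ContinuousMap.id _) := by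
        intro i j hij
        have : p ∘ i.succAbove = fun _ => p j := by
          funext l
          exact congrArg p (hij l)
        rw [this]
        refine (aff_const 0 (p j)).trans ?_
        ext1 x
        exact Prod.ext (Subsingleton.elim _ _) rfl
      rw [e 0 1 (by decide), e 1 0 (by decide)]
      simp only [c, iota, push_single]
      simp [sub_eq_add_neg])
  refine ⟨h, fun {X} _ => ⟨fun x => ?_, fun n x => ?_⟩⟩
  · rw [bdry_natOp, h0, natOp_slice_sub_slice]
  · rw [natOp_homotopy hh, natOp_slice_sub_slice]

end Homotopy

/-! ### Relative singular homology of pairs of subsets -/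

section Relative

variable {X : Type u} [TopologicalSpace X] {Y : Type w} [TopologicalSpace Y]

theorem mem_chainsIn_iff {n : ℕ} {U : Set X} {c : SingChain X n} :
    c ∈ chainsIn n U ↔ ∀ σ ∈ c.support, Set.range σ ⊆ U := by
  classical
  constructor
  · intro hc
    suffices h : chainsIn n U ≤ (Finsupp.supported ℤ ℤ {σ | Set.range σ ⊆ U} :
        Submodule ℤ (SingChain X n)).toAddSubgroup from (Finsupp.mem_supported ℤ c).1 (h hc)
    exact chainsIn_le_iff.2 fun σ hσ => Finsupp.single_mem_supported ℤ 1 hσ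
  · intro h
    rw [← Finsupp.sum_single c]
    refine sum_mem fun σ hσ => ?_
    have : Finsupp.single σ (c σ) = c σ • (Finsupp.single σ 1 : SingChain X n) := by
      rw [Finsupp.smul_single, smul_eq_mul, mul_one]
    rw [this]
    exact zsmul_mem (single_mem_chainsIn (h σ hσ)) _

theorem mem_chainsIn_preimage {f : C(X, Y)} (hf : Function.Injective f) {n : ℕ} {U : Set Y}
    {c : SingChain X n} (hc : push f n c ∈ chainsIn n U) : c ∈ chainsIn n (f ⁻¹' U) := by
  refine mem_chainsIn_iff.2 fun σ hσ => ?_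
  have hinj : Function.Injective fun σ : C(Simplex n, X) => f.comp σ := fun σ τ h => by
    ext x
    exact hf (DFunLike.congr_fun h x)
  have h : f.comp σ ∈ (push f n c).support := by
    rw [Finsupp.mem_support_iff] at hσ ⊢
    exact (Finsupp.mapDomain_apply hinj c σ).trans_ne hσ
  rintro _ ⟨x, rfl⟩
  exact mem_chainsIn_iff.1 hc _ h ⟨x, rfl⟩

/-- The inclusion of a subset. -/
def incl (U : Set X) : C(U, X) := ⟨Subtype.val, continuous_subtype_val⟩

theorem exists_push_incl {n : ℕ} {U : Set X} {c : SingChain X n} (hc : c ∈ chainsIn n U) :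
    ∃ c' : SingChain U n, push (incl U) n c' = c := by
  suffices h : chainsIn n U ≤
      (push (incl U) n).range from h hc
  refine chainsIn_le_iff.2 fun σ hσ => ?_
  refine ⟨Finsupp.single ⟨fun x => ⟨σ x, hσ ⟨x, rfl⟩⟩, by fun_prop⟩ 1, ?_⟩
  rw [push_single]
  rfl

/-- The relative singular cycles of the pair `(U, V)`. -/
def relZ (n : ℕ) (U V : Set X) : AddSubgroup (SingChain X n) :=
  chainsIn n U ⊓ (chainsIn (n - 1) V).comap (bdry' n)

/-- The relative singular boundaries of the pair `(U, V)`, together with the chains of `V`. -/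
def relB (n : ℕ) (U V : Set X) : AddSubgroup (SingChain X n) :=
  (chainsIn (n + 1) U).map (bdry n) ⊔ chainsIn n V

theorem mem_relZ {n : ℕ} {U V : Set X} {c : SingChain X n} :
    c ∈ relZ n U V ↔ c ∈ chainsIn n U ∧ bdry' n c ∈ chainsIn (n - 1) V := Iff.rfl

theorem mem_relB {n : ℕ} {U V : Set X} {c : SingChain X n} :
    c ∈ relB n U V ↔ ∃ e ∈ chainsIn (n + 1) U, ∃ d ∈ chainsIn n V, bdry n e + d = c := by
  rw [relB, AddSubgroup.mem_sup]
  constructor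
  · rintro ⟨_, ⟨e, he, rfl⟩, d, hd, h⟩
    exact ⟨e, he, d, hd, h⟩
  · rintro ⟨e, he, d, hd, h⟩
    exact ⟨_, ⟨e, he, rfl⟩, d, hd, h⟩

theorem bdry_mem_relB {n : ℕ} {U V : Set X} {e : SingChain X (n + 1)}
    (he : e ∈ chainsIn (n + 1) U) : bdry n e ∈ relB n U V :=
  AddSubgroup.mem_sup_left ⟨e, he, rfl⟩

theorem chainsIn_le_relB {n : ℕ} {U V : Set X} : chainsIn n V ≤ relB n U V := le_sup_right

theorem relZ_mono {n : ℕ} {U U' V V' : Set X} (hU : U ⊆ U') (hV : V ⊆ V') :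
    relZ n U V ≤ relZ n U' V' := fun _ hc => ⟨chainsIn_mono hU hc.1, chainsIn_mono hV hc.2⟩

theorem relB_mono {n : ℕ} {U U' V V' : Set X} (hU : U ⊆ U') (hV : V ⊆ V') :
    relB n U V ≤ relB n U' V' :=
  sup_le_sup (AddSubgroup.map_mono (chainsIn_mono hU)) (chainsIn_mono hV)

theorem push_mem_relZ {f : C(X, Y)} {U V : Set X} {U' V' : Set Y} (hU : Set.MapsTo f U U')
    (hV : Set.MapsTo f V V') {n : ℕ} {c : SingChain X n} (hc : c ∈ relZ n U V) :
    push f n c ∈ relZ n U' V' := by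
  refine mem_relZ.2 ⟨push_mem_chainsIn hU hc.1, ?_⟩
  rw [← push_bdry']
  exact push_mem_chainsIn hV hc.2

theorem push_mem_relB {f : C(X, Y)} {U V : Set X} {U' V' : Set Y} (hU : Set.MapsTo f U U')
    (hV : Set.MapsTo f V V') {n : ℕ} {c : SingChain X n} (hc : c ∈ relB n U V) :
    push f n c ∈ relB n U' V' := by
  obtain ⟨e, he, d, hd, rfl⟩ := mem_relB.1 hc
  rw [map_add, push_bdry]
  exact mem_relB.2 ⟨_, push_mem_chainsIn hU he, _, push_mem_chainsIn hV hd, rfl⟩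

theorem bdry'_mem_chainsIn {n : ℕ} {U : Set X} {c : SingChain X n} (hc : c ∈ chainsIn n U) :
    bdry' n c ∈ chainsIn (n - 1) U := by
  cases n with
  | zero => exact zero_mem _
  | succ n => exact bdry_mem_chainsIn hc

theorem bdry'_bdry (n : ℕ) (c : SingChain X (n + 1)) : bdry' n (bdry n c) = 0 := by
  cases n with
  | zero => rfl
  | succ n => exact bdry_bdry n c

theorem chainsIn_le_relZ {n : ℕ} {U V : Set X} (h : V ⊆ U) : chainsIn n V ≤ relZ n U V :=
  fun _ hc => ⟨chainsIn_mono h hc, bdry'_mem_chainsIn hc⟩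

theorem bdry_mem_relZ {n : ℕ} {U V W : Set X} {c : SingChain X (n + 1)}
    (hc : c ∈ relZ (n + 1) U V) : bdry n c ∈ relZ n V W := by
  refine mem_relZ.2 ⟨hc.2, ?_⟩
  rw [bdry'_bdry]
  exact zero_mem _

/-- Homotopic maps of pairs agree on relative homology. -/
theorem push_sub_push_mem_relB (F : C(X × Simplex 1, Y)) {U V : Set X} {U' V' : Set Y}
    (hU : ∀ x ∈ U, ∀ t, F (x, t) ∈ U') (hV : ∀ x ∈ V, ∀ t, F (x, t) ∈ V') {n : ℕ}
    {c : SingChain X n} (hc : c ∈ relZ n U V) :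
    push (F.comp (slice X (stdSimplex.vertex 1))) n c -
      push (F.comp (slice X (stdSimplex.vertex 0))) n c ∈ relB n U' V' := by
  obtain ⟨h, hh⟩ := exists_prism.{u}
  have hop : ∀ {k l : ℕ} {W : Set X} {W' : Set Y} (_ : ∀ x ∈ W, ∀ t, F (x, t) ∈ W')
      (b : SingChain (Simplex k × Simplex 1) l) {c : SingChain X k} (_ : c ∈ chainsIn k W),
      push F l (natOp b c) ∈ chainsIn l W' := fun hW b c hc =>
    push_mem_chainsIn (fun x hx => hW x.1 hx.1 x.2) (natOp_mem_chainsIn b hc)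
  rw [push_comp, push_comp, ← map_sub]
  cases n with
  | zero =>
    rw [← (hh (X := X)).1, push_bdry]
    exact bdry_mem_relB (hop hU _ hc.1)
  | succ n =>
    rw [← (hh (X := X)).2, map_add, push_bdry]
    exact add_mem (bdry_mem_relB (hop hU _ hc.1)) (chainsIn_le_relB (hop hV _ hc.2))

/-- The vanishing of the relative homology group `H_n(U, V)`. -/
def RelAcyclic (n : ℕ) (U V : Set X) : Prop := relZ n U V ≤ relB n U V

theorem RelAcyclic.trans {n : ℕ} {U V W : Set X} (hUV : V ⊆ U) (hVW : W ⊆ V)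
    (h : RelAcyclic n U V) (h' : RelAcyclic n V W) : RelAcyclic n U W := by
  intro c hc
  obtain ⟨e, he, d, hd, rfl⟩ := mem_relB.1 (h (relZ_mono le_rfl hVW hc))
  refine add_mem (bdry_mem_relB he) (relB_mono hUV le_rfl (h' (mem_relZ.2 ⟨hd, ?_⟩)))
  have h2 := (mem_relZ.1 hc).2
  rwa [map_add, bdry'_bdry, zero_add] at h2

/-- If `U` can be deformed into `V` inside `U`, keeping `V` inside `V`, then `H_*(U, V) = 0`. -/
theorem relAcyclic_of_deformation {U V : Set X} (F : C(U × Simplex 1, X))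
    (h₀ : ∀ x : U, F (x, stdSimplex.vertex 0) = x) (h₁ : ∀ x : U, F (x, stdSimplex.vertex 1) ∈ V)
    (hU : ∀ x t, F (x, t) ∈ U) (hV : ∀ (x : U) (t), (x : X) ∈ V → F (x, t) ∈ V) (n : ℕ) :
    RelAcyclic n U V := by
  intro c hc
  obtain ⟨c', rfl⟩ := exists_push_incl hc.1
  have hc' : c' ∈ relZ n Set.univ (Subtype.val ⁻¹' V) := by
    refine mem_relZ.2 ⟨mem_chainsIn_univ _, ?_⟩
    have h2 : push (incl U) (n - 1) (bdry' n c') ∈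
        chainsIn (n - 1) V := by
      rw [push_bdry']
      exact (mem_relZ.1 hc).2
    exact mem_chainsIn_preimage (f := incl U) Subtype.val_injective h2
  have key := push_sub_push_mem_relB F (U' := U) (V' := V) (fun x _ t => hU x t)
    (fun x hx t => hV x t hx) hc'
  have e : F.comp (slice U (stdSimplex.vertex 0)) = incl U := by
    ext x
    exact h₀ x
  rw [e] at key
  have h1 : push (F.comp (slice U (stdSimplex.vertex 1))) n c' ∈ relB n U V :=
    chainsIn_le_relB (push_mem_chainsIn (U := Set.univ) (fun x _ => h₁ x) (mem_chainsIn_univ c'))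
  have h := sub_mem h1 key
  rwa [sub_sub_self] at h

/-- The relative singular homology group `H_n(U, V)` for `V ⊆ U`. -/
def Hrel (n : ℕ) (U V : Set X) : Type u :=
  relZ n U V ⧸ (relB n U V).addSubgroupOf (relZ n U V)

instance (n : ℕ) (U V : Set X) : AddCommGroup (Hrel n U V) :=
  inferInstanceAs (AddCommGroup (relZ n U V ⧸ (relB n U V).addSubgroupOf (relZ n U V)))

/-- The homomorphism `φ` induces an isomorphism `H_n(U, V) → H_m(U', V')`. -/
structure RelIso {n m : ℕ} (φ : SingChain X n →+ SingChain Y m) (U V : Set X) (U' V' : Set Y) :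
    Prop where
  map_relZ : ∀ c ∈ relZ n U V, φ c ∈ relZ m U' V'
  map_relB_iff : ∀ c ∈ relZ n U V, φ c ∈ relB m U' V' ↔ c ∈ relB n U V
  surj : ∀ d ∈ relZ m U' V', ∃ c ∈ relZ n U V, d - φ c ∈ relB m U' V'

theorem RelIso.nonempty_addEquiv {n m : ℕ} {U V : Set X} {U' V' : Set Y}
    {φ : SingChain X n →+ SingChain Y m} (h : RelIso φ U V U' V') :
    Nonempty (Hrel n U V ≃+ Hrel m U' V') := by
  let ψ : relZ n U V →+ relZ m U' V' :=
    (φ.comp (relZ n U V).subtype).codRestrict _ fun c => h.map_relZ c c.2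
  let Φ : Hrel n U V →+ Hrel m U' V' :=
    QuotientAddGroup.map _ _ ψ fun c hc => (h.map_relB_iff c c.2).2 hc
  refine ⟨AddEquiv.ofBijective Φ ⟨?_, ?_⟩⟩
  · rw [injective_iff_map_eq_zero]
    intro x hx
    induction x using QuotientAddGroup.induction_on with
    | H c => exact (QuotientAddGroup.eq_zero_iff _).2
              ((h.map_relB_iff c c.2).1 ((QuotientAddGroup.eq_zero_iff (ψ c)).1 hx))
  · intro y
    induction y using QuotientAddGroup.induction_on with
    | H d =>
      obtain ⟨c, hc, h⟩ := h.surj d d.2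
      refine ⟨QuotientAddGroup.mk' _ ⟨c, hc⟩, ?_⟩
      refine (QuotientAddGroup.eq_iff_sub_mem.2 ?_).symm
      exact h

theorem relAcyclic_iff_subsingleton {n : ℕ} {U V : Set X} :
    RelAcyclic n U V ↔ Subsingleton (Hrel n U V) := by
  constructor
  · intro h
    refine ⟨fun x y => ?_⟩
    induction x using QuotientAddGroup.induction_on with
    | H c =>
      induction y using QuotientAddGroup.induction_on with
      | H d => exact QuotientAddGroup.eq_iff_sub_mem.2 (h (c - d).2)
  · intro h c hc
    exact (QuotientAddGroup.eq_zero_iff (⟨c, hc⟩ : relZ n U V)).1 (Subsingleton.elim (α := Hrel n U V) _ _)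

/-- If `H_*(U, W) = 0`, the connecting homomorphism `H_{k+1}(U, V) → H_k(V, W)` of the triple
`(U, V, W)` is an isomorphism. -/
theorem relIso_bdry {U V W : Set X} (hUV : V ⊆ U) (hVW : W ⊆ V) (h : ∀ k, RelAcyclic k U W)
    (k : ℕ) : RelIso (bdry k) U V V W where
  map_relZ _ hc := bdry_mem_relZ hc
  map_relB_iff c hc := by
    constructor
    · intro hb
      obtain ⟨e, he, d, hd, hed⟩ := mem_relB.1 hb
      have h1 : c - e ∈ relZ (k + 1) U W := by
        refine mem_relZ.2 ⟨sub_mem hc.1 (chainsIn_mono hUV he), ?_⟩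
        change bdry k (c - e) ∈ _
        rw [map_sub, ← hed, add_sub_cancel_left]
        exact hd
      have h2 := add_mem (relB_mono le_rfl hVW (h _ h1)) (chainsIn_le_relB he)
      rwa [sub_add_cancel] at h2
    · intro hb
      obtain ⟨e, he, d, hd, rfl⟩ := mem_relB.1 hb
      rw [map_add, bdry_bdry, zero_add]
      exact bdry_mem_relB hd
  surj d hd := by
    obtain ⟨e, he, p, hp, rfl⟩ := mem_relB.1 (h k (relZ_mono hUV le_rfl hd))
    refine ⟨e, mem_relZ.2 ⟨he, ?_⟩, ?_⟩
    · have h1 := sub_mem (mem_relZ.1 hd).1 (chainsIn_mono hVW hp)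
      rwa [add_sub_cancel_right] at h1
    · rw [add_sub_cancel_left]
      exact chainsIn_le_relB hp

/-- If `H_*(U, V) = 0`, then `H_*(V, W) → H_*(U, W)` is an isomorphism. -/
theorem relIso_id_of_relAcyclic {U V W : Set X} (hUV : V ⊆ U) (hVW : W ⊆ V)
    (h : ∀ k, RelAcyclic k U V) (k : ℕ) : RelIso (AddMonoidHom.id (SingChain X k)) V W U W where
  map_relZ _ hc := relZ_mono hUV le_rfl hc
  map_relB_iff c hc := by
    refine ⟨fun hb => ?_, fun hb => relB_mono hUV le_rfl hb⟩
    obtain ⟨e, he, q, hq, rfl⟩ := mem_relB.1 hb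
    have h1 : e ∈ relZ (k + 1) U V := by
      refine mem_relZ.2 ⟨he, ?_⟩
      have h1 := sub_mem (mem_relZ.1 hc).1 (chainsIn_mono hVW hq)
      rwa [add_sub_cancel_right] at h1
    obtain ⟨f, hf, g, hg, rfl⟩ := mem_relB.1 (h _ h1)
    refine mem_relB.2 ⟨g, hg, q, hq, ?_⟩
    rw [map_add, bdry_bdry, zero_add]
  surj d hd := by
    obtain ⟨e, he, c, hc, rfl⟩ := mem_relB.1 (h k (relZ_mono le_rfl hVW hd))
    refine ⟨c, mem_relZ.2 ⟨hc, ?_⟩, ?_⟩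
    · have h1 := (mem_relZ.1 hd).2
      rwa [map_add, bdry'_bdry, zero_add] at h1
    · rw [AddMonoidHom.id_apply, add_sub_cancel_right]
      exact bdry_mem_relB he

/-- If `H_*(V, W) = 0`, then `H_*(U, W) → H_*(U, V)` is an isomorphism. -/
theorem relIso_id_of_relAcyclic' {U V W : Set X} (hUV : V ⊆ U) (hVW : W ⊆ V)
    (h : ∀ k, RelAcyclic k V W) (k : ℕ) : RelIso (AddMonoidHom.id (SingChain X k)) U W U V where
  map_relZ _ hc := relZ_mono le_rfl hVW hc
  map_relB_iff c hc := by
    refine ⟨fun hb => ?_, fun hb => relB_mono le_rfl hVW hb⟩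
    obtain ⟨e, he, v, hv, rfl⟩ := mem_relB.1 hb
    refine add_mem (bdry_mem_relB he) (relB_mono hUV le_rfl (h k (mem_relZ.2 ⟨hv, ?_⟩)))
    have h1 := (mem_relZ.1 hc).2
    rwa [map_add, bdry'_bdry, zero_add] at h1
  surj d hd := by
    cases k with
    | zero => exact ⟨d, mem_relZ.2 ⟨hd.1, zero_mem _⟩, by simp⟩
    | succ k =>
      obtain ⟨e, he, z, hz, hez⟩ := mem_relB.1 (h k (bdry_mem_relZ (W := W) hd))
      refine ⟨d - e, mem_relZ.2 ⟨sub_mem hd.1 (chainsIn_mono hUV he), ?_⟩, ?_⟩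
      · change bdry k (d - e) ∈ _
        rw [map_sub, ← hez, add_sub_cancel_left]
        exact hz
      · rw [AddMonoidHom.id_apply, sub_sub_cancel]
        exact chainsIn_le_relB he

/-- A homotopy equivalence of pairs induces isomorphisms in relative homology. -/
theorem relIso_push (f : C(X, Y)) (g : C(Y, X)) (hfg : f.comp g = ContinuousMap.id Y)
    (F : C(X × Simplex 1, X)) (h₀ : ∀ x, F (x, stdSimplex.vertex 0) = g (f x))
    (h₁ : ∀ x, F (x, stdSimplex.vertex 1) = x) {U V : Set X} {U' V' : Set Y}
    (hfU : Set.MapsTo f U U') (hfV : Set.MapsTo f V V') (hgU : Set.MapsTo g U' U)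
    (hgV : Set.MapsTo g V' V) (hFU : ∀ x ∈ U, ∀ t, F (x, t) ∈ U)
    (hFV : ∀ x ∈ V, ∀ t, F (x, t) ∈ V) (k : ℕ) : RelIso (push f k) U V U' V' where
  map_relZ c hc := push_mem_relZ hfU hfV hc
  map_relB_iff c hc := by
    refine ⟨fun hb => ?_, fun hb => push_mem_relB hfU hfV hb⟩
    have h := push_sub_push_mem_relB F hFU hFV hc
    have e₀ : F.comp (slice X (stdSimplex.vertex 0)) = g.comp f := by
      ext x
      exact h₀ x
    have e₁ : F.comp (slice X (stdSimplex.vertex 1)) = ContinuousMap.id X := by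
      ext x
      exact h₁ x
    rw [e₀, e₁, push_comp, push_id] at h
    have h' := add_mem h (push_mem_relB hgU hgV hb)
    rwa [sub_add_cancel] at h'
  surj d hd := by
    refine ⟨push g k d, push_mem_relZ hgU hgV hd, ?_⟩
    rw [← push_comp, hfg, push_id, sub_self]
    exact zero_mem _

theorem chainsIn_inter {n : ℕ} {U V : Set X} {c : SingChain X n} (hU : c ∈ chainsIn n U)
    (hV : c ∈ chainsIn n V) : c ∈ chainsIn n (U ∩ V) :=
  mem_chainsIn_iff.2 fun σ hσ =>
    Set.subset_inter (mem_chainsIn_iff.1 hU σ hσ) (mem_chainsIn_iff.1 hV σ hσ)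

end Relative

/-! ### Barycentric subdivision -/

section Subdivision

/-- The barycentric subdivision of the fundamental simplex. -/
def sd : ∀ n, SingChain (Simplex n) n
  | 0 => iota 0
  | n + 1 => cone stdSimplex.barycenter n (natEnd (sd n) (bdry n (iota (n + 1))))

theorem sd_mem (n : ℕ) : sd n ∈ affChains (Simplex n) n := by
  cases n with
  | zero => exact iota_mem 0
  | succ n => exact cone_mem _

/-- The analogue of `bdry_cone_of_cycle` in degree `0`, for the difference of two points. -/
theorem bdry_cone_sub {M : Type*} [TopologicalSpace M] [AffineModel M] (b : M)
    (v w : Fin 1 → M) : bdry 0 (cone b 0 (Finsupp.single (aff v) 1 - Finsupp.single (aff w) 1)) =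
      Finsupp.single (aff v) 1 - Finsupp.single (aff w) 1 := by
  have h : ∀ v : Fin 1 → M, bdry 0 (cone b 0 (Finsupp.single (aff v) 1)) =
      Finsupp.single (aff v) 1 - Finsupp.single (aff fun _ : Fin 1 => b) 1 := fun v => by
    rw [cone_single, bdry_single, Fin.sum_univ_two, aff_comp_simplexMap, aff_comp_simplexMap]
    have e₀ : (Fin.cons b v : Fin 2 → M) ∘ Fin.succAbove 0 = v := by
      funext i; simp
    have e₁ : (Fin.cons b v : Fin 2 → M) ∘ Fin.succAbove 1 = fun _ => b := by
      funext i
      rw [Subsingleton.elim i 0]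
      rfl
    rw [e₀, e₁]
    simp [sub_eq_add_neg]
  rw [map_sub, map_sub, h, h, sub_sub_sub_cancel_right]

theorem bdry_sd (n : ℕ) : bdry n (sd (n + 1)) = natEnd (sd n) (bdry n (iota (n + 1))) := by
  induction n with
  | zero =>
    change bdry 0 (cone _ 0 (natEnd (iota 0) (bdry 0 (iota 1)))) =
      natEnd (iota 0) (bdry 0 (iota 1))
    rw [natEnd_iota]
    have e : bdry 0 (iota 1) =
        Finsupp.single (aff ((fun i => stdSimplex.vertex i : Fin 2 → Simplex 1) ∘
          Fin.succAbove 0) : C(Simplex 0, Simplex 1)) 1 -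
        Finsupp.single (aff ((fun i => stdSimplex.vertex i : Fin 2 → Simplex 1) ∘
          Fin.succAbove 1) : C(Simplex 0, Simplex 1)) 1 := by
      rw [iota, bdry_single, Fin.sum_univ_two, simplexMap_eq_comb, simplexMap_eq_comb]
      simp [sub_eq_add_neg]
      rfl
    rw [e]
    exact bdry_cone_sub _ _ _
  | succ n ih =>
    refine bdry_cone_of_cycle _
      (natEnd_mem_affChains (sd_mem _) (bdry_mem_affChains (iota_mem _))) ?_
    rw [bdry_natEnd ih, bdry_bdry, map_zero]

theorem cone_single_one {M : Type*} [TopologicalSpace M] [AffineModel M] (b : M) {k : ℕ}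
    (τ : C(Simplex k, M)) : cone b k (Finsupp.single τ 1) =
      Finsupp.single (aff (Fin.cons b fun i => τ (stdSimplex.vertex i) : Fin (k + 2) → M)) 1 :=
  Finsupp.mapDomain_single

theorem push_cone {M N : Type*} [TopologicalSpace M] [TopologicalSpace N] [AffineModel M]
    [AffineModel N] {f : C(M, N)} (hf : IsAff f) (b : M) {k : ℕ} (c : SingChain M k) :
    push f (k + 1) (cone b k c) = cone (f b) k (push f k c) :=
  hom_ext_single (f := (push f (k + 1)).comp (cone b k)) (g := (cone (f b) k).comp (push f k))
    (fun σ => by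
      rw [AddMonoidHom.comp_apply, AddMonoidHom.comp_apply, push_single, cone_single_one, cone_single_one,
        push_single, hf]
      congr 2
      funext i
      refine Fin.cases rfl (fun i => rfl) i) c

theorem comb_mem_of_convex {k m : ℕ} {C : Set (Fin (m + 1) → ℝ)} (hC : Convex ℝ C)
    {v : Fin (k + 1) → Simplex m} (hv : ∀ i, (v i).1 ∈ C) (x : Simplex k) :
    (Simplex.comb v x).1 ∈ C :=
  hC.sum_mem (fun i _ => x.2.1 i) x.2.2 fun i _ => hv i

/-- The barycentre of a simplex with `n + 2` vertices of mutual distance at most `D` has distance at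
most `(n + 1) / (n + 2) * D` from each vertex. -/
theorem dist_barycenter_le {n m : ℕ} (v : Fin (n + 2) → Simplex m) {D : ℝ}
    (hv : ∀ i j, dist (v i) (v j) ≤ D) (j : Fin (n + 2)) :
    dist (Simplex.comb v stdSimplex.barycenter) (v j) ≤ (n + 1 : ℕ) / ((n + 1 : ℕ) + 1) * D := by
  have hn : (0 : ℝ) < (n : ℝ) + 2 := by positivity
  have e : (Simplex.comb v stdSimplex.barycenter).1 - (v j).1 =
      ∑ i, ((n : ℝ) + 2)⁻¹ • ((v i).1 - (v j).1) := by
    have hb : ∀ i, (stdSimplex.barycenter : Simplex (n + 1)) i = ((n : ℝ) + 2)⁻¹ := fun i => by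
      refine (stdSimplex.barycenter_apply i).trans ?_
      rw [Fintype.card_fin]
      push_cast
      ring
    rw [Simplex.comb_val]
    simp_rw [hb, smul_sub, Finset.sum_sub_distrib, Finset.sum_const, Finset.card_univ,
      Fintype.card_fin, ← Nat.cast_smul_eq_nsmul ℝ, smul_smul]
    congr 1
    push_cast
    rw [mul_inv_cancel₀ hn.ne', one_smul]
  rw [Subtype.dist_eq, dist_eq_norm, e]
  refine (norm_sum_le _ _).trans ?_
  have h2 : ∀ i, ‖((n : ℝ) + 2)⁻¹ • ((v i).1 - (v j).1)‖ ≤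
      ((n : ℝ) + 2)⁻¹ * (if i = j then 0 else D) := fun i => by
    rw [norm_smul, Real.norm_of_nonneg (inv_nonneg.2 hn.le)]
    refine mul_le_mul_of_nonneg_left ?_ (inv_nonneg.2 hn.le)
    split_ifs with h
    · simp [h]
    · rw [← dist_eq_norm, ← Subtype.dist_eq]
      exact hv i j
  refine (Finset.sum_le_sum fun i _ => h2 i).trans (le_of_eq ?_)
  rw [← Finset.mul_sum]
  have h3 : ∑ i : Fin (n + 2), (if i = j then (0 : ℝ) else D) = (n + 1) * D := by
    have : ∀ i : Fin (n + 2), (if i = j then (0 : ℝ) else D) = D - if i = j then D else 0 := by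
      intro i; split_ifs <;> simp
    simp_rw [this, Finset.sum_sub_distrib]
    simp
    ring
  rw [h3]
  push_cast
  field_simp
  ring

/-- The chains spanned by affine simplices in `C` of mesh at most `r`. -/
def meshChains (m k : ℕ) (r : ℝ) (C : Set (Fin (m + 1) → ℝ)) : AddSubgroup (SingChain (Simplex m) k) :=
  AddSubgroup.closure ((fun w : Fin (k + 1) → Simplex m => Finsupp.single (aff w) 1) ''
    {w | (∀ i j, dist (w i) (w j) ≤ r) ∧ ∀ i, (w i).1 ∈ C})

theorem meshChains_mono {m k : ℕ} {r s : ℝ} {C D : Set (Fin (m + 1) → ℝ)} (h : r ≤ s) (h' : C ⊆ D) :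
    meshChains m k r C ≤ meshChains m k s D :=
  AddSubgroup.closure_mono (Set.image_mono fun _ hw =>
    ⟨fun i j => (hw.1 i j).trans h, fun i => h' (hw.2 i)⟩)

theorem meshChains_le_iff {m k : ℕ} {r : ℝ} {C : Set (Fin (m + 1) → ℝ)}
    {P : AddSubgroup (SingChain (Simplex m) k)} : meshChains m k r C ≤ P ↔
      ∀ w : Fin (k + 1) → Simplex m, (∀ i j, dist (w i) (w j) ≤ r) → (∀ i, (w i).1 ∈ C) →
        (Finsupp.single (aff w) 1 : SingChain (Simplex m) k) ∈ P := by
  rw [meshChains, AddSubgroup.closure_le]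
  constructor
  · intro h w h1 h2
    exact h ⟨w, ⟨h1, h2⟩, rfl⟩
  · rintro h _ ⟨w, hw, rfl⟩
    exact h w hw.1 hw.2

/-- Subdivision shrinks the mesh of an affine `n`-simplex by the factor `n / (n + 1)`. -/
theorem natEnd_sd_single_mem {m : ℕ} (n : ℕ) (v : Fin (n + 1) → Simplex m) {D : ℝ}
    (hv : ∀ i j, dist (v i) (v j) ≤ D) :
    natEnd (sd n) (Finsupp.single (aff v) 1) ∈
      meshChains m n (n / (n + 1) * D) (convexHull ℝ (Set.range fun i => (v i).1)) := by
  induction n with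
  | zero =>
    rw [sd, natEnd_iota]
    refine AddSubgroup.subset_closure ⟨v, ⟨fun i j => ?_, fun i => subset_convexHull ℝ _ ⟨i, rfl⟩⟩,
      rfl⟩
    rw [show i = j from Fin.ext (by omega), dist_self]
    simp
  | succ n ih =>
    have hD : 0 ≤ D := dist_nonneg.trans (hv 0 0)
    have e : natEnd (sd (n + 1)) (Finsupp.single (aff v) 1) =
        cone (Simplex.comb v stdSimplex.barycenter) n (∑ i : Fin (n + 2), (-1 : ℤ) ^ (i : ℕ) •
          natEnd (sd n) (Finsupp.single (aff (v ∘ i.succAbove)) 1)) := by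
      have h1 : push (aff v) n (natEnd (sd n) (bdry n (iota (n + 1)))) =
          ∑ i : Fin (n + 2), (-1 : ℤ) ^ (i : ℕ) •
            natEnd (sd n) (Finsupp.single (aff (v ∘ i.succAbove)) 1) := by
        rw [push_natEnd, push_bdry, iota, push_single, bdry_single, map_sum]
        simp only [map_zsmul]
        refine Finset.sum_congr rfl fun i _ => ?_
        rw [← aff_comp_simplexMap]
        rfl
      rw [natEnd_single, sd, ← h1]
      exact push_cone (isAff_comb v) _ _
    rw [e]
    set C := convexHull ℝ (Set.range fun i => (v i).1)
    set r : ℝ := ((n + 1 : ℕ) : ℝ) / ((n + 1 : ℕ) + 1) * D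
    have hr : (n : ℝ) / (n + 1) * D ≤ r := by
      refine mul_le_mul_of_nonneg_right ?_ hD
      rw [div_le_div_iff₀ (by positivity) (by positivity)]
      push_cast
      nlinarith
    have hsum : ∑ i : Fin (n + 2), (-1 : ℤ) ^ (i : ℕ) •
        natEnd (sd n) (Finsupp.single (aff (v ∘ i.succAbove)) 1) ∈ meshChains m n r C := by
      refine sum_mem fun i _ => zsmul_mem ?_ _
      refine meshChains_mono hr ?_ (ih (v ∘ i.succAbove) fun j k => hv _ _)
      refine convexHull_mono ?_
      rintro _ ⟨j, rfl⟩
      exact ⟨_, rfl⟩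
    suffices h : meshChains m n r C ≤ (meshChains m (n + 1) r C).comap
        (cone (Simplex.comb v stdSimplex.barycenter) n) from h hsum
    refine meshChains_le_iff.2 fun w hw hwC => ?_
    rw [AddSubgroup.mem_comap, cone_single]
    have hb : ∀ i, dist (Simplex.comb v stdSimplex.barycenter) (w i) ≤ r := fun i => by
      have hsub : C ⊆ Metric.closedBall (Simplex.comb v stdSimplex.barycenter).1 r := by
        refine convexHull_min ?_ (convex_closedBall _ _)
        rintro _ ⟨j, rfl⟩
        rw [Metric.mem_closedBall, dist_comm]
        exact dist_barycenter_le v hv j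
      have := hsub (hwC i)
      rw [Metric.mem_closedBall, dist_comm] at this
      exact this
    refine AddSubgroup.subset_closure ⟨_, ⟨fun i j => ?_, fun i => ?_⟩, rfl⟩
    · refine Fin.cases (Fin.cases ?_ (fun j => ?_) j) (fun i => Fin.cases ?_ (fun j => ?_) j) i
      · rw [dist_self]; positivity
      · exact hb j
      · rw [dist_comm]; exact hb i
      · exact hw i j
    · refine Fin.cases ?_ (fun i => ?_) i
      · exact comb_mem_of_convex (convex_convexHull ℝ _)
          (fun i => subset_convexHull ℝ _ (Set.mem_range_self i)) _
      · exact hwC i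

/-- The mesh of the iterated subdivisions of the standard simplex decays geometrically. -/
theorem exists_mesh_bound (n : ℕ) : ∃ D : ℝ, ∀ k : ℕ, (natEnd (sd n))^[k] (iota n) ∈
    meshChains n n ((n / (n + 1) : ℝ) ^ k * D) Set.univ := by
  refine ⟨Metric.diam (Set.univ : Set (Simplex n)), fun k => ?_⟩
  induction k with
  | zero =>
    have h : (aff fun i => stdSimplex.vertex i : C(Simplex n, Simplex n)) =
        ContinuousMap.id _ := by
      rw [← simplexMap_id, simplexMap_eq_comb]
      rfl
    rw [Function.iterate_zero, id, iota, ← h]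
    refine AddSubgroup.subset_closure ⟨_, ⟨fun i j => ?_, fun i => Set.mem_univ _⟩, rfl⟩
    rw [pow_zero, one_mul]
    exact Metric.dist_le_diam_of_mem isCompact_univ.isBounded (Set.mem_univ _) (Set.mem_univ _)
  | succ k ih =>
    rw [Function.iterate_succ_apply']
    suffices h : meshChains n n ((n / (n + 1) : ℝ) ^ k * Metric.diam (Set.univ : Set (Simplex n)))
        Set.univ ≤ (meshChains n n ((n / (n + 1) : ℝ) ^ (k + 1) *
          Metric.diam (Set.univ : Set (Simplex n))) Set.univ).comap (natEnd (sd n)) from h ih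
    refine meshChains_le_iff.2 fun w hw _ => ?_
    rw [AddSubgroup.mem_comap]
    refine meshChains_mono (le_of_eq ?_) (Set.subset_univ _) (natEnd_sd_single_mem n w hw)
    rw [pow_succ]
    ring

end Subdivision

/-! ### Excision -/

section Excision

variable {X : Type u} [TopologicalSpace X]

theorem natEnd_sd_mem_sup {n : ℕ} {U V : Set X} {c : SingChain X n}
    (hc : c ∈ chainsIn n U ⊔ chainsIn n V) (k : ℕ) :
    (natEnd (sd n))^[k] c ∈ chainsIn n U ⊔ chainsIn n V := by
  induction k with
  | zero => exact hc
  | succ k ih =>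
    rw [Function.iterate_succ_apply']
    obtain ⟨a, ha, b, hb, h⟩ := AddSubgroup.mem_sup.1 ih
    rw [← h, map_add]
    exact AddSubgroup.mem_sup.2 ⟨_, natEnd_mem_chainsIn _ ha, _, natEnd_mem_chainsIn _ hb, rfl⟩

theorem natEnd_sd_mem_of_mem {n : ℕ} {W : Set X} {c : SingChain X n}
    (hc : c ∈ chainsIn n W) (k : ℕ) : (natEnd (sd n))^[k] c ∈ chainsIn n W := by
  have h := natEnd_sd_mem_sup (U := W) (V := W) (by rwa [sup_idem]) k
  rwa [sup_idem] at h

/-- Small simplices: after sufficiently many subdivisions, a chain is a sum of chains subordinate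
to a given open cover by two sets. -/
theorem exists_iterate_sd_mem {n : ℕ} {W U V : Set X} (hU : IsOpen U) (hV : IsOpen V)
    (hW : W ⊆ U ∪ V) {c : SingChain X n} (hc : c ∈ chainsIn n W) :
    ∃ k, (natEnd (sd n))^[k] c ∈ chainsIn n (W ∩ U) ⊔ chainsIn n (W ∩ V) := by
  induction hc using AddSubgroup.closure_induction with
  | zero => exact ⟨0, zero_mem _⟩
  | neg x _ hx =>
    obtain ⟨k, hk⟩ := hx
    refine ⟨k, ?_⟩
    rw [iterate_map_neg]
    exact neg_mem hk
  | add x y _ _ hx hy =>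
    obtain ⟨k, hk⟩ := hx
    obtain ⟨l, hl⟩ := hy
    refine ⟨k + l, ?_⟩
    rw [iterate_map_add]
    refine add_mem ?_ ?_
    · rw [add_comm k l, Function.iterate_add_apply]
      exact natEnd_sd_mem_sup hk l
    · rw [Function.iterate_add_apply]
      exact natEnd_sd_mem_sup hl k
  | mem x hx =>
    obtain ⟨σ, hσ, rfl⟩ := hx
    obtain ⟨D, hD⟩ := exists_mesh_bound n
    -- `k` is taken so large that the mesh of the subdivision is below a Lebesgue number of the
    -- preimage of the cover
    obtain ⟨δ, hδ, hball⟩ := lebesgue_number_lemma_of_metric (s := (Set.univ : Set (Simplex n)))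
      (c := fun b : Bool => if b then σ ⁻¹' U else σ ⁻¹' V) isCompact_univ
      (by intro b; cases b
          · exact hV.preimage σ.continuous
          · exact hU.preimage σ.continuous)
      (fun x _ => by
        rcases hW (hσ ⟨x, rfl⟩) with h | h
        · exact Set.mem_iUnion.2 ⟨true, h⟩
        · exact Set.mem_iUnion.2 ⟨false, h⟩)
    obtain ⟨k, hk⟩ : ∃ k : ℕ, (n / (n + 1) : ℝ) ^ k * D < δ := by
      have h1 : (n / (n + 1) : ℝ) < 1 := by
        rw [div_lt_one (by positivity)]
        linarith
      have h := (tendsto_pow_atTop_nhds_zero_of_lt_one (by positivity) h1).mul_const D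
      rw [zero_mul] at h
      exact (h.eventually_lt_const hδ).exists
    refine ⟨k, ?_⟩
    have e : (natEnd (sd n))^[k] (Finsupp.single σ 1) = push σ n ((natEnd (sd n))^[k] (iota n)) := by
      have hcomm : Function.Semiconj (push σ n) (natEnd (sd n)) (natEnd (sd n)) :=
        fun c => push_natEnd _ _ _
      rw [(hcomm.iterate_right k).eq, iota, push_single]
      rfl
    change (natEnd (sd n))^[k] (Finsupp.single σ 1) ∈ _
    rw [e]
    suffices h : meshChains n n ((n / (n + 1) : ℝ) ^ k * D) Set.univ ≤
        (chainsIn n (W ∩ U) ⊔ chainsIn n (W ∩ V)).comap (push σ n) from h (hD k)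
    refine meshChains_le_iff.2 fun w hw _ => ?_
    rw [AddSubgroup.mem_comap, push_single]
    have hrange : ∀ x, aff w x ∈ Metric.ball (w 0) δ := fun x => by
      have h : (Simplex.comb w x).1 ∈ Metric.closedBall (w 0).1 ((n / (n + 1) : ℝ) ^ k * D) :=
        comb_mem_of_convex (convex_closedBall _ _) (fun i => hw i 0) x
      exact lt_of_le_of_lt h hk
    obtain ⟨b, hb⟩ := hball (w 0) (Set.mem_univ _)
    cases b with
    | true =>
      refine AddSubgroup.mem_sup_left (single_mem_chainsIn ?_)
      rintro _ ⟨x, rfl⟩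
      exact ⟨hσ ⟨_, rfl⟩, hb (hrange x)⟩
    | false =>
      refine AddSubgroup.mem_sup_right (single_mem_chainsIn ?_)
      rintro _ ⟨x, rfl⟩
      exact ⟨hσ ⟨_, rfl⟩, hb (hrange x)⟩

/-- Excision: a chain of `W` whose boundary is subordinate to an open cover of `W` by two sets is
homologous to a chain subordinate to the cover. -/
theorem exists_sub_bdry_mem_sup {n : ℕ} {W U V : Set X} (hU : IsOpen U) (hV : IsOpen V)
    (hW : W ⊆ U ∪ V) {c : SingChain X n} (hc : c ∈ chainsIn n W)
    (hb : bdry' n c ∈ chainsIn (n - 1) (W ∩ U) ⊔ chainsIn (n - 1) (W ∩ V)) :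
    ∃ e ∈ chainsIn (n + 1) W, c - bdry n e ∈ chainsIn n (W ∩ U) ⊔ chainsIn n (W ∩ V) := by
  obtain ⟨T, hT⟩ := exists_homotopy_id.{u} sd_mem rfl bdry_sd
  obtain ⟨k, hk⟩ := exists_iterate_sd_mem hU hV hW hc
  -- Summing the homotopies from one subdivision to the next: the extra terms lie in the subgroup since
  -- the boundary of `c` does, as do its subdivisions.
  suffices h : ∀ k, ∃ e ∈ chainsIn (n + 1) W, (natEnd (sd n))^[k] c - c - bdry n e ∈
      chainsIn n (W ∩ U) ⊔ chainsIn n (W ∩ V) by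
    obtain ⟨e, he, h⟩ := h k
    refine ⟨-e, neg_mem he, ?_⟩
    have := sub_mem hk h
    rw [map_neg]
    convert this using 1
    abel
  intro k
  induction k with
  | zero => exact ⟨0, zero_mem _, by simp⟩
  | succ k ih =>
    obtain ⟨e, he, h⟩ := ih
    set c' := (natEnd (sd n))^[k] c with hc'
    refine ⟨e + natEnd (T n) c', add_mem he (natEnd_mem_chainsIn _ (natEnd_sd_mem_of_mem hc k)), ?_⟩
    rw [Function.iterate_succ_apply', ← hc']
    have key : natEnd (sd n) c' - c' - bdry n (natEnd (T n) c') ∈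
        chainsIn n (W ∩ U) ⊔ chainsIn n (W ∩ V) := by
      cases n with
      | zero =>
        rw [(hT (X := X)).1, sub_self]
        exact zero_mem _
      | succ n =>
        rw [← (hT (X := X)).2, add_sub_cancel_left]
        have hcomm : bdry n c' = (natEnd (sd n))^[k] (bdry n c) := by
          have hcomm : Function.Semiconj (bdry (X := X) n) (natEnd (sd (n + 1))) (natEnd (sd n)) :=
            fun c => bdry_natEnd (bdry_sd n) c
          exact (hcomm.iterate_right k).eq c
        have h1 : bdry n c' ∈ chainsIn n (W ∩ U) ⊔ chainsIn n (W ∩ V) := by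
          rw [hcomm]
          exact natEnd_sd_mem_sup hb k
        obtain ⟨a, ha, b, hb, h⟩ := AddSubgroup.mem_sup.1 h1
        rw [← h, map_add]
        exact AddSubgroup.mem_sup.2
          ⟨_, natEnd_mem_chainsIn _ ha, _, natEnd_mem_chainsIn _ hb, rfl⟩
    have := add_mem h key
    convert this using 1
    rw [map_add]
    abel

/-- Excision as an isomorphism of relative homology groups. -/
theorem relIso_excision {W U V : Set X} (hU : IsOpen U) (hV : IsOpen V) (hW : W ⊆ U ∪ V) (k : ℕ) :
    RelIso (AddMonoidHom.id (SingChain X k)) (W ∩ V) (W ∩ V ∩ U) W (W ∩ U) where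
  map_relZ _ hc := relZ_mono Set.inter_subset_left
    (Set.inter_subset_inter_left _ Set.inter_subset_left) hc
  map_relB_iff c hc := by
    refine ⟨fun hb => ?_, fun hb => relB_mono Set.inter_subset_left
      (Set.inter_subset_inter_left _ Set.inter_subset_left) hb⟩
    obtain ⟨e, he, d, hd, hed⟩ := mem_relB.1 hb
    rw [AddMonoidHom.id_apply] at hed
    have hbe : bdry' (k + 1) e ∈ chainsIn k (W ∩ U) ⊔ chainsIn k (W ∩ V) := by
      change bdry k e ∈ _
      rw [← add_sub_cancel_right (bdry k e) d, hed]
      exact sub_mem (AddSubgroup.mem_sup_right (mem_relZ.1 hc).1) (AddSubgroup.mem_sup_left hd)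
    obtain ⟨f, _, hf⟩ := exists_sub_bdry_mem_sup hU hV hW he hbe
    obtain ⟨p, hp, q, hq, hpq⟩ := AddSubgroup.mem_sup.1 hf
    have h1 : bdry k p + bdry k q = bdry k e := by
      rw [← map_add, hpq, map_sub, bdry_bdry, sub_zero]
    have h2 : c - bdry k q = bdry k p + d := by
      rw [← hed, ← h1]
      abel
    refine mem_relB.2 ⟨q, hq, c - bdry k q, ?_, by abel⟩
    have h3 := chainsIn_inter (h2 ▸ add_mem (bdry_mem_chainsIn hp) hd)
      (sub_mem (mem_relZ.1 hc).1 (bdry_mem_chainsIn hq))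
    refine chainsIn_mono ?_ h3
    exact fun x hx => ⟨hx.2, hx.1.2⟩
  surj d hd := by
    obtain ⟨e, he, h⟩ := exists_sub_bdry_mem_sup hU hV hW (mem_relZ.1 hd).1
      (AddSubgroup.mem_sup_left (mem_relZ.1 hd).2)
    obtain ⟨p, hp, q, hq, hpq⟩ := AddSubgroup.mem_sup.1 h
    refine ⟨q, mem_relZ.2 ⟨hq, ?_⟩, ?_⟩
    · have h1 : bdry' k q = bdry' k d - bdry' k p := by
        rw [← add_sub_cancel_left p q, hpq, map_sub, map_sub, bdry'_bdry, sub_zero]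
      have h2 := chainsIn_inter (h1 ▸ sub_mem (mem_relZ.1 hd).2 (bdry'_mem_chainsIn hp))
        (bdry'_mem_chainsIn hq)
      refine chainsIn_mono ?_ h2
      exact fun x hx => ⟨hx.2, hx.1.2⟩
    · refine mem_relB.2 ⟨e, he, p, hp, ?_⟩
      rw [AddMonoidHom.id_apply, eq_sub_iff_add_eq, add_assoc, hpq]
      abel

end Excision

/-! ### The local homology of a ball -/

section Ball

theorem simplex_one_mem (t : Simplex 1) : 0 ≤ t 0 ∧ 0 ≤ t 1 ∧ t 0 + t 1 = 1 :=
  ⟨stdSimplex.zero_le t 0, stdSimplex.zero_le t 1, stdSimplex.add_eq_one t⟩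

theorem continuous_simplex_apply {n : ℕ} (i : Fin (n + 1)) : Continuous fun t : Simplex n => t i :=
  (continuous_apply i).comp continuous_subtype_val

/-- If `V` is star-shaped in the convex set `U`, then `H_*(U, V) = 0`. -/
theorem relAcyclic_of_starConvex {E : Type u} [NormedAddCommGroup E] [NormedSpace ℝ E] {U V : Set E}
    (hU : Convex ℝ U) (hVU : V ⊆ U) {p : E} (hp : p ∈ V) (hV : StarConvex ℝ p V) (n : ℕ) :
    RelAcyclic n U V := by
  refine relAcyclic_of_deformation
    ⟨fun y : U × Simplex 1 => y.2 1 • p + y.2 0 • (y.1 : E), ?_⟩ ?_ ?_ ?_ ?_ n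
  · have h := fun i : Fin 2 => (continuous_simplex_apply (n := 1) i)
    exact (((h 1).comp continuous_snd).smul continuous_const).add
      (((h 0).comp continuous_snd).smul (continuous_subtype_val.comp continuous_fst))
  · intro x
    simp
  · intro x
    simpa using hp
  · intro x t
    obtain ⟨h0, h1, h⟩ := simplex_one_mem t
    exact hU (hVU hp) x.2 h1 h0 (by rw [add_comm]; exact h)
  · intro x t hx
    obtain ⟨h0, h1, h⟩ := simplex_one_mem t
    exact hV hx h1 h0 (by rw [add_comm]; exact h)

/-- The open unit cube, i.e. the unit ball for the maximum norm. -/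
abbrev cube (n : ℕ) : Set (Fin n → ℝ) := Metric.ball 0 1

theorem mem_cube {n : ℕ} {x : Fin n → ℝ} : x ∈ cube n ↔ ∀ i, |x i| < 1 := by
  rw [cube, mem_ball_zero_iff, pi_norm_lt_iff one_pos]
  rfl

theorem mem_cube_succ {n : ℕ} {x : Fin (n + 1) → ℝ} :
    x ∈ cube (n + 1) ↔ |x 0| < 1 ∧ Fin.tail x ∈ cube n := by
  rw [mem_cube, mem_cube, Fin.forall_fin_succ]
  rfl

theorem eq_zero_iff_tail {n : ℕ} {x : Fin (n + 1) → ℝ} : x = 0 ↔ x 0 = 0 ∧ Fin.tail x = 0 := by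
  rw [funext_iff, Fin.forall_fin_succ, funext_iff]
  rfl

/-- The cube minus the ray `{(s, 0) | ε s ≤ 0}`. -/
def slit (n : ℕ) (ε : ℝ) : Set (Fin (n + 1) → ℝ) :=
  cube (n + 1) ∩ {x | Fin.tail x = 0 → 0 < ε * x 0}

/-- A slit cube is star-shaped with respect to the point `(ε / 2, 0)`. -/
theorem relAcyclic_slit (n k : ℕ) {ε : ℝ} (hε : |ε| = 1) : RelAcyclic k (cube (n + 1)) (slit n ε) := by
  have hε2 : ε * ε = 1 := by rw [← abs_mul_abs_self, hε, one_mul]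
  have hp : (Fin.cons (ε / 2) 0 : Fin (n + 1) → ℝ) ∈ slit n ε := by
    refine ⟨mem_cube_succ.2 ⟨?_, ?_⟩, fun _ => ?_⟩
    · rw [Fin.cons_zero, abs_div, hε]
      norm_num
    · rw [Fin.tail_cons]
      exact Metric.mem_ball_self one_pos
    · rw [Fin.cons_zero]
      linarith
  refine relAcyclic_of_starConvex (convex_ball _ _) Set.inter_subset_left hp ?_ k
  intro x hx a b ha hb hab
  refine ⟨convex_ball _ _ hp.1 hx.1 ha hb hab, fun ht => ?_⟩
  have ht' : b • Fin.tail x = 0 := by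
    rw [← ht]
    funext i
    simp [Fin.tail]
  simp only [Pi.add_apply, Pi.smul_apply, Fin.cons_zero, smul_eq_mul]
  rcases smul_eq_zero.1 ht' with h | h
  · have ha1 : a = 1 := by linarith
    rw [h, ha1]
    linarith
  · have hx0 := hx.2 h
    have e : ε * (a * (ε / 2) + b * x 0) = a / 2 + b * (ε * x 0) := by
      linear_combination a / 2 * hε2
    rw [e]
    rcases ha.lt_or_eq with h' | h'
    · have := mul_nonneg hb hx0.le
      linarith
    · have hb1 : b = 1 := by linarith
      rw [hb1, ← h']
      linarith

theorem isOpen_slit (n : ℕ) (ε : ℝ) :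
    IsOpen {x : Fin (n + 1) → ℝ | Fin.tail x = 0 → 0 < ε * x 0} := by
  have h : {x : Fin (n + 1) → ℝ | Fin.tail x = 0 → 0 < ε * x 0} =
      {x | Fin.tail x ≠ 0} ∪ {x | 0 < ε * x 0} := by
    ext x
    exact imp_iff_not_or
  have hc : Continuous (Fin.tail : (Fin (n + 1) → ℝ) → Fin n → ℝ) :=
    continuous_pi fun i => continuous_apply _
  rw [h]
  exact (isOpen_ne_fun hc continuous_const).union
    (isOpen_lt continuous_const (continuous_const.mul (continuous_apply 0)))

theorem punctured_cube_eq (n : ℕ) : cube (n + 1) \ {0} = slit n 1 ∪ slit n (-1) := by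
  ext x
  simp only [slit, Set.mem_sdiff, Set.mem_singleton_iff, Set.mem_union, Set.mem_inter_iff,
    ← and_or_left, Set.mem_ofPred_eq, eq_zero_iff_tail]
  refine and_congr_right fun _ => ?_
  by_cases h : Fin.tail x = 0
  · simp only [h, and_true, forall_const, one_mul, neg_mul, Left.neg_pos_iff]
    exact lt_or_lt_iff_ne.symm.trans or_comm
  · simp [h]

theorem slit_inter_slit (n : ℕ) : slit n 1 ∩ slit n (-1) = cube (n + 1) ∩ {x | Fin.tail x ≠ 0} := by
  ext x
  simp only [slit, Set.mem_inter_iff, Set.mem_ofPred_eq]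
  by_cases h : Fin.tail x = 0
  · simp only [h, forall_const, ne_eq, not_true_eq_false, and_false, iff_false]
    rintro ⟨⟨_, h1⟩, _, h2⟩
    linarith
  · simp [h]

/-- Projection along the first coordinate. -/
def tailMap (n : ℕ) : C(Fin (n + 1) → ℝ, Fin n → ℝ) :=
  ⟨Fin.tail, continuous_pi fun _ => continuous_apply _⟩

/-- Inclusion of the hyperplane where the first coordinate vanishes. -/
def consMap (n : ℕ) : C(Fin n → ℝ, Fin (n + 1) → ℝ) :=
  ⟨fun x => Fin.cons (0 : ℝ) x, continuous_pi (Fin.cases continuous_const continuous_apply)⟩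

/-- Projection along the first coordinate is a homotopy equivalence from the cube and the complement of
its axis to the cube and the punctured cube of one dimension less. -/
theorem relIso_tailMap (n k : ℕ) : RelIso (push (tailMap n) k) (cube (n + 1))
    (cube (n + 1) ∩ {x | Fin.tail x ≠ 0}) (cube n) (cube n \ {0}) := by
  -- `consMap` is inverse to `tailMap` up to the linear contraction of the first coordinate.
  have hF : ∀ (x : Fin (n + 1) → ℝ), x ∈ cube (n + 1) → ∀ t : Simplex 1,
      (Fin.cons (t 1 * x 0) (Fin.tail x) : Fin (n + 1) → ℝ) ∈ cube (n + 1) := by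
    intro x hx t
    refine mem_cube_succ.2 ⟨?_, ?_⟩
    · rw [Fin.cons_zero, abs_mul, abs_of_nonneg (stdSimplex.zero_le t 1)]
      exact (mul_le_of_le_one_left (abs_nonneg _) (stdSimplex.le_one t 1)).trans_lt
        (mem_cube_succ.1 hx).1
    · rw [Fin.tail_cons]
      exact (mem_cube_succ.1 hx).2
  have hg : Set.MapsTo (consMap n) (cube n) (cube (n + 1)) := fun x hx =>
    mem_cube_succ.2 ⟨by simp [consMap], by simpa [consMap] using hx⟩
  refine relIso_push (tailMap n) (consMap n) ?_
    ⟨fun y => Fin.cons (y.2 1 * y.1 0) (Fin.tail y.1), ?_⟩ ?_ ?_ ?_ ?_ ?_ ?_ hF ?_ k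
  · ext x i
    simp [tailMap, consMap]
  · refine continuous_pi (Fin.cases ?_ fun i => ?_)
    · simp only [Fin.cons_zero]
      exact ((continuous_simplex_apply (n := 1) 1).comp continuous_snd).mul
        ((continuous_apply 0).comp continuous_fst)
    · simp only [Fin.cons_succ]
      exact (continuous_apply i.succ).comp continuous_fst
  · intro x
    change (Fin.cons ((stdSimplex.vertex 0 : Simplex 1) 1 * x 0) (Fin.tail x) : Fin (n + 1) → ℝ) =
      Fin.cons 0 (Fin.tail x)
    simp
  · intro x
    change (Fin.cons ((stdSimplex.vertex 1 : Simplex 1) 1 * x 0) (Fin.tail x) : Fin (n + 1) → ℝ) = x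
    simp
  · exact fun x hx => (mem_cube_succ.1 hx).2
  · exact fun x hx => ⟨(mem_cube_succ.1 hx.1).2, hx.2⟩
  · exact hg
  · exact fun x hx => ⟨hg hx.1, by simpa [consMap] using hx.2⟩
  · exact fun x hx t => ⟨hF x hx.1 t, by simpa using hx.2⟩

/-- Suspension: writing `C` for the cube, `C \ 0` is the union of the slit cubes `C₊` and `C₋`, so
`H_{k+1}(C, C \ 0) ≅ H_k(C \ 0, C₊) ≅ H_k(C₋, C₊ ∩ C₋) ≅ H_k(C, C₊ ∩ C₋)` by the triple
`(C, C \ 0, C₊)`, excision and the triple `(C, C₋, C₊ ∩ C₋)`; the last pair is that of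
`relIso_tailMap`. -/
theorem nonempty_Hrel_cube_succ (n k : ℕ) : Nonempty
    (Hrel (k + 1) (cube (n + 1)) (cube (n + 1) \ {0}) ≃+ Hrel k (cube n) (cube n \ {0})) := by
  have hW : cube (n + 1) \ {0} ⊆ {x | Fin.tail x = 0 → 0 < 1 * x 0} ∪
      {x | Fin.tail x = 0 → 0 < -1 * x 0} := by
    rw [punctured_cube_eq]
    exact Set.union_subset_union Set.inter_subset_right Set.inter_subset_right
  have hUp : slit n 1 ⊆ cube (n + 1) \ {0} := by
    rw [punctured_cube_eq]; exact Set.subset_union_left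
  have hUm : slit n (-1) ⊆ cube (n + 1) \ {0} := by
    rw [punctured_cube_eq]; exact Set.subset_union_right
  have e : ∀ ε, slit n ε ⊆ cube (n + 1) \ {0} →
      (cube (n + 1) \ {0}) ∩ {x | Fin.tail x = 0 → 0 < ε * x 0} = slit n ε := fun ε h =>
    Set.Subset.antisymm (fun x hx => ⟨hx.1.1, hx.2⟩) fun x hx => ⟨h hx, hx.2⟩
  have h2 := relIso_excision (isOpen_slit n 1) (isOpen_slit n (-1)) hW k
  rw [e _ hUp, e _ hUm] at h2
  have e' : slit n (-1) ∩ {x | Fin.tail x = 0 → 0 < 1 * x 0} =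
      cube (n + 1) ∩ {x | Fin.tail x ≠ 0} := by
    rw [← slit_inter_slit]
    exact Set.Subset.antisymm (fun x hx => ⟨⟨hx.1.1, hx.2⟩, hx.1⟩) fun x hx => ⟨hx.2, hx.1.2⟩
  rw [e'] at h2
  obtain ⟨f₁⟩ := (relIso_bdry Set.sdiff_subset hUp (fun k => relAcyclic_slit n k abs_one)
    k).nonempty_addEquiv
  obtain ⟨f₂⟩ := h2.nonempty_addEquiv
  obtain ⟨f₃⟩ := (relIso_id_of_relAcyclic (V := slit n (-1))
    (W := cube (n + 1) ∩ {x | Fin.tail x ≠ 0}) Set.inter_subset_left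
    (by rw [← slit_inter_slit]; exact Set.inter_subset_right)
    (fun k => relAcyclic_slit n k (by simp)) k).nonempty_addEquiv
  obtain ⟨f₄⟩ := (relIso_tailMap n k).nonempty_addEquiv
  exact ⟨f₁.trans (f₂.symm.trans (f₃.trans f₄))⟩

theorem relAcyclic_cube_succ_zero (n : ℕ) :
    RelAcyclic 0 (cube (n + 1)) (cube (n + 1) \ {0}) := by
  have hU : slit n 1 ⊆ cube (n + 1) \ {0} := by
    rw [punctured_cube_eq]; exact Set.subset_union_left
  intro c hc
  exact relB_mono le_rfl hU (relAcyclic_slit n 0 abs_one (mem_relZ.2 ⟨hc.1, zero_mem _⟩))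

section Point

variable {X : Type u} [TopologicalSpace X] [Subsingleton X]

theorem relAcyclic_of_subsingleton (p : X) (k : ℕ) :
    RelAcyclic (k + 1) (Set.univ : Set X) ∅ := by
  -- In a space with one point every singular simplex is affine, so the cone construction applies.
  let _ : AffineModel X :=
    { aff := fun _ => ContinuousMap.const _ p
      aff_vertex := fun _ _ => Subsingleton.elim _ _
      aff_comp_simplexMap := fun _ _ => rfl }
  intro c hc
  have h : bdry k c ∈ chainsIn k (∅ : Set X) := (mem_relZ.1 hc).2
  have h0 : bdry k c = 0 := by
    refine Finsupp.support_eq_empty.1 (Finset.eq_empty_of_forall_notMem fun σ hσ => ?_)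
    exact mem_chainsIn_iff.1 h σ hσ ⟨stdSimplex.vertex 0, rfl⟩
  have haff : c ∈ affChains X (k + 1) := by
    suffices h : chainsIn (k + 1) (Set.univ : Set X) ≤ affChains X (k + 1) from
      h (mem_chainsIn_univ c)
    refine chainsIn_le_iff.2 fun σ _ => ?_
    have e : σ = aff fun _ => p := by ext x; exact Subsingleton.elim _ _
    rw [e]
    exact single_aff_mem _
  rw [← bdry_cone_of_cycle p haff h0]
  exact bdry_mem_relB (mem_chainsIn_univ _)

theorem nonempty_Hrel_of_subsingleton (p : X) :
    Nonempty (Hrel 0 (Set.univ : Set X) ∅ ≃+ ℤ) := by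
  let σ₀ : C(Simplex 0, X) := ContinuousMap.const _ p
  have hσ : ∀ {n : ℕ} (σ τ : C(Simplex n, X)), σ = τ := fun σ τ => by
    ext x; exact Subsingleton.elim _ _
  -- the two faces of a `1`-simplex agree, so there are no boundaries in degree `0`
  have hB : ∀ c ∈ relB 0 (Set.univ : Set X) ∅, c = 0 := by
    intro c hc
    obtain ⟨e, _, d, hd, rfl⟩ := mem_relB.1 hc
    have hd0 : d = 0 := by
      refine Finsupp.support_eq_empty.1 (Finset.eq_empty_of_forall_notMem fun σ hσ => ?_)
      exact mem_chainsIn_iff.1 hd σ hσ ⟨stdSimplex.vertex 0, rfl⟩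
    rw [hd0, add_zero]
    refine hom_ext_single (f := bdry 0) (g := 0) (fun σ => ?_) e
    rw [bdry_single, Fin.sum_univ_two, hσ (σ.comp _) σ₀, hσ (σ.comp (simplexMap _)) σ₀]
    simp
  let Φ : Hrel 0 (Set.univ : Set X) ∅ →+ ℤ := QuotientAddGroup.lift _
    ((Finsupp.applyAddHom σ₀).comp (relZ 0 (Set.univ : Set X) ∅).subtype) fun c hc => by
      rw [AddMonoidHom.mem_ker, AddMonoidHom.comp_apply, AddSubgroup.coe_subtype, hB c hc, map_zero]
  refine ⟨AddEquiv.ofBijective Φ ⟨?_, fun m => ?_⟩⟩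
  · rw [injective_iff_map_eq_zero]
    intro x hx
    induction x using QuotientAddGroup.induction_on with
    | H c =>
      have hc : c.1 σ₀ = 0 := hx
      have h0 : c = 0 := by
        refine Subtype.ext (Finsupp.ext fun σ => ?_)
        rw [hσ σ σ₀]
        exact hc
      rw [h0]
      rfl
  · refine ⟨QuotientAddGroup.mk' _ ⟨Finsupp.single σ₀ m, mem_relZ.2
      ⟨mem_chainsIn_univ _, zero_mem _⟩⟩, ?_⟩
    change (Finsupp.single σ₀ m) σ₀ = m
    exact Finsupp.single_eq_same

end Point

/-- The local homology of the cube at its centre is `ℤ`, concentrated in degree `n`. -/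
theorem Hrel_cube (n : ℕ) : Nonempty (Hrel n (cube n) (cube n \ {0}) ≃+ ℤ) ∧
    ∀ k, k ≠ n → RelAcyclic k (cube n) (cube n \ {0}) := by
  induction n with
  | zero =>
    have e : cube 0 = Set.univ := Set.eq_univ_of_forall fun x => mem_cube.2 fun i => i.elim0
    have e' : cube 0 \ {0} = ∅ := by
      ext x
      simp [Subsingleton.elim x 0]
    rw [e', e]
    refine ⟨nonempty_Hrel_of_subsingleton 0, fun k hk => ?_⟩
    obtain ⟨k, rfl⟩ := Nat.exists_eq_succ_of_ne_zero hk
    exact relAcyclic_of_subsingleton 0 k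
  | succ n ih =>
    refine ⟨?_, fun k hk => ?_⟩
    · obtain ⟨f⟩ := nonempty_Hrel_cube_succ n n
      obtain ⟨g⟩ := ih.1
      exact ⟨f.trans g⟩
    · cases k with
      | zero => exact relAcyclic_cube_succ_zero n
      | succ k =>
        obtain ⟨f⟩ := nonempty_Hrel_cube_succ n k
        have h := relAcyclic_iff_subsingleton.1 (ih.2 k (by omega))
        exact relAcyclic_iff_subsingleton.2 f.toEquiv.subsingleton

/-- A relative cycle that generates the local homology of the cube. -/
theorem exists_cube_generator (n : ℕ) : ∃ g ∈ relZ n (cube n) (cube n \ {0}),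
    (∀ c ∈ relZ n (cube n) (cube n \ {0}), ∃ m : ℤ, c - m • g ∈ relB n (cube n) (cube n \ {0})) ∧
    ∀ m : ℤ, m • g ∈ relB n (cube n) (cube n \ {0}) → m = 0 := by
  obtain ⟨f⟩ := (Hrel_cube n).1
  obtain ⟨g, hg⟩ : ∃ g : relZ n (cube n) (cube n \ {0}),
      (QuotientAddGroup.mk' _ g : Hrel n (cube n) (cube n \ {0})) = f.symm 1 :=
    QuotientAddGroup.mk'_surjective _ _
  let q : relZ n (cube n) (cube n \ {0}) →+ Hrel n (cube n) (cube n \ {0}) :=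
    QuotientAddGroup.mk' _
  have hq : ∀ c, q c = 0 ↔ c.1 ∈ relB n (cube n) (cube n \ {0}) := fun c =>
    QuotientAddGroup.eq_zero_iff c
  have hfg : f (q g) = 1 := by
    change f (QuotientAddGroup.mk' _ g : Hrel n (cube n) (cube n \ {0})) = 1
    rw [hg, AddEquiv.apply_symm_apply]
  refine ⟨g, g.2, fun c hc => ⟨f (q ⟨c, hc⟩), ?_⟩, fun m hm => ?_⟩
  · refine (hq (⟨c, hc⟩ - f (q ⟨c, hc⟩) • g)).1 (f.injective ?_)
    rw [map_sub, map_sub, map_zsmul, map_zsmul, hfg, map_zero]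
    simp
  · have h := (hq (m • g)).2 hm
    have h' := congrArg f h
    rw [map_zsmul, map_zsmul, hfg, map_zero] at h'
    simpa using h'

end Ball

/-! ### Attaching a cell -/

section Attach

variable {X : Type u} [TopologicalSpace X] {n : ℕ}

/-- `Φ` is a characteristic map for the open cell `e`: it maps the open cube homeomorphically onto
`e`. -/
structure CellChart (Φ : C(Fin n → ℝ, X)) (e : Set X) : Prop where
  image_cube : Φ '' cube n = e
  exists_inverse : ∃ ψ : X → Fin n → ℝ, ContinuousOn ψ e ∧ ∀ v ∈ cube n, ψ (Φ v) = v

variable {Φ : C(Fin n → ℝ, X)} {e : Set X}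

theorem CellChart.injOn (h : CellChart Φ e) : Set.InjOn Φ (cube n) := by
  obtain ⟨ψ, _, hψ⟩ := h.exists_inverse
  intro v hv w hw hvw
  rw [← hψ v hv, hvw, hψ w hw]

theorem CellChart.mem (h : CellChart Φ e) {v : Fin n → ℝ} (hv : v ∈ cube n) : Φ v ∈ e :=
  h.image_cube ▸ ⟨v, hv, rfl⟩

/-- Singular chains of the open cell lift to the cube. -/
theorem CellChart.exists_push (h : CellChart Φ e) {S : Set (Fin n → ℝ)} (hS : S ⊆ cube n) {k : ℕ}
    {c : SingChain X k} (hc : c ∈ chainsIn k (Φ '' S)) :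
    ∃ c' ∈ chainsIn k S, push Φ k c' = c := by
  obtain ⟨ψ, hψc, hψ⟩ := h.exists_inverse
  suffices h : chainsIn k (Φ '' S) ≤ (chainsIn k S).map (push Φ k) from h hc
  refine chainsIn_le_iff.2 fun σ hσ => ?_
  have hσe : ∀ x, σ x ∈ e := fun x => by
    obtain ⟨v, hv, hvx⟩ := hσ ⟨x, rfl⟩
    rw [← hvx]
    exact h.mem (hS hv)
  refine ⟨Finsupp.single ⟨fun x => ψ (σ x), hψc.comp_continuous σ.continuous hσe⟩ 1,
    single_mem_chainsIn ?_, ?_⟩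
  · rintro _ ⟨x, rfl⟩
    obtain ⟨v, hv, hvx⟩ := hσ ⟨x, rfl⟩
    change ψ (σ x) ∈ S
    rw [← hvx, hψ v (hS hv)]
    exact hv
  · rw [push_single]
    congr 1
    ext x
    obtain ⟨v, hv, hvx⟩ := hσ ⟨x, rfl⟩
    change Φ (ψ (σ x)) = σ x
    rw [← hvx, hψ v (hS hv)]

theorem CellChart.push_injOn (h : CellChart Φ e) {k : ℕ} {c : SingChain (Fin n → ℝ) k}
    (hc : c ∈ chainsIn k (cube n)) (h0 : push Φ k c = 0) : c = 0 := by
  have hinj : Set.InjOn (fun σ : C(Simplex k, Fin n → ℝ) => Φ.comp σ)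
      {σ | Set.range σ ⊆ cube n} := fun σ hσ τ hτ hστ => by
    ext1 x
    exact h.injOn (hσ ⟨x, rfl⟩) (hτ ⟨x, rfl⟩) (DFunLike.congr_fun hστ x)
  refine Finsupp.mapDomain_injOn _ hinj (fun σ hσ => mem_chainsIn_iff.1 hc σ hσ)
    (fun σ hσ => by simp at hσ) ?_
  exact h0.trans Finsupp.mapDomain_zero.symm

theorem CellChart.image_diff (h : CellChart Φ e) : Φ '' (cube n \ {0}) = e \ {Φ 0} := by
  have h0 : (0 : Fin n → ℝ) ∈ cube n := Metric.mem_ball_self one_pos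
  ext x
  constructor
  · rintro ⟨v, ⟨hv, hv0⟩, rfl⟩
    exact ⟨h.mem hv, fun hx => hv0 (h.injOn hv h0 hx)⟩
  · rintro ⟨hx, hx0⟩
    rw [← h.image_cube] at hx
    obtain ⟨v, hv, rfl⟩ := hx
    exact ⟨v, ⟨hv, fun hv0 => hx0 (by rw [hv0]; rfl)⟩, rfl⟩

/-- A characteristic map identifies the singular chains of the open cube with those of the open cell,
and in particular the local homology at the centre. -/
theorem CellChart.relIso (h : CellChart Φ e) (k : ℕ) :
    RelIso (push Φ k) (cube n) (cube n \ {0}) e (e \ {Φ 0}) := by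
  have h1 : Set.MapsTo Φ (cube n) e := fun v hv => h.mem hv
  have h2 : Set.MapsTo Φ (cube n \ {0}) (e \ {Φ 0}) := h.image_diff ▸ Set.mapsTo_image _ _
  refine ⟨fun c hc => push_mem_relZ h1 h2 hc,
    fun c hc => ⟨fun hb => ?_, fun hb => push_mem_relB h1 h2 hb⟩, fun d hd => ?_⟩
  · rw [← h.image_diff] at hb
    nth_rewrite 1 [← h.image_cube] at hb
    obtain ⟨x, hx, y, hy, hxy⟩ := mem_relB.1 hb
    obtain ⟨x, hx', rfl⟩ := h.exists_push le_rfl hx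
    obtain ⟨y, hy', rfl⟩ := h.exists_push Set.sdiff_subset hy
    rw [← push_bdry, ← map_add, ← sub_eq_zero, ← map_sub] at hxy
    have h3 := h.push_injOn (sub_mem (add_mem (bdry_mem_chainsIn hx')
      (chainsIn_mono Set.sdiff_subset hy')) (mem_relZ.1 hc).1) hxy
    exact mem_relB.2 ⟨x, hx', y, hy', sub_eq_zero.1 h3⟩
  · rw [← h.image_diff] at hd
    nth_rewrite 1 [← h.image_cube] at hd
    obtain ⟨c, hc, rfl⟩ := h.exists_push le_rfl (mem_relZ.1 hd).1
    have h3 := (mem_relZ.1 hd).2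
    rw [← push_bdry'] at h3
    obtain ⟨b, hb, hbc⟩ := h.exists_push Set.sdiff_subset h3
    rw [← sub_eq_zero, ← map_sub] at hbc
    have h4 := sub_eq_zero.1 (h.push_injOn (sub_mem (chainsIn_mono Set.sdiff_subset hb)
      (bdry'_mem_chainsIn hc)) hbc)
    refine ⟨c, mem_relZ.2 ⟨hc, h4 ▸ hb⟩, ?_⟩
    rw [sub_self]
    exact zero_mem _

/-- Attaching data for a cell: `e` is an open cell with characteristic map `Φ`, whose frontier lies
in the closed set `Z` disjoint from `e`. -/
structure Attaches (Φ : C(Fin n → ℝ, X)) (e Z : Set X) : Prop extends CellChart Φ e where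
  isClosed : IsClosed Z
  disjoint : Disjoint e Z
  mapsTo_sphere : ∀ v : Fin n → ℝ, ‖v‖ = 1 → Φ v ∈ Z

variable {Z : Set X}

theorem Attaches.mem_punctured (h : Attaches Φ e Z) {v : Fin n → ℝ} (hv : ‖v‖ ≤ 1) (hv0 : v ≠ 0) :
    Φ v ∈ (Z ∪ e) \ {Φ 0} := by
  have h0 : (0 : Fin n → ℝ) ∈ cube n := Metric.mem_ball_self one_pos
  rcases hv.lt_or_eq with hv | hv
  · have hv' : v ∈ cube n := mem_ball_zero_iff.2 hv
    exact ⟨Or.inr (h.mem hv'), fun hx => hv0 (h.injOn hv' h0 hx)⟩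
  · refine ⟨Or.inl (h.mapsTo_sphere v hv), fun hx => ?_⟩
    have hx' : Φ v = Φ 0 := hx
    exact Set.disjoint_left.1 h.disjoint (h.mem h0) (hx' ▸ h.mapsTo_sphere v hv)

theorem Attaches.mapsTo_cube (h : Attaches Φ e Z) : Set.MapsTo Φ (cube n) (Z ∪ e) :=
  fun _ hv => Or.inr (h.mem hv)

theorem Attaches.mapsTo_punctured (h : Attaches Φ e Z) :
    Set.MapsTo Φ (cube n \ {0}) ((Z ∪ e) \ {Φ 0}) :=
  fun _ hv => h.mem_punctured (mem_ball_zero_iff.1 hv.1).le hv.2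

/-- A cell minus its centre deforms radially into its frontier. -/
theorem Attaches.relAcyclic_punctured [T2Space X] (h : Attaches Φ e Z) (k : ℕ) :
    RelAcyclic k ((Z ∪ e) \ {Φ 0}) Z := by
  classical
  obtain ⟨ψ, hψc, hψ⟩ := h.exists_inverse
  -- In the coordinates of the cell the deformation is the radial expansion
  -- `v ↦ (t₀ + t₁ / ‖v‖) v`; on `Z` it is constant.
  let G : (Fin n → ℝ) × Simplex 1 → X := fun y => Φ ((y.2 0 + y.2 1 * ‖y.1‖⁻¹) • y.1)
  let F : X × Simplex 1 → X := fun y => if y.1 ∈ e then G (ψ y.1, y.2) else y.1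
  have hG : ContinuousOn G {y | y.1 ≠ 0} := by
    refine Φ.continuous.comp_continuousOn (ContinuousOn.fun_smul
      (f := fun y : (Fin n → ℝ) × Simplex 1 => y.2 0 + y.2 1 * ‖y.1‖⁻¹) ?_ continuousOn_fst)
    have h0 := (continuous_simplex_apply (n := 1) 0).comp
      (continuous_snd : Continuous (Prod.snd : (Fin n → ℝ) × Simplex 1 → _))
    have h1 := (continuous_simplex_apply (n := 1) 1).comp
      (continuous_snd : Continuous (Prod.snd : (Fin n → ℝ) × Simplex 1 → _))
    refine h0.continuousOn.add (h1.continuousOn.mul ?_)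
    exact (continuous_norm.comp continuous_fst).continuousOn.inv₀ fun y hy => norm_ne_zero_iff.2 hy
  have hmem : ∀ v : Fin n → ℝ, ‖v‖ ≤ 1 → v ≠ 0 → ∀ t : Simplex 1,
      ‖(t 0 + t 1 * ‖v‖⁻¹) • v‖ = t 0 * ‖v‖ + t 1 := fun v hv hv0 t => by
    obtain ⟨h0, h1, _⟩ := simplex_one_mem t
    have hn : ‖v‖ ≠ 0 := norm_ne_zero_iff.2 hv0
    rw [norm_smul, Real.norm_of_nonneg (by positivity), add_mul, mul_assoc, inv_mul_cancel₀ hn,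
      mul_one]
  have hFZ : ∀ x ∈ Z, ∀ t, F (x, t) = x := fun x hx t =>
    if_neg fun he => Set.disjoint_left.1 h.disjoint he hx
  have hFΦ : ∀ v : Fin n → ℝ, ‖v‖ ≤ 1 → v ≠ 0 → ∀ t, F (Φ v, t) = G (v, t) := by
    intro v hv hv0 t
    rcases hv.lt_or_eq with hv | hv
    · have hv' : v ∈ cube n := mem_ball_zero_iff.2 hv
      refine (if_pos (h.mem hv')).trans ?_
      change G (ψ (Φ v), t) = G (v, t)
      rw [hψ v hv']
    · rw [hFZ _ (h.mapsTo_sphere v hv)]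
      change Φ v = Φ ((t 0 + t 1 * ‖v‖⁻¹) • v)
      rw [hv, inv_one, mul_one, (simplex_one_mem t).2.2, one_smul]
  have hcases : ∀ x ∈ (Z ∪ e) \ {Φ 0}, x ∈ Z ∨ ∃ v : Fin n → ℝ, ‖v‖ ≤ 1 ∧ v ≠ 0 ∧ Φ v = x := by
    rintro x ⟨hx | hx, hx0⟩
    · exact Or.inl hx
    · rw [← h.image_cube] at hx
      obtain ⟨v, hv, rfl⟩ := hx
      exact Or.inr ⟨v, (mem_ball_zero_iff.1 hv).le, fun hv0 => hx0 (by rw [hv0]; rfl), rfl⟩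
  -- The preimage of a closed set is the union of its part over `Z` and of the image of its part over
  -- the closed cube. The latter is closed by compactness, once the preimage under `G`, which is
  -- closed only away from the centre, has been replaced by a closed set `C`.
  have hF : ContinuousOn F (((Z ∪ e) \ {Φ 0}) ×ˢ Set.univ) := by
    refine continuousOn_iff_isClosed.2 fun t ht => ?_
    obtain ⟨C, hC, hCt⟩ := continuousOn_iff_isClosed.1 hG t ht
    have hcomp : IsCompact (C ∩ (Metric.closedBall 0 1 ×ˢ Set.univ)) :=
      ((isCompact_closedBall _ _).prod isCompact_univ).inter_left hC
    refine ⟨(Z ∩ t) ×ˢ Set.univ ∪ (Φ.prodMap (ContinuousMap.id _)) ''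
      (C ∩ (Metric.closedBall 0 1 ×ˢ Set.univ)), ?_, ?_⟩
    · exact ((h.isClosed.inter ht).prod isClosed_univ).union
        (hcomp.image (ContinuousMap.continuous _)).isClosed
    · ext ⟨x, s⟩
      refine and_congr_left fun hx => ?_
      constructor
      · intro hxt
        rcases hcases x hx.1 with hxZ | ⟨v, hv, hv0, rfl⟩
        · left
          have : F (x, s) ∈ t := hxt
          rw [hFZ x hxZ] at this
          exact ⟨⟨hxZ, this⟩, trivial⟩
        · right
          have h1 : G (v, s) ∈ t := hFΦ v hv hv0 s ▸ hxt
          have h2 : (v, s) ∈ C ∩ {y | y.1 ≠ 0} := hCt ▸ ⟨h1, hv0⟩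
          exact ⟨(v, s), ⟨h2.1, mem_closedBall_zero_iff.2 hv, trivial⟩, rfl⟩
      · rintro (hxt | ⟨⟨v, s'⟩, ⟨hvC, hv, _⟩, hvx⟩)
        · change F (x, s) ∈ t
          rw [hFZ x hxt.1.1]
          exact hxt.1.2
        · obtain ⟨rfl, rfl⟩ := Prod.mk.inj hvx
          have hv0 : v ≠ 0 := by
            rintro rfl
            exact hx.1.2 rfl
          change F (Φ v, s') ∈ t
          rw [hFΦ v (mem_closedBall_zero_iff.1 hv) hv0]
          have h2 : (v, s') ∈ G ⁻¹' t ∩ {y | y.1 ≠ 0} := hCt ▸ ⟨hvC, hv0⟩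
          exact h2.1
  refine relAcyclic_of_deformation ⟨fun y => F (y.1, y.2), hF.comp_continuous (by fun_prop)
    fun y => ⟨y.1.2, trivial⟩⟩ ?_ ?_ ?_ ?_ k
  · rintro ⟨x, hx⟩
    change F (x, _) = x
    rcases hcases x hx with hxZ | ⟨v, hv, hv0, rfl⟩
    · exact hFZ x hxZ _
    · rw [hFΦ v hv hv0]
      simp [G]
  · rintro ⟨x, hx⟩
    change F (x, _) ∈ Z
    rcases hcases x hx with hxZ | ⟨v, hv, hv0, rfl⟩
    · rwa [hFZ x hxZ]
    · rw [hFΦ v hv hv0]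
      refine h.mapsTo_sphere _ ?_
      rw [hmem v hv hv0]
      simp
  · rintro ⟨x, hx⟩ t
    change F (x, t) ∈ _
    rcases hcases x hx with hxZ | ⟨v, hv, hv0, rfl⟩
    · rwa [hFZ x hxZ]
    · rw [hFΦ v hv hv0]
      obtain ⟨h0, h1, h01⟩ := simplex_one_mem t
      have hn : 0 < ‖v‖ := norm_pos_iff.2 hv0
      refine h.mem_punctured ?_ ?_
      · rw [hmem v hv hv0]
        nlinarith
      · rw [← norm_ne_zero_iff, hmem v hv hv0]
        rcases h0.lt_or_eq with h' | h'
        · have := mul_pos h' hn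
          linarith
        · have : t 1 = 1 := by linarith
          rw [this, ← h']
          norm_num
  · rintro ⟨x, hx⟩ t hxZ
    change F (x, t) ∈ Z
    rwa [hFZ x hxZ]

/-- Local form of the homology of a pair `(Z ∪ e, Z)`: it is that of the cube relative to the
complement of its centre. -/
theorem Attaches.relIso_local [T2Space X] (h : Attaches Φ e Z) (k : ℕ) :
    RelIso (AddMonoidHom.id (SingChain X k)) e (e \ {Φ 0}) (Z ∪ e) ((Z ∪ e) \ {Φ 0}) := by
  have hΦ0 : Φ 0 ∈ e := h.mem (Metric.mem_ball_self one_pos)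
  have h1 := relIso_excision (W := Z ∪ e) (U := {Φ 0}ᶜ) (V := Zᶜ) isOpen_compl_singleton
    h.isClosed.isOpen_compl (fun x _ => by
      by_cases hx : x = Φ 0
      · exact Or.inr fun hZ => Set.disjoint_left.1 h.disjoint hΦ0 (hx ▸ hZ)
      · exact Or.inl hx) k
  have e1 : (Z ∪ e) ∩ Zᶜ = e := by
    ext x
    constructor
    · rintro ⟨hx | hx, hxZ⟩
      · exact absurd hx hxZ
      · exact hx
    · exact fun hx => ⟨Or.inr hx, Set.disjoint_left.1 h.disjoint hx⟩
  rw [e1] at h1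
  exact h1

/-- Enlarging `Z` to the complement of the centre of the cell does not change the relative homology. -/
theorem Attaches.relIso_punctured [T2Space X] (h : Attaches Φ e Z) (k : ℕ) :
    RelIso (AddMonoidHom.id (SingChain X k)) (Z ∪ e) Z (Z ∪ e) ((Z ∪ e) \ {Φ 0}) := by
  refine relIso_id_of_relAcyclic' Set.sdiff_subset (fun x hx => ⟨Or.inl hx, fun hx0 => ?_⟩)
    (fun k => h.relAcyclic_punctured k) k
  have hx0' : x = Φ 0 := hx0
  exact Set.disjoint_left.1 h.disjoint (h.mem (Metric.mem_ball_self one_pos)) (hx0' ▸ hx)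

/-- Near the centre of the cell, a relative cycle of `(Z ∪ e, Z)` is homologous to the image of a
relative cycle of the cube. -/
theorem Attaches.exists_local [T2Space X] (h : Attaches Φ e Z) {k : ℕ} {c : SingChain X k}
    (hc : c ∈ relZ k (Z ∪ e) Z) : ∃ b ∈ relZ k (cube n) (cube n \ {0}),
      c - push Φ k b ∈ relB k (Z ∪ e) ((Z ∪ e) \ {Φ 0}) := by
  obtain ⟨d, hd, hcd⟩ := (h.relIso_local k).surj c ((h.relIso_punctured k).map_relZ c hc)
  obtain ⟨b, hb, hdb⟩ := (h.relIso k).surj d hd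
  refine ⟨b, hb, ?_⟩
  have h2 := add_mem hcd ((relB_mono Set.subset_union_right
    (Set.sdiff_subset_sdiff_left Set.subset_union_right)) hdb)
  rwa [AddMonoidHom.id_apply, sub_add_sub_cancel] at h2

/-- Attaching an `n`-cell does not change the homology in degrees different from `n`. -/
theorem Attaches.relAcyclic [T2Space X] (h : Attaches Φ e Z) {k : ℕ} (hk : k ≠ n) :
    RelAcyclic k (Z ∪ e) Z := by
  intro c hc
  obtain ⟨b, hb, hcb⟩ := h.exists_local hc
  refine ((h.relIso_punctured k).map_relB_iff c hc).1 ?_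
  have h1 := push_mem_relB h.mapsTo_cube h.mapsTo_punctured ((Hrel_cube n).2 k hk hb)
  have h2 := add_mem hcb h1
  rwa [sub_add_cancel] at h2

variable (n) in
/-- A relative cycle generating the local homology of the cube at its centre. -/
def cubeGen : SingChain (Fin n → ℝ) n := (exists_cube_generator n).choose

/-- A relative cycle of `(Z ∪ e, Z)` that represents the orientation class of the cell `e`
given by `Φ`. -/
structure IsCellCycle (Φ : C(Fin n → ℝ, X)) (e Z : Set X) (g : SingChain X n) : Prop where
  isRelCycle : g ∈ relZ n (Z ∪ e) Z
  sub_push_mem : g - push Φ n (cubeGen n) ∈ relB n (Z ∪ e) ((Z ∪ e) \ {Φ 0})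

theorem IsCellCycle.mono {Z' : Set X} {g : SingChain X n} (hg : IsCellCycle Φ e Z g) (h : Z ⊆ Z') :
    IsCellCycle Φ e Z' g :=
  ⟨relZ_mono (Set.union_subset_union_left _ h) h hg.1,
    relB_mono (Set.union_subset_union_left _ h)
      (Set.sdiff_subset_sdiff_left (Set.union_subset_union_left _ h)) hg.2⟩

theorem Attaches.exists_isCellCycle [T2Space X] (h : Attaches Φ e Z) :
    ∃ g, IsCellCycle Φ e Z g := by
  have hg : cubeGen n ∈ relZ n (cube n) (cube n \ {0}) := (exists_cube_generator n).choose_spec.1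
  have h1 : push Φ n (cubeGen n) ∈ relZ n (Z ∪ e) ((Z ∪ e) \ {Φ 0}) :=
    push_mem_relZ h.mapsTo_cube h.mapsTo_punctured hg
  obtain ⟨g, hg, hg'⟩ := (h.relIso_punctured n).surj _ h1
  refine ⟨g, hg, ?_⟩
  rw [← neg_sub]
  exact neg_mem hg'

/-- The class of a cell cycle generates `H_n(Z ∪ e, Z)`. -/
theorem IsCellCycle.exists_sub_mem [T2Space X] {g : SingChain X n} (hg : IsCellCycle Φ e Z g)
    (h : Attaches Φ e Z) {c : SingChain X n} (hc : c ∈ relZ n (Z ∪ e) Z) :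
    ∃ m : ℤ, c - m • g ∈ relB n (Z ∪ e) Z := by
  obtain ⟨b, hb, hcb⟩ := h.exists_local hc
  obtain ⟨m, hm⟩ := (exists_cube_generator n).choose_spec.2.1 b hb
  refine ⟨m, ((h.relIso_punctured n).map_relB_iff _ (sub_mem hc (zsmul_mem hg.isRelCycle m))).1 ?_⟩
  have h1 : push Φ n (b - m • cubeGen n) ∈ relB n (Z ∪ e) ((Z ∪ e) \ {Φ 0}) :=
    push_mem_relB h.mapsTo_cube h.mapsTo_punctured hm
  have h2 := sub_mem (add_mem hcb h1) (zsmul_mem hg.sub_push_mem m)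
  rw [map_sub, map_zsmul, smul_sub] at h2
  rw [AddMonoidHom.id_apply]
  convert h2 using 1
  abel

/-- The class of a cell cycle has infinite order in `H_n(Z ∪ e, Z)`. -/
theorem IsCellCycle.eq_zero_of_zsmul_mem [T2Space X] {g : SingChain X n}
    (hg : IsCellCycle Φ e Z g) (h : Attaches Φ e Z) {m : ℤ}
    (hm : m • g ∈ relB n (Z ∪ e) Z) : m = 0 := by
  have hgen1 : cubeGen n ∈ relZ n (cube n) (cube n \ {0}) := (exists_cube_generator n).choose_spec.1
  have hgen := (exists_cube_generator n).choose_spec.2.2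
  have h1 := ((h.relIso_punctured n).map_relB_iff _ (zsmul_mem hg.isRelCycle m)).2 hm
  have h2 : push Φ n (m • cubeGen n) ∈ relB n (Z ∪ e) ((Z ∪ e) \ {Φ 0}) := by
    have h3 := sub_mem h1 (zsmul_mem hg.sub_push_mem m)
    convert h3 using 1
    rw [map_zsmul, AddMonoidHom.id_apply, smul_sub]
    abel
  have hz : m • cubeGen n ∈ relZ n (cube n) (cube n \ {0}) := zsmul_mem hgen1 m
  exact hgen m (((h.relIso n).map_relB_iff _ hz).1
    (((h.relIso_local n).map_relB_iff _ ((h.relIso n).map_relZ _ hz)).1 h2))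

end Attach

/-! ### Singular chains of a CW complex -/

section ChainSupport

variable {X : Type u} [TopologicalSpace X]

/-- The union of the images of the simplices of a singular chain. -/
def chainSupport {n : ℕ} (c : SingChain X n) : Set X := ⋃ σ ∈ c.support, Set.range σ

theorem isCompact_chainSupport {n : ℕ} (c : SingChain X n) : IsCompact (chainSupport c) :=
  c.support.finite_toSet.isCompact_biUnion fun σ _ => isCompact_range σ.continuous

theorem mem_chainsIn_iff_support {n : ℕ} {c : SingChain X n} {U : Set X} :
    c ∈ chainsIn n U ↔ chainSupport c ⊆ U := by
  rw [mem_chainsIn_iff, chainSupport, Set.iUnion₂_subset_iff]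

end ChainSupport

section CW

open Topology.RelCWComplex (cell openCell closedCell cellFrontier skeletonLT)

variable {X : Type u} [TopologicalSpace X] [Topology.CWComplex (Set.univ : Set X)]

theorem exists_mem_openCell (x : X) :
    ∃ s : Σ n, cell (Set.univ : Set X) n, x ∈ openCell s.1 s.2 := by
  have h : x ∈ ⋃ (n : ℕ) (j : cell (Set.univ : Set X) n), openCell (C := (Set.univ : Set X)) n j :=
    (Topology.CWComplex.iUnion_openCell_eq_complex (C := (Set.univ : Set X))).symm ▸ Set.mem_univ x
  obtain ⟨n, e, he⟩ := Set.mem_iUnion₂.1 h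
  exact ⟨⟨n, e⟩, he⟩

theorem eq_of_mem_openCell {s t : Σ n, cell (Set.univ : Set X) n} {x : X}
    (hs : x ∈ openCell s.1 s.2) (ht : x ∈ openCell t.1 t.2) : s = t := by
  by_contra h
  exact Set.disjoint_left.1
    (Topology.RelCWComplex.disjoint_openCell_of_ne (i := s.2) (j := t.2) h) hs ht

theorem eq_of_mem_openCell' {n : ℕ} {e e' : cell (Set.univ : Set X) n} {x : X}
    (hs : x ∈ openCell n e) (ht : x ∈ openCell n e') : e = e' :=
  eq_of_heq (Sigma.mk.inj (eq_of_mem_openCell (s := ⟨n, e⟩) (t := ⟨n, e'⟩) hs ht)).2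

/-- The characteristic map of a cell, extended to all of `ℝⁿ` by precomposition with the
coordinatewise projection to the closed cube. -/
def charMap (n : ℕ) (e : cell (Set.univ : Set X) n) : C(Fin n → ℝ, X) where
  toFun v := Topology.RelCWComplex.map n e fun i => max (-1) (min 1 (v i))
  continuous_toFun := by
    refine (Topology.RelCWComplex.continuousOn n e).comp_continuous (by fun_prop) fun v => ?_
    rw [mem_closedBall_zero_iff, pi_norm_le_iff_of_nonneg zero_le_one]
    exact fun i => abs_le.2 ⟨le_max_left _ _, max_le (by norm_num) (min_le_left _ _)⟩

theorem charMap_eq {n : ℕ} (e : cell (Set.univ : Set X) n) {v : Fin n → ℝ} (hv : ‖v‖ ≤ 1) :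
    charMap n e v = Topology.RelCWComplex.map n e v := by
  refine congrArg (Topology.RelCWComplex.map n e) (funext fun i => ?_)
  have h := abs_le.1 ((norm_le_pi_norm v i).trans hv)
  rw [min_eq_right h.2, max_eq_right h.1]

theorem cellChart_charMap {n : ℕ} (e : cell (Set.univ : Set X) n) :
    CellChart (charMap n e) (openCell n e) where
  image_cube := Set.image_congr fun v hv => charMap_eq e (mem_ball_zero_iff.1 hv).le
  exists_inverse := by
    refine ⟨(Topology.RelCWComplex.map n e).symm, ?_, fun v hv => ?_⟩
    · have h := Topology.RelCWComplex.continuousOn_symm n e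
      rwa [← (Topology.RelCWComplex.map n e).image_source_eq_target,
        Topology.RelCWComplex.source_eq n e] at h
    · rw [charMap_eq e (mem_ball_zero_iff.1 hv).le]
      refine (Topology.RelCWComplex.map n e).left_inv ?_
      rw [Topology.RelCWComplex.source_eq n e]
      exact hv

variable [T2Space X]

variable (X) in
/-- The union of the open cells of dimension less than `n`. -/
def skel (n : ℕ) : Set X := (skeletonLT (Set.univ : Set X) (n : ℕ∞) :
  Topology.RelCWComplex.Subcomplex (Set.univ : Set X))

theorem mem_skel_iff {n : ℕ} {x : X} :
    x ∈ skel X n ↔ ∃ m < n, ∃ e : cell (Set.univ : Set X) m, x ∈ openCell m e := by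
  refine Topology.CWComplex.mem_skeletonLT_iff.trans ?_
  simp only [exists_prop, Nat.cast_lt]

/-- A set with at most one point in every open cell is closed. -/
theorem isClosed_of_openCell_subsingleton {T : Set X}
    (hT : ∀ s : Σ n, cell (Set.univ : Set X) n, (T ∩ openCell s.1 s.2).Subsingleton) :
    IsClosed T := by
  refine (Topology.CWComplex.closed Set.univ T (Set.subset_univ _)).2 fun n e => ?_
  refine Set.Finite.isClosed ?_
  rw [← Topology.RelCWComplex.cellFrontier_union_openCell_eq_closedCell, Set.inter_union_distrib_left]
  refine Set.Finite.union ?_ (hT ⟨n, e⟩).finite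
  obtain ⟨I, hI⟩ := Topology.CWComplex.cellFrontier_subset_finite_openCell n e
  refine Set.Finite.subset (s := ⋃ m ∈ Finset.range n, ⋃ j ∈ I m, T ∩ openCell m j) ?_ ?_
  · exact Set.Finite.biUnion (Finset.finite_toSet _) fun m _ =>
      Set.Finite.biUnion (Finset.finite_toSet _) fun j _ => (hT ⟨m, j⟩).finite
  · rintro x ⟨hxT, hx⟩
    obtain ⟨m, hm, j, hj, hxj⟩ : ∃ m, m < n ∧ ∃ j ∈ I m, x ∈ openCell m j := by
      simpa using hI hx
    simp only [Set.mem_iUnion, Finset.mem_range]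
    exact ⟨m, hm, j, hj, hxT, hxj⟩

/-- A compact subset of a CW complex meets only finitely many open cells. -/
theorem finite_openCell_of_isCompact {K : Set X} (hK : IsCompact K) :
    {s : Σ n, cell (Set.univ : Set X) n | (K ∩ openCell s.1 s.2).Nonempty}.Finite := by
  set S := {s : Σ n, cell (Set.univ : Set X) n | (K ∩ openCell s.1 s.2).Nonempty}
  -- One point is chosen in each cell that meets `K`. All subsets of the set of these points are closed,
  -- so it has no accumulation point; being contained in `K`, it is finite.
  have hne : ∀ s : Σ n, cell (Set.univ : Set X) n, ∃ x, s ∈ S → x ∈ K ∩ openCell s.1 s.2 := fun s => by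
    obtain ⟨y, hy⟩ := Topology.RelCWComplex.openCell_nonempty s.1 s.2
    by_cases hs : s ∈ S
    · exact ⟨_, fun _ => hs.some_mem⟩
    · exact ⟨y, fun h => absurd h hs⟩
  choose p hp using hne
  have hinj : Set.InjOn p S := fun s hs t ht hst =>
    eq_of_mem_openCell (hp s hs).2 (hst ▸ (hp t ht).2)
  have hcl : ∀ T ⊆ p '' S, IsClosed T := fun T hT => by
    refine isClosed_of_openCell_subsingleton fun s x hx y hy => ?_
    obtain ⟨a, ha, rfl⟩ := hT hx.1
    obtain ⟨b, hb, rfl⟩ := hT hy.1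
    rw [eq_of_mem_openCell (hp a ha).2 hx.2, eq_of_mem_openCell (hp b hb).2 hy.2]
  refine Set.Finite.of_finite_image ?_ hinj
  by_contra hinf
  obtain ⟨x, -, hx⟩ := Set.Infinite.exists_accPt_of_subset_isCompact hinf hK
    (Set.image_subset_iff.2 fun s hs => (hp s hs).1)
  rw [accPt_principal_iff_clusterPt, ← mem_closure_iff_clusterPt,
    (hcl _ Set.sdiff_subset).closure_eq] at hx
  exact hx.2 rfl

/-- A closed union of cells. -/
structure CellClosed (F : Set X) : Prop where
  isClosed : IsClosed F
  openCell_subset : ∀ n (e : cell (Set.univ : Set X) n), (F ∩ openCell n e).Nonempty →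
    openCell n e ⊆ F

variable {F : Set X}

theorem CellClosed.closedCell_subset (hF : CellClosed F) {n : ℕ} {e : cell (Set.univ : Set X) n}
    (h : openCell n e ⊆ F) : closedCell n e ⊆ F := by
  rw [← Topology.RelCWComplex.closure_openCell_eq_closedCell]
  exact hF.isClosed.closure_subset_iff.2 h

theorem isClosed_skel (n : ℕ) : IsClosed (skel X n) :=
  (skeletonLT (Set.univ : Set X) (n : ℕ∞)).closed

theorem skel_mono {m n : ℕ} (h : m ≤ n) : skel X m ⊆ skel X n :=
  Topology.RelCWComplex.skeletonLT_mono (by exact_mod_cast h)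

theorem skel_zero : skel X 0 = ∅ := Topology.CWComplex.skeletonLT_zero_eq_empty

/-- Every singular chain lies in some skeleton. -/
theorem exists_mem_chainsIn_skel {k : ℕ} {c : SingChain X k} (hc : c ∈ chainsIn k F) :
    ∃ n, c ∈ chainsIn k (skel X n ∩ F) := by
  have hfin := finite_openCell_of_isCompact (isCompact_chainSupport c)
  obtain ⟨N, hN⟩ := (hfin.image Sigma.fst).bddAbove
  refine ⟨N + 1, mem_chainsIn_iff_support.2 fun x hx => ⟨?_, mem_chainsIn_iff_support.1 hc hx⟩⟩
  obtain ⟨s, hs⟩ := exists_mem_openCell x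
  exact mem_skel_iff.2 ⟨s.1, Nat.lt_succ_of_le (hN ⟨s, ⟨x, hx, hs⟩, rfl⟩), s.2, hs⟩

/-- The union of the `(n-1)`-skeleton of `F` and some `n`-cells. -/
def addCells (F : Set X) (n : ℕ) (T : Finset (cell (Set.univ : Set X) n)) : Set X :=
  skel X n ∩ F ∪ ⋃ e ∈ T, openCell n e

theorem addCells_empty (n : ℕ) : addCells F n ∅ = skel X n ∩ F := by
  simp [addCells]

theorem addCells_insert {n : ℕ} [DecidableEq (cell (Set.univ : Set X) n)]
    (T : Finset (cell (Set.univ : Set X) n)) (e : cell (Set.univ : Set X) n) :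
    addCells F n (insert e T) = addCells F n T ∪ openCell n e := by
  rw [addCells, addCells, Finset.set_biUnion_insert, Set.union_comm (openCell n e),
    Set.union_assoc]

theorem skel_subset_addCells {n : ℕ} {T : Finset (cell (Set.univ : Set X) n)} :
    skel X n ∩ F ⊆ addCells F n T := Set.subset_union_left

theorem addCells_subset {n : ℕ} {T : Finset (cell (Set.univ : Set X) n)}
    (hT : ∀ e ∈ T, openCell n e ⊆ F) : addCells F n T ⊆ skel X (n + 1) ∩ F := by
  refine Set.union_subset (Set.inter_subset_inter_left _ (skel_mono n.le_succ))
    (Set.iUnion₂_subset fun e he x hx => ⟨?_, hT e he hx⟩)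
  exact mem_skel_iff.2 ⟨n, n.lt_succ_self, e, hx⟩

/-- Every chain of the `n`-skeleton meets only finitely many `n`-cells. -/
theorem exists_mem_chainsIn_addCells (hF : CellClosed F) {n k : ℕ} {c : SingChain X k}
    (hc : c ∈ chainsIn k (skel X (n + 1) ∩ F)) :
    ∃ T : Finset (cell (Set.univ : Set X) n), (∀ e ∈ T, openCell n e ⊆ F) ∧
      ∀ T', T ⊆ T' → c ∈ chainsIn k (addCells F n T') := by
  classical
  have hfin := (finite_openCell_of_isCompact (isCompact_chainSupport c)).preimage
    (f := Sigma.mk n) sigma_mk_injective.injOn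
  refine ⟨hfin.toFinset, fun e he => ?_, fun T' hT' => mem_chainsIn_iff_support.2 fun x hx => ?_⟩
  · obtain ⟨x, hx, hxe⟩ := hfin.mem_toFinset.1 he
    exact hF.openCell_subset n e ⟨x, (mem_chainsIn_iff_support.1 hc hx).2, hxe⟩
  · have hx' := mem_chainsIn_iff_support.1 hc hx
    obtain ⟨m, hm, e, he⟩ := mem_skel_iff.1 hx'.1
    rcases (Nat.lt_succ_iff.1 hm).lt_or_eq with hm | rfl
    · exact Or.inl ⟨mem_skel_iff.2 ⟨m, hm, e, he⟩, hx'.2⟩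
    · exact Or.inr (Set.mem_iUnion₂.2 ⟨e, hT' (hfin.mem_toFinset.2 ⟨x, hx, he⟩), he⟩)

theorem isClosed_addCells (hF : CellClosed F) {n : ℕ} {T : Finset (cell (Set.univ : Set X) n)}
    (hT : ∀ e ∈ T, openCell n e ⊆ F) : IsClosed (addCells F n T) := by
  have h : addCells F n T = skel X n ∩ F ∪ ⋃ e ∈ T, closedCell n e := by
    refine subset_antisymm (Set.union_subset_union_right _ (Set.iUnion₂_mono fun e _ =>
      Topology.RelCWComplex.openCell_subset_closedCell n e)) (Set.union_subset
      Set.subset_union_left (Set.iUnion₂_subset fun e he x hx => ?_))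
    have hxF := hF.closedCell_subset (hT e he) hx
    rw [← Topology.RelCWComplex.cellFrontier_union_openCell_eq_closedCell] at hx
    rcases hx with hx | hx
    · exact Or.inl ⟨Topology.RelCWComplex.cellFrontier_subset_skeletonLT n e hx, hxF⟩
    · exact Or.inr (Set.mem_iUnion₂.2 ⟨e, he, hx⟩)
  rw [h]
  exact ((isClosed_skel n).inter hF.isClosed).union (T.finite_toSet.isClosed_biUnion fun e _ =>
    Topology.RelCWComplex.isClosed_closedCell)

/-- `Φ` is a characteristic map of the cell `e`, not necessarily the one chosen in the
CW structure. -/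
structure IsCharMap {n : ℕ} (Φ : C(Fin n → ℝ, X)) (e : cell (Set.univ : Set X) n) : Prop extends
    CellChart Φ (openCell n e) where
  mapsTo_sphere : ∀ v : Fin n → ℝ, ‖v‖ = 1 → Φ v ∈ skel X n

theorem isCharMap_charMap {n : ℕ} (e : cell (Set.univ : Set X) n) : IsCharMap (charMap n e) e where
  toCellChart := cellChart_charMap e
  mapsTo_sphere v hv := Topology.RelCWComplex.cellFrontier_subset_skeletonLT n e
    ⟨v, mem_sphere_zero_iff_norm.2 hv, (charMap_eq e hv.le).symm⟩

theorem IsCharMap.attaches (hF : CellClosed F) {n : ℕ} {T : Finset (cell (Set.univ : Set X) n)}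
    (hT : ∀ e ∈ T, openCell n e ⊆ F) {e : cell (Set.univ : Set X) n} (he : openCell n e ⊆ F)
    (heT : e ∉ T) {Φ : C(Fin n → ℝ, X)} (hΦ : IsCharMap Φ e) :
    Attaches Φ (openCell n e) (addCells F n T) where
  toCellChart := hΦ.toCellChart
  isClosed := isClosed_addCells hF hT
  disjoint := by
    refine Set.disjoint_left.2 fun x hx hx' => ?_
    rcases hx' with hx' | hx'
    · exact Set.disjoint_left.1
        (Topology.RelCWComplex.disjoint_skeletonLT_openCell (n := (n : ℕ∞)) le_rfl) hx'.1 hx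
    · obtain ⟨e', he', hxe'⟩ := Set.mem_iUnion₂.1 hx'
      exact heT (eq_of_mem_openCell' hx hxe' ▸ he')
  mapsTo_sphere v hv := by
    have h : v ∈ closure (cube n) := by
      rw [cube, closure_ball _ one_ne_zero]
      exact mem_closedBall_zero_iff.2 hv.le
    have h' : Φ v ∈ closedCell n e := by
      rw [← Topology.RelCWComplex.closure_openCell_eq_closedCell]
      exact map_mem_closure Φ.continuous h fun w hw => hΦ.mem hw
    exact Or.inl ⟨hΦ.mapsTo_sphere v hv, hF.closedCell_subset he h'⟩

theorem relAcyclic_addCells (hF : CellClosed F) {n k : ℕ} (hk : k ≠ n)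
    (T : Finset (cell (Set.univ : Set X) n)) (hT : ∀ e ∈ T, openCell n e ⊆ F) :
    RelAcyclic k (addCells F n T) (skel X n ∩ F) := by
  classical
  induction T using Finset.induction_on with
  | empty =>
    rw [addCells_empty]
    exact fun c hc => chainsIn_le_relB hc.1
  | insert e T heT ih =>
    have hT' : ∀ e ∈ T, openCell n e ⊆ F := fun e he => hT e (Finset.mem_insert_of_mem he)
    rw [addCells_insert]
    exact RelAcyclic.trans Set.subset_union_left skel_subset_addCells
      ((IsCharMap.attaches hF hT' (hT e (Finset.mem_insert_self e T)) heT
        (isCharMap_charMap e)).relAcyclic hk) (ih hT')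

/-- The relative homology of consecutive skeleta is concentrated in one degree. -/
theorem relAcyclic_skel (hF : CellClosed F) {n k : ℕ} (hk : k ≠ n) :
    RelAcyclic k (skel X (n + 1) ∩ F) (skel X n ∩ F) := by
  intro c hc
  obtain ⟨T, hT, hcT⟩ := exists_mem_chainsIn_addCells hF hc.1
  exact relB_mono (addCells_subset hT) le_rfl
    (relAcyclic_addCells hF hk T hT ⟨hcT T le_rfl, hc.2⟩)

/-- The homology of the pair of skeleta `(X^{(m+j)}, X^{(m)})` vanishes up to degree `m`. -/
theorem relAcyclic_skel_of_lt (hF : CellClosed F) {m n k : ℕ} (hmn : m ≤ n) (hk : k < m) :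
    RelAcyclic k (skel X n ∩ F) (skel X m ∩ F) := by
  induction n, hmn using Nat.le_induction with
  | base => exact fun c hc => chainsIn_le_relB hc.1
  | succ n hn ih =>
    exact RelAcyclic.trans (Set.inter_subset_inter_left _ (skel_mono n.le_succ))
      (Set.inter_subset_inter_left _ (skel_mono hn)) (relAcyclic_skel hF (by omega)) ih

/-- The homology of a skeleton vanishes above its dimension. -/
theorem relAcyclic_skel_empty (hF : CellClosed F) {n k : ℕ} (hk : n ≤ k) :
    RelAcyclic k (skel X n ∩ F) ∅ := by
  induction n with
  | zero =>
    rw [skel_zero, Set.empty_inter]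
    exact fun c hc => chainsIn_le_relB hc.1
  | succ n ih =>
    exact RelAcyclic.trans (Set.inter_subset_inter_left _ (skel_mono n.le_succ))
      (Set.empty_subset _) (relAcyclic_skel hF (by omega)) (ih (by omega))

section Basis

variable {n : ℕ} {Φ : cell (Set.univ : Set X) n → C(Fin n → ℝ, X)}
  {g : cell (Set.univ : Set X) n → SingChain X n}

theorem isCellCycle_addCells {T : Finset (cell (Set.univ : Set X) n)}
    {e : cell (Set.univ : Set X) n}
    (hg : IsCellCycle (Φ e) (openCell n e) (skel X n ∩ F) (g e)) :
    IsCellCycle (Φ e) (openCell n e) (addCells F n T) (g e) :=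
  hg.mono skel_subset_addCells

theorem exists_sub_sum_mem_addCells (hF : CellClosed F) (hΦ : ∀ e, IsCharMap (Φ e) e)
    (hg : ∀ e, openCell n e ⊆ F → IsCellCycle (Φ e) (openCell n e) (skel X n ∩ F) (g e))
    (T : Finset (cell (Set.univ : Set X) n)) (hT : ∀ e ∈ T, openCell n e ⊆ F) (c : SingChain X n)
    (hc : c ∈ relZ n (addCells F n T) (skel X n ∩ F)) :
    ∃ m : cell (Set.univ : Set X) n → ℤ,
      c - ∑ e ∈ T, m e • g e ∈ relB n (addCells F n T) (skel X n ∩ F) := by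
  classical
  induction T using Finset.induction_on generalizing c with
  | empty =>
    rw [addCells_empty] at hc ⊢
    exact ⟨0, by simpa using chainsIn_le_relB hc.1⟩
  | insert e T heT ih =>
    have hT' : ∀ e ∈ T, openCell n e ⊆ F := fun e he => hT e (Finset.mem_insert_of_mem he)
    have heF := hT e (Finset.mem_insert_self e T)
    rw [addCells_insert] at hc ⊢
    have hcyc := isCellCycle_addCells (T := T) (hg e heF)
    obtain ⟨a, ha⟩ := hcyc.exists_sub_mem (IsCharMap.attaches hF hT' heF heT (hΦ e))
      (relZ_mono le_rfl skel_subset_addCells hc)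
    obtain ⟨x, hx, y, hy, hxy⟩ := mem_relB.1 ha
    have hy' : y ∈ relZ n (addCells F n T) (skel X n ∩ F) := by
      refine mem_relZ.2 ⟨hy, ?_⟩
      have h1 : y = c - a • g e - bdry n x := by rw [← hxy]; abel
      rw [h1, map_sub, map_sub, map_zsmul, bdry'_bdry, sub_zero]
      exact sub_mem (mem_relZ.1 hc).2 (zsmul_mem (mem_relZ.1 (hg e heF).isRelCycle).2 a)
    obtain ⟨m, hm⟩ := ih hT' y hy'
    refine ⟨fun e' => if e' = e then a else m e', ?_⟩
    have h1 : (if e = e then a else m e) • g e = a • g e := by rw [if_pos rfl]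
    have h2 : ∑ e' ∈ T, (if e' = e then a else m e') • g e' = ∑ e' ∈ T, m e' • g e' :=
      Finset.sum_congr rfl fun e' he' => by
        rw [if_neg]
        rintro rfl
        exact heT he'
    have h3 : c - (a • g e + ∑ e' ∈ T, m e' • g e') =
        bdry n x + (y - ∑ e' ∈ T, m e' • g e') := by
      rw [← sub_sub, ← hxy]
      abel
    rw [Finset.sum_insert heT, h1, h2, h3]
    exact add_mem (bdry_mem_relB hx) (relB_mono Set.subset_union_left le_rfl hm)

/-- The cells of `F` span its cellular chains. -/
theorem exists_sub_sum_mem (hF : CellClosed F) (hΦ : ∀ e, IsCharMap (Φ e) e)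
    (hg : ∀ e, openCell n e ⊆ F → IsCellCycle (Φ e) (openCell n e) (skel X n ∩ F) (g e))
    {c : SingChain X n} (hc : c ∈ relZ n (skel X (n + 1) ∩ F) (skel X n ∩ F)) :
    ∃ (T : Finset (cell (Set.univ : Set X) n)) (m : cell (Set.univ : Set X) n → ℤ),
      (∀ e ∈ T, openCell n e ⊆ F) ∧
        c - ∑ e ∈ T, m e • g e ∈ relB n (skel X (n + 1) ∩ F) (skel X n ∩ F) := by
  obtain ⟨T, hT, hcT⟩ := exists_mem_chainsIn_addCells hF hc.1
  obtain ⟨m, hm⟩ := exists_sub_sum_mem_addCells hF hΦ hg T hT c ⟨hcT T le_rfl, hc.2⟩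
  exact ⟨T, m, hT, relB_mono (addCells_subset hT) le_rfl hm⟩

/-- The cells of `F` are linearly independent in its cellular chains. -/
theorem eq_zero_of_sum_mem (hF : CellClosed F) (hΦ : ∀ e, IsCharMap (Φ e) e)
    (hg : ∀ e, openCell n e ⊆ F → IsCellCycle (Φ e) (openCell n e) (skel X n ∩ F) (g e))
    {T : Finset (cell (Set.univ : Set X) n)} (hT : ∀ e ∈ T, openCell n e ⊆ F)
    {m : cell (Set.univ : Set X) n → ℤ}
    (hm : ∑ e ∈ T, m e • g e ∈ relB n (skel X (n + 1) ∩ F) (skel X n ∩ F)) :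
    ∀ e ∈ T, m e = 0 := by
  classical
  intro e he
  obtain ⟨x, hx, y, hy, hxy⟩ := mem_relB.1 hm
  obtain ⟨T₀, hT₀, hxT⟩ := exists_mem_chainsIn_addCells hF hx
  -- The cell `e` is attached last: `T'` consists of all the other cells that occur in the relation, whose
  -- cycles vanish modulo `addCells F n T'`, so that the relation becomes one for the cycle of `e` alone.
  let T' := (T₀ ∪ T).erase e
  have hT' : ∀ e' ∈ T', openCell n e' ⊆ F := fun e' he' => by
    rcases Finset.mem_union.1 (Finset.mem_of_mem_erase he') with h | h
    · exact hT₀ e' h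
    · exact hT e' h
  have hins : insert e T' = T₀ ∪ T := Finset.insert_erase (Finset.mem_union_right _ he)
  have hx' := hxT (insert e T') (hins ▸ Finset.subset_union_left)
  rw [addCells_insert] at hx'
  refine (isCellCycle_addCells (T := T') (hg e (hT e he))).eq_zero_of_zsmul_mem
    (IsCharMap.attaches hF hT' (hT e he) (Finset.notMem_erase e _) (hΦ e)) ?_
  have h1 : m e • g e = bdry n x + y - ∑ e' ∈ T.erase e, m e' • g e' := by
    rw [hxy, ← Finset.add_sum_erase T _ he, add_sub_cancel_right]
  rw [h1]
  refine sub_mem (mem_relB.2 ⟨x, hx', y, chainsIn_mono skel_subset_addCells hy, rfl⟩)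
    (chainsIn_le_relB (sum_mem fun e' he' => zsmul_mem ?_ _))
  have he'T := Finset.mem_of_mem_erase he'
  refine chainsIn_mono (Set.union_subset skel_subset_addCells ?_) (hg e' (hT e' he'T)).isRelCycle.1
  exact fun z hz => Or.inr (Set.mem_iUnion₂.2 ⟨e', Finset.mem_erase.2
    ⟨Finset.ne_of_mem_erase he', Finset.mem_union_right _ he'T⟩, hz⟩)

end Basis

end CW

/-! ### Coefficient systems with a basis permuted by the group -/

section Lifting

variable {G : Type v} [Group G]

/-- An element `g` with `g⁻¹ A.H g ⊆ B.H` defines a morphism of orbits, sending the base coset to that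
of `g`. -/
theorem Orb.exists_hom {A B : Orb G} (g : G) (hg : ∀ a ∈ A.H, g⁻¹ * a * g ∈ B.H) :
    ∃ φ : A ⟶ B, ((Orb.rep φ : G) : G ⧸ B.H) = (g : G ⧸ B.H) := by
  let f : G ⧸ A.H → G ⧸ B.H := Quotient.lift (fun x : G => ((x * g : G) : G ⧸ B.H))
    fun x y hxy => by
      refine QuotientGroup.eq.2 ?_
      have h := hg _ (QuotientGroup.leftRel_apply.1 hxy)
      simpa [mul_assoc] using h
  let φ : (G ⧸ A.H) →[G] (G ⧸ B.H) :=
    { toFun := f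
      map_smul' := fun x y => by
        induction y using QuotientGroup.induction_on with
        | H y => exact congrArg _ (mul_assoc x y g) }
  refine ⟨φ, (Orb.rep_spec (A := A) (B := B) φ).symm.trans ?_⟩
  change ((1 * g : G) : G ⧸ B.H) = _
  rw [one_mul]

theorem Orb.hom_ext {A B : Orb G} {φ ψ : A ⟶ B}
    (h : ((Orb.rep φ : G) : G ⧸ B.H) = ((Orb.rep ψ : G) : G ⧸ B.H)) : φ = ψ := by
  refine MulActionHom.ext (f := Orb.app φ) (g := Orb.app ψ) fun x => ?_
  induction x using QuotientGroup.induction_on with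
  | H x =>
    rw [Orb.app_coe, Orb.app_coe]
    exact congrArg (fun y => x • y) h

/-- The lifting property of a projective coefficient system, in a form that asks only for
liftability of elements. -/
def HasLifting (P : Coeff.{v, u} G) : Prop :=
  ∀ (E N : Coeff.{v, u} G) (p : E ⟶ N) (f : P ⟶ N),
    (∀ A (x : P.obj A), ∃ y : E.obj A, p.app A y = f.app A x) → ∃ g : P ⟶ E, g ≫ p = f

/-- The fixed points of `A` in a `G`-set. -/
abbrev FixedBy (A : Orb G) (J : Type u) [MulAction G J] : Type u :=
  {j : J // ∀ a ∈ A.H, a • j = j}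

theorem smul_fixedBy {J : Type u} [MulAction G J] {A B : Orb G} {g : G}
    (hg : ∀ a ∈ A.H, g⁻¹ * a * g ∈ B.H) {j : J} (hj : ∀ b ∈ B.H, b • j = j) :
    ∀ a ∈ A.H, a • g • j = g • j := by
  intro a ha
  rw [← inv_smul_eq_iff, ← mul_smul, ← mul_smul]
  exact hj _ (hg a ha)

/-- Yoneda's lemma for orbits: a coefficient system whose values have bases given by the fixed
points of a `G`-set with finite stabilizers is projective, since it is a direct sum of free
coefficient systems on the orbits `G/G_j`. -/
theorem hasLifting_of_basis {J : Type u} [MulAction G J]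
    (hfin : ∀ j : J, Finite (MulAction.stabilizer G j)) {P : Coeff.{v, u} G}
    (b : ∀ A : Orb G, Module.Basis (FixedBy A J) ℤ (P.obj (op A)))
    (hb : ∀ {A B : Orb G} (φ : A ⟶ B) (j : FixedBy B J), P.map φ.op (b B j) =
      b A ⟨Orb.rep φ • j.1, smul_fixedBy (Orb.rep_conj φ) j.2⟩) :
    HasLifting P := by
  intro E N p f hpf
  let O : J → Orb G := fun j => ⟨MulAction.stabilizer G j, hfin j⟩
  -- `r j` is the chosen representative of the orbit of `j`, and `γ j` translates it to `j`. The value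
  -- on a representative is lifted to `y`, and transported to `j` along a morphism `φ : A ⟶ G/G_{r j}`
  -- that takes `r j` to `j`. There is only one such morphism (`hL`), which gives naturality.
  let r : J → J := fun j => (Quotient.mk (MulAction.orbitRel G J) j).out
  have hr : ∀ (g : G) (j : J), r (g • j) = r j := fun g j =>
    congrArg Quotient.out (Quotient.sound ⟨g, rfl⟩)
  have hγ : ∀ j, ∃ g : G, g • r j = j := fun j =>
    (MulAction.orbitRel G J).symm (Quotient.mk_out (s := MulAction.orbitRel G J) j)
  choose γ hγ using hγ
  have hO : ∀ j, ∀ a ∈ (O j).H, a • j = j := fun j a ha => ha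
  choose y hy using fun j => hpf (op (O j)) (b (O j) ⟨j, hO j⟩)
  have hmor : ∀ (A : Orb G) (j : FixedBy A J), ∃ φ : A ⟶ O (r j.1), Orb.rep φ • r j.1 = j.1 := by
    intro A j
    obtain ⟨φ, hφ⟩ := Orb.exists_hom (A := A) (B := O (r j.1)) (γ j.1) fun a ha => by
      change ((γ j.1)⁻¹ * a * γ j.1) • r j.1 = r j.1
      rw [mul_smul, mul_smul, hγ, j.2 a ha, inv_smul_eq_iff, hγ]
    refine ⟨φ, ?_⟩
    have h : ((γ j.1)⁻¹ * Orb.rep φ) • r j.1 = r j.1 := QuotientGroup.eq.1 hφ.symm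
    rwa [mul_smul, inv_smul_eq_iff, hγ] at h
  choose φ hφ using hmor
  let L : ∀ A : Orb G, FixedBy A J → E.obj (op A) := fun A j => E.map (φ A j).op (y (r j.1))
  have hL : ∀ (A : Orb G) (j : FixedBy A J) (i : J) (_ : r j.1 = i) (ψ : A ⟶ O i),
      Orb.rep ψ • i = j.1 → L A j = E.map ψ.op (y i) := by
    rintro A j _ rfl ψ hψ
    have h : φ A j = ψ := Orb.hom_ext (QuotientGroup.eq.2 (by
      change ((Orb.rep (φ A j))⁻¹ * Orb.rep ψ) • r j.1 = r j.1
      rw [mul_smul, hψ, inv_smul_eq_iff, hφ]))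
    rw [← h]
  let g : P ⟶ E :=
    { app := fun A => AddCommGrpCat.ofHom ((b A.unop).constr ℤ (L A.unop)).toAddMonoidHom
      naturality := fun B A ψ => by
        have h : ((b A.unop).constr ℤ (L A.unop)) ∘ₗ (P.map ψ).hom.toIntLinearMap =
            (E.map ψ).hom.toIntLinearMap ∘ₗ ((b B.unop).constr ℤ (L B.unop)) := by
          refine (b B.unop).ext fun j => ?_
          change (b A.unop).constr ℤ (L A.unop) (P.map ψ (b B.unop j)) =
            E.map ψ ((b B.unop).constr ℤ (L B.unop) (b B.unop j))
          rw [(b B.unop).constr_basis]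
          refine (congrArg _ (hb ψ.unop j)).trans ?_
          rw [(b A.unop).constr_basis, hL A.unop _ (r j.1) (hr _ _) (ψ.unop ≫ φ B.unop j)]
          · exact ConcreteCategory.congr_hom (E.map_comp (φ B.unop j).op ψ) _
          · have h := QuotientGroup.eq.1 (Orb.rep_comp ψ.unop (φ B.unop j))
            have h' : ((Orb.rep (ψ.unop ≫ φ B.unop j))⁻¹ * (Orb.rep ψ.unop *
              Orb.rep (φ B.unop j))) • r j.1 = r j.1 := h
            rw [mul_smul, inv_smul_eq_iff, mul_smul, hφ] at h'
            exact h'.symm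
        ext x
        exact LinearMap.congr_fun h x }
  refine ⟨g, ?_⟩
  ext A x
  have h : (p.app A).hom.toIntLinearMap ∘ₗ ((b A.unop).constr ℤ (L A.unop)) =
      (f.app A).hom.toIntLinearMap := by
    refine (b A.unop).ext fun j => ?_
    change p.app A ((b A.unop).constr ℤ (L A.unop) (b A.unop j)) = f.app A (b A.unop j)
    rw [(b A.unop).constr_basis]
    have h1 := ConcreteCategory.congr_hom (p.naturality (φ A.unop j).op) (y (r j.1))
    have h2 := ConcreteCategory.congr_hom (f.naturality (φ A.unop j).op)
      (b (O (r j.1)) ⟨r j.1, hO (r j.1)⟩)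
    refine h1.trans ((congrArg (N.map (φ A.unop j).op) (hy (r j.1))).trans (h2.symm.trans ?_))
    refine congrArg (f.app A) ((hb (φ A.unop j) ⟨r j.1, hO (r j.1)⟩).trans ?_)
    exact congrArg (b A.unop) (Subtype.ext (hφ A.unop j))
  exact LinearMap.congr_fun h x

/-- The direct sum of two coefficient systems. -/
def prodCoeff (F F' : Coeff.{v, u} G) : Coeff.{v, u} G where
  obj A := AddCommGrpCat.of (F.obj A × F'.obj A)
  map φ := AddCommGrpCat.ofHom ((F.map φ).hom.prodMap (F'.map φ).hom)
  map_id A := by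
    ext x
    · exact ConcreteCategory.congr_hom (F.map_id A) x.1
    · exact ConcreteCategory.congr_hom (F'.map_id A) x.2
  map_comp φ ψ := by
    ext x
    · exact ConcreteCategory.congr_hom (F.map_comp φ ψ) x.1
    · exact ConcreteCategory.congr_hom (F'.map_comp φ ψ) x.2

/-- The morphism from a direct sum given by morphisms from the summands. -/
def prodDesc {F F' N : Coeff.{v, u} G} (f : F ⟶ N) (f' : F' ⟶ N) : prodCoeff F F' ⟶ N where
  app A := AddCommGrpCat.ofHom ((f.app A).hom.coprod (f'.app A).hom)
  naturality A B φ := by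
    ext x
    have h : f.app B (F.map φ x.1) + f'.app B (F'.map φ x.2) =
        N.map φ (f.app A x.1) + N.map φ (f'.app A x.2) :=
      congrArg₂ (· + ·) (ConcreteCategory.congr_hom (f.naturality φ) x.1)
        (ConcreteCategory.congr_hom (f'.naturality φ) x.2)
    exact h.trans (map_add (N.map φ).hom _ _).symm

/-- The morphism to a direct sum given by morphisms to the summands. -/
def prodLift {F F' N : Coeff.{v, u} G} (f : N ⟶ F) (f' : N ⟶ F') : N ⟶ prodCoeff F F' where
  app A := AddCommGrpCat.ofHom ((f.app A).hom.prod (f'.app A).hom)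
  naturality A B φ := by
    ext x
    exact Prod.ext (ConcreteCategory.congr_hom (f.naturality φ) x)
      (ConcreteCategory.congr_hom (f'.naturality φ) x)

theorem HasLifting.prod {F F' : Coeff.{v, u} G} (h : HasLifting F) (h' : HasLifting F') :
    HasLifting (prodCoeff F F') := by
  intro E N p f hpf
  obtain ⟨g, hg⟩ := h E N p (prodLift (𝟙 F) 0 ≫ f) fun A x => hpf A (x, 0)
  obtain ⟨g', hg'⟩ := h' E N p (prodLift 0 (𝟙 F') ≫ f) fun A x => hpf A (0, x)
  refine ⟨prodDesc g g', ?_⟩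
  ext A x
  have h1 : p.app A (g.app A x.1) = f.app A (x.1, 0) :=
    ConcreteCategory.congr_hom (NatTrans.congr_app hg A) x.1
  have h2 : p.app A (g'.app A x.2) = f.app A (0, x.2) :=
    ConcreteCategory.congr_hom (NatTrans.congr_app hg' A) x.2
  have h3 : p.app A (g.app A x.1 + g'.app A x.2) =
      p.app A (g.app A x.1) + p.app A (g'.app A x.2) := map_add (p.app A).hom _ _
  have h4 : f.app A ((x.1, 0) + (0, x.2)) = f.app A (x.1, 0) + f.app A (0, x.2) :=
    map_add (f.app A).hom _ _
  refine h3.trans ((congrArg₂ (· + ·) h1 h2).trans (h4.symm.trans ?_))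
  exact congrArg (f.app A) (Prod.ext (add_zero x.1) (zero_add x.2))

theorem HasLifting.retract {F F' : Coeff.{v, u} G} (h : HasLifting F) (i : F' ⟶ F) (r : F ⟶ F')
    (hir : i ≫ r = 𝟙 F') : HasLifting F' := by
  intro E N p f hpf
  obtain ⟨g, hg⟩ := h E N p (r ≫ f) fun A x => hpf A (r.app A x)
  exact ⟨i ≫ g, by rw [Category.assoc, hg, ← Category.assoc, hir, Category.id_comp]⟩

end Lifting

/-! ### The cells of a proper `G`-CW complex -/

section Cells

open Topology.RelCWComplex (cell openCell)

variable {G : Type v} [Group G] {X : ProperGCW.{u} G} {n : ℕ}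

variable (X n) in
/-- The `n`-cells of a `G`-CW complex, on which `G` acts. -/
def ProperGCW.Cell : Type u := cell (Set.univ : Set X) n

/-- The open cell with a given index. -/
def ProperGCW.Cell.carrier (e : X.Cell n) : Set X :=
  openCell (C := (Set.univ : Set X)) n e

theorem ProperGCW.Cell.exists_mem (e : X.Cell n) : ∃ x, x ∈ e.carrier :=
  Topology.RelCWComplex.openCell_nonempty (C := (Set.univ : Set X)) n e

theorem ProperGCW.Cell.eq_of_mem {e e' : X.Cell n} {x : X} (h : x ∈ e.carrier)
    (h' : x ∈ e'.carrier) : e = e' :=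
  eq_of_mem_openCell' (X := X) h h'

theorem ProperGCW.Cell.exists_image_eq (g : G) (e : X.Cell n) :
    ∃ e' : X.Cell n, (fun x => g • x) '' e.carrier = e'.carrier :=
  X.smul_openCell g n e

/-- The action on the cells, determined by the action on the open cells (`image_carrier`). -/
instance : SMul G (X.Cell n) := ⟨fun g e => (e.exists_image_eq g).choose⟩

theorem ProperGCW.Cell.image_carrier (g : G) (e : X.Cell n) :
    (fun x => g • x) '' e.carrier = (g • e).carrier := (e.exists_image_eq g).choose_spec

theorem ProperGCW.Cell.smul_mem {g : G} {e : X.Cell n} {x : X} (hx : x ∈ e.carrier) :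
    g • x ∈ (g • e).carrier := e.image_carrier g ▸ ⟨x, hx, rfl⟩

instance : MulAction G (X.Cell n) where
  one_smul e := by
    obtain ⟨x, hx⟩ := e.exists_mem
    have h := ProperGCW.Cell.smul_mem (g := (1 : G)) hx
    rw [one_smul] at h
    exact ProperGCW.Cell.eq_of_mem h hx
  mul_smul g g' e := by
    obtain ⟨x, hx⟩ := e.exists_mem
    have h := ProperGCW.Cell.smul_mem (g := g * g') hx
    rw [mul_smul] at h
    exact ProperGCW.Cell.eq_of_mem h (ProperGCW.Cell.smul_mem (ProperGCW.Cell.smul_mem hx))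

theorem ProperGCW.Cell.smul_eq_of_mem {g : G} {e : X.Cell n} (h : g • e = e) {x : X}
    (hx : x ∈ e.carrier) : g • x = x := by
  refine X.smul_eq g n e x hx ?_
  have h' := ProperGCW.Cell.smul_mem (g := g) hx
  rw [h] at h'
  exact h'

theorem ProperGCW.Cell.smul_eq_self {g : G} {e : X.Cell n} {x : X} (hx : x ∈ e.carrier)
    (h : g • x = x) : g • e = e :=
  ProperGCW.Cell.eq_of_mem (h ▸ ProperGCW.Cell.smul_mem hx) hx

theorem ProperGCW.Cell.subset_fixed_iff {A : Orb G} {e : X.Cell n} :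
    e.carrier ⊆ X.fixed A ↔ ∀ a ∈ A.H, a • e = e := by
  constructor
  · intro h a ha
    obtain ⟨x, hx⟩ := e.exists_mem
    exact ProperGCW.Cell.smul_eq_self hx (h hx a ha)
  · exact fun h x hx a ha => ProperGCW.Cell.smul_eq_of_mem (h a ha) hx

theorem ProperGCW.Cell.finite_stabilizer (e : X.Cell n) : Finite (MulAction.stabilizer G e) := by
  obtain ⟨x, hx⟩ := e.exists_mem
  have := X.finite_stabilizer x
  exact Finite.of_injective (Subgroup.inclusion (K := MulAction.stabilizer G x) fun g hg =>
    ProperGCW.Cell.smul_eq_of_mem hg hx) (Subgroup.inclusion_injective _)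

/-- The fixed point sets are closed unions of cells. -/
theorem ProperGCW.cellClosed_fixed (A : Orb G) : CellClosed (X.fixed A) where
  isClosed := by
    have h : X.fixed A = ⋂ a ∈ A.H, {x : X | a • x = x} := by
      ext x
      simp [ProperGCW.fixed]
    rw [h]
    exact isClosed_biInter fun a _ => isClosed_eq (continuous_const_smul a) continuous_id
  openCell_subset n e := by
    rintro ⟨x, hxA, hx⟩
    exact ProperGCW.Cell.subset_fixed_iff.2 fun a ha =>
      ProperGCW.Cell.smul_eq_self (e := (e : X.Cell n)) hx (hxA a ha)

theorem IsCellCycle.push {X : Type u} [TopologicalSpace X] {Y : Type w} [TopologicalSpace Y]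
    {n : ℕ} {Φ : C(Fin n → ℝ, X)} {e Z : Set X} {g : SingChain X n} (h : IsCellCycle Φ e Z g)
    {f : C(X, Y)} (hf : Function.Injective f) {e' Z' : Set Y} (he : Set.MapsTo f e e')
    (hZ : Set.MapsTo f Z Z') : IsCellCycle (f.comp Φ) e' Z' (TwistedBredon.push f n g) where
  isRelCycle := push_mem_relZ (Set.MapsTo.union_union hZ he) hZ h.1
  sub_push_mem := by
    rw [push_comp, ← map_sub]
    refine push_mem_relB (Set.MapsTo.union_union hZ he) (fun x hx => ?_) h.2
    exact ⟨Set.MapsTo.union_union hZ he hx.1, fun hx' => hx.2 (hf hx')⟩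

theorem ProperGCW.smulMap_injective (g : G) : Function.Injective (X.smulMap g) :=
  MulAction.injective g

/-- The isotropy group of a cell, as an object of the orbit category. -/
def ProperGCW.Cell.orb (e : X.Cell n) : Orb G := ⟨MulAction.stabilizer G e, e.finite_stabilizer⟩

theorem ProperGCW.Cell.carrier_subset_orb (e : X.Cell n) : e.carrier ⊆ X.fixed e.orb :=
  ProperGCW.Cell.subset_fixed_iff.2 fun _ ha => ha

theorem ProperGCW.smul_mem_skel (g : G) (k : ℕ) : Set.MapsTo (X.smulMap g) (skel X k) (skel X k) :=
  ProperGCW.smul_skelLT g k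

/-- Characteristic maps and cell cycles can be chosen compatibly with the action: they are chosen
for one cell in every orbit and transported to the others. The result is well defined since the
isotropy group of a cell acts trivially on chains in its fixed point set. -/
theorem ProperGCW.exists_equivariant_cellCycle (X : ProperGCW.{u} G) (n : ℕ) :
    ∃ (Φ : X.Cell n → C(Fin n → ℝ, X)) (b : X.Cell n → SingChain X n),
      (∀ e, IsCharMap (X := X) (Φ e) e) ∧
      (∀ (A : Orb G) (e : X.Cell n), e.carrier ⊆ X.fixed A →
        IsCellCycle (Φ e) e.carrier (skel X n ∩ X.fixed A) (b e)) ∧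
      ∀ (g : G) (e : X.Cell n), TwistedBredon.push (X.smulMap g) n (b e) = b (g • e) := by
  -- `r j` is the chosen representative of the orbit of `j`, and `γ j` translates it to `j`
  let r : X.Cell n → X.Cell n := fun j => (Quotient.mk (MulAction.orbitRel G (X.Cell n)) j).out
  have hr : ∀ (g : G) (j : X.Cell n), r (g • j) = r j := fun g j =>
    congrArg Quotient.out (Quotient.sound ⟨g, rfl⟩)
  have hγ : ∀ j, ∃ g : G, g • r j = j := fun j =>
    (MulAction.orbitRel G (X.Cell n)).symm
      (Quotient.mk_out (s := MulAction.orbitRel G (X.Cell n)) j)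
  choose γ hγ using hγ
  have hatt : ∀ e : X.Cell n, ∃ b, IsCellCycle (charMap (X := X) n e) e.carrier
      (skel X n ∩ X.fixed e.orb) b := fun e => by
    have h := IsCharMap.attaches (X := X) (X.cellClosed_fixed e.orb) (n := n) (T := ∅)
      (fun e he => absurd he (Finset.notMem_empty e)) e.carrier_subset_orb
      (Finset.notMem_empty _) (isCharMap_charMap (X := X) e)
    rw [addCells_empty] at h
    exact h.exists_isCellCycle
  choose b₀ hb₀ using hatt
  refine ⟨fun e => (X.smulMap (γ e)).comp (charMap (X := X) n (r e)),
    fun e => TwistedBredon.push (X.smulMap (γ e)) n (b₀ (r e)), fun e => ?_, fun A e he => ?_,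
    fun g e => ?_⟩
  · have h := isCharMap_charMap (X := X) (r e)
    refine ⟨⟨?_, ?_⟩, fun v hv => ProperGCW.smul_mem_skel _ _ (h.mapsTo_sphere v hv)⟩
    · change _ = e.carrier
      rw [← hγ e, ← ProperGCW.Cell.image_carrier, hγ e]
      change _ = _ '' (openCell (C := (Set.univ : Set X)) n (r e))
      rw [← h.image_cube, ← Set.image_comp]
      rfl
    · obtain ⟨ψ, hψ, hψ'⟩ := h.exists_inverse
      refine ⟨fun x => ψ ((γ e)⁻¹ • x), hψ.comp (continuous_const_smul _).continuousOn
        fun x hx => ?_, fun v hv => ?_⟩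
      · have h1 := ProperGCW.Cell.smul_mem (g := (γ e)⁻¹) (e := e) hx
        have h2 : (γ e)⁻¹ • e = r e := by rw [inv_smul_eq_iff, hγ]
        rw [h2] at h1
        exact h1
      · change ψ ((γ e)⁻¹ • γ e • charMap (X := X) n (r e) v) = v
        rw [inv_smul_smul, hψ' v hv]
  · refine (hb₀ (r e)).push (ProperGCW.smulMap_injective _) (fun x hx => ?_) fun x hx => ?_
    · have h := ProperGCW.Cell.smul_mem (g := γ e) hx
      rw [hγ] at h
      exact h
    · refine ProperGCW.smul_inter (X := X) n (B := (r e).orb) (fun a ha => ?_) hx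
      change ((γ e)⁻¹ * a * γ e) • r e = r e
      rw [mul_smul, mul_smul, hγ, ProperGCW.Cell.subset_fixed_iff.1 he a ha, inv_smul_eq_iff, hγ]
  · change _ = TwistedBredon.push (X.smulMap (γ (g • e))) n (b₀ (r (g • e)))
    rw [← push_comp, hr]
    refine push_congr (U := X.fixed (r e).orb) (fun x hx => ?_)
      (chainsIn_mono (Set.union_subset Set.inter_subset_right (r e).carrier_subset_orb)
        (mem_relZ.1 (hb₀ (r e)).isRelCycle).1)
    change g • γ e • x = γ (g • e) • x
    rw [← inv_smul_eq_iff, ← mul_smul, ← mul_smul]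
    refine hx _ ?_
    change ((γ (g • e))⁻¹ * g * γ e) • r e = r e
    rw [mul_smul, mul_smul, hγ, inv_smul_eq_iff, ← hr g e, hγ]

/-- The cellular chains in a fixed degree form a projective coefficient system. -/
theorem ProperGCW.hasLifting_cellCoeff (X : ProperGCW.{u} G) (n : ℕ) :
    HasLifting (X.cellCoeff n) := by
  obtain ⟨Φ, b, hΦ, hb, hbg⟩ := X.exists_equivariant_cellCycle n
  have hmem : ∀ (A : Orb G) (e : FixedBy A (X.Cell n)), b e.1 ∈ X.relCycles n A := fun A e => by
    have h := hb A e.1 (ProperGCW.Cell.subset_fixed_iff.2 e.2)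
    refine relZ_mono ?_ le_rfl h.isRelCycle
    refine Set.union_subset (Set.inter_subset_inter_left _ (skel_mono n.le_succ)) fun x hx => ?_
    exact ⟨(mem_skel_iff (X := X)).2 ⟨n, n.lt_succ_self, e.1, hx⟩,
      ProperGCW.Cell.subset_fixed_iff.2 e.2 hx⟩
  let mk : ∀ A : Orb G, X.relCycles n A →+ (X.cellCoeff n).obj (op A) := fun A =>
    QuotientAddGroup.mk' _
  have hmk : ∀ (A : Orb G) (c : X.relCycles n A), mk A c = 0 ↔
      c.1 ∈ relB n (skel X (n + 1) ∩ X.fixed A) (skel X n ∩ X.fixed A) := fun A c =>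
    QuotientAddGroup.eq_zero_iff _
  let w : ∀ A : Orb G, FixedBy A (X.Cell n) → (X.cellCoeff n).obj (op A) := fun A e =>
    mk A ⟨b e.1, hmem A e⟩
  have hli : ∀ A, LinearIndependent ℤ (w A) := fun A => by
    classical
    refine linearIndependent_iff'.2 fun s m hs e he => ?_
    -- the coefficients, extended by zero to the cells that are not fixed
    let m' : X.Cell n → ℤ := fun e => if h : ∀ a ∈ A.H, a • e = e then m ⟨e, h⟩ else 0
    have hm' : ∀ e : FixedBy A (X.Cell n), m' e.1 = m e := fun e => dif_pos e.2
    have h1 : mk A (∑ e ∈ s, m e • ⟨b e.1, hmem A e⟩) = 0 := by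
      rw [map_sum]
      simp only [map_zsmul]
      exact hs
    have h2 := (hmk A _).1 h1
    have h3 : ((∑ e ∈ s, m e • ⟨b e.1, hmem A e⟩ : X.relCycles n A) : SingChain X n) =
        ∑ e ∈ s.map (Function.Embedding.subtype _), m' e • b e := by
      rw [AddSubgroup.val_finsetSum, Finset.sum_map]
      exact Finset.sum_congr rfl fun e _ => by
        rw [Function.Embedding.subtype_apply, hm']
        rfl
    rw [h3] at h2
    rw [← hm' e]
    refine eq_zero_of_sum_mem (X := X) (X.cellClosed_fixed A) hΦ (fun e he => hb A e he)
      (fun e he => ?_) h2 e.1 (Finset.mem_map.2 ⟨e, he, rfl⟩)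
    obtain ⟨e, -, rfl⟩ := Finset.mem_map.1 he
    exact ProperGCW.Cell.subset_fixed_iff.2 e.2
  have hsp : ∀ A, ⊤ ≤ Submodule.span ℤ (Set.range (w A)) := fun A x _ => by
    induction x using QuotientAddGroup.induction_on with
    | H c =>
      obtain ⟨T, m, hT, hm⟩ := exists_sub_sum_mem (X := X) (X.cellClosed_fixed A) hΦ
        (fun e he => hb A e he) c.2
      have hT' : ∀ e : X.Cell n, e ∈ T → ∀ a ∈ A.H, a • e = e := fun e he =>
        ProperGCW.Cell.subset_fixed_iff.1 (hT e he)
      have h1 : mk A (c - ∑ e ∈ T.attach, m e.1 • ⟨b e.1, hmem A ⟨e.1, hT' e.1 e.2⟩⟩) = 0 := by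
        refine (hmk A _).2 ?_
        rw [AddSubgroup.coe_sub, AddSubgroup.val_finsetSum]
        rw [← Finset.sum_attach T] at hm
        exact hm
      rw [map_sub, sub_eq_zero, map_sum] at h1
      refine (congrArg (· ∈ Submodule.span ℤ (Set.range (w A))) h1).mpr (sum_mem fun e _ => ?_)
      rw [map_zsmul]
      exact Submodule.smul_mem _ _ (Submodule.subset_span ⟨⟨e.1, hT' e.1 e.2⟩, rfl⟩)
  refine hasLifting_of_basis (J := X.Cell n) ProperGCW.Cell.finite_stabilizer
    (fun A => Module.Basis.mk (hli A) (hsp A)) fun {A B} φ j => ?_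
  rw [Module.Basis.mk_apply, Module.Basis.mk_apply]
  exact congrArg (mk A) (Subtype.ext (hbg (Orb.rep φ) j.1))

/-- The singular chains of the fixed point sets of an invariant subset form a projective
coefficient system. -/
theorem ProperGCW.hasLifting_chainsIn {n : ℕ} {S : Set X} (hS : ∀ (g : G), ∀ x ∈ S, g • x ∈ S)
    {U : Orb G → Set X} (hU : ∀ A, U A = S ∩ X.fixed A)
    (h : IsSubCoeff (X.actChain n) fun A => chainsIn n (U A)) :
    HasLifting (subCoeff (X.actChain n) (fun A => chainsIn n (U A)) h) := by
  let J : SubMulAction G C(Simplex n, X) :=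
    { carrier := {σ | Set.range σ ⊆ S}
      smul_mem' := fun g σ hσ => by
        rintro _ ⟨x, rfl⟩
        exact hS g _ (hσ ⟨x, rfl⟩) }
  have hfin : ∀ j : J, Finite (MulAction.stabilizer G j) := fun j => by
    have := X.finite_stabilizer (j.1 (stdSimplex.vertex 0))
    refine Finite.of_injective (Subgroup.inclusion
      (K := MulAction.stabilizer G (j.1 (stdSimplex.vertex 0))) fun g hg => ?_)
      (Subgroup.inclusion_injective _)
    have h1 : g • j = j := hg
    exact DFunLike.congr_fun (congrArg Subtype.val h1) (stdSimplex.vertex 0)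
  have hmem : ∀ (A : Orb G) (σ : C(Simplex n, X)), Set.range σ ⊆ U A ↔
      ∃ h : σ ∈ J, ∀ a ∈ A.H, a • (⟨σ, h⟩ : J) = ⟨σ, h⟩ := fun A σ => by
    rw [hU, Set.subset_inter_iff]
    refine ⟨fun ⟨h1, h2⟩ => ⟨h1, fun a ha => Subtype.ext ?_⟩, fun ⟨h1, h2⟩ => ⟨h1, ?_⟩⟩
    · ext x
      exact h2 ⟨x, rfl⟩ a ha
    · rintro _ ⟨x, rfl⟩ a ha
      exact DFunLike.congr_fun (congrArg Subtype.val (h2 a ha)) x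
  let P := subCoeff (X.actChain n) (fun A => chainsIn n (U A)) h
  let w : ∀ A : Orb G, FixedBy A J → P.obj (op A) := fun A j =>
    (⟨Finsupp.single j.1.1 1, single_mem_chainsIn ((hmem A j.1.1).2 ⟨j.1.2, j.2⟩)⟩ :
      chainsIn n (U A))
  let val : ∀ A : Orb G, P.obj (op A) →+ SingChain X n := fun A => (chainsIn n (U A)).subtype
  have hli : ∀ A, LinearIndependent ℤ (w A) := fun A => by
    classical
    refine linearIndependent_iff'.2 fun s m hs j hj => ?_
    have h1 : val A (∑ i ∈ s, m i • w A i) j.1.1 = m j := by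
      rw [map_sum, Finsupp.finsetSum_apply, Finset.sum_eq_single j]
      · rw [map_zsmul]
        exact (congrArg (m j * ·) Finsupp.single_eq_same).trans (mul_one _)
      · intro i _ hij
        rw [map_zsmul]
        refine (congrArg (m i * ·) (Finsupp.single_eq_of_ne fun h => hij ?_)).trans (mul_zero _)
        exact Subtype.ext (Subtype.ext h.symm)
      · exact fun h => absurd hj h
    rw [← h1]
    exact DFunLike.congr_fun (congrArg (val A) hs) j.1.1
  have hsp : ∀ A, ⊤ ≤ Submodule.span ℤ (Set.range (w A)) := fun A c _ => by
    have h1 : chainsIn n (U A) ≤ (Submodule.span ℤ (Set.range (w A))).toAddSubgroup.map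
        (val A) := chainsIn_le_iff.2 fun σ hσ => by
      obtain ⟨h1, h2⟩ := (hmem A σ).1 hσ
      exact ⟨w A ⟨⟨σ, h1⟩, h2⟩, Submodule.subset_span ⟨_, rfl⟩, rfl⟩
    obtain ⟨c', hc', hcc'⟩ := h1 c.2
    have h2 : c' = c := Subtype.ext hcc'
    exact h2 ▸ hc'
  refine hasLifting_of_basis (J := J) hfin
    (fun A => Module.Basis.mk (hli A) (hsp A)) fun {A B} φ j => ?_
  rw [Module.Basis.mk_apply, Module.Basis.mk_apply]
  exact Subtype.ext (push_single (X.smulMap (Orb.rep φ)) j.1.1 1)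

end Cells

/-! ### Relative cycles of skeleta -/

section RelCoeff

variable {G : Type v} [Group G]

theorem HasLifting.subCoeff_congr {V : Type u} [AddCommGroup V] {ρ : G →* AddMonoid.End V}
    {P P' : Orb G → AddSubgroup V} (hP : P = P') {h : IsSubCoeff ρ P} {h' : IsSubCoeff ρ P'}
    (hl : HasLifting (subCoeff ρ P h)) : HasLifting (subCoeff ρ P' h') := by
  subst hP
  exact hl

/-- The first projection of a direct sum. -/
def prodFst (F F' : Coeff.{v, u} G) : prodCoeff F F' ⟶ F := prodDesc (𝟙 F) 0

/-- The second projection of a direct sum. -/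
def prodSnd (F F' : Coeff.{v, u} G) : prodCoeff F F' ⟶ F' := prodDesc 0 (𝟙 F')

theorem prodFst_apply (F F' : Coeff.{v, u} G) (A : (Orb G)ᵒᵖ) (x : (prodCoeff F F').obj A) :
    (prodFst F F').app A x = x.1 := add_zero (x.1 : F.obj A)

theorem prodSnd_apply (F F' : Coeff.{v, u} G) (A : (Orb G)ᵒᵖ) (x : (prodCoeff F F').obj A) :
    (prodSnd F F').app A x = x.2 := zero_add (x.2 : F'.obj A)

/-- A morphism to a system of subgroups `P` with values in smaller subgroups `P'`. -/
def codRestrictCoeff {V : Type u} [AddCommGroup V] {ρ : G →* AddMonoid.End V}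
    {P P' : Orb G → AddSubgroup V} {h : IsSubCoeff ρ P} (h' : IsSubCoeff ρ P') {F : Coeff.{v, u} G}
    (f : F ⟶ subCoeff ρ P h)
    (hf : ∀ A (x : F.obj A), (P A.unop).subtype (f.app A x) ∈ P' A.unop) :
    F ⟶ subCoeff ρ P' h' where
  app A := AddCommGrpCat.ofHom (((P A.unop).subtype.comp (f.app A).hom).codRestrict _ (hf A))
  naturality A B φ := by
    ext x
    exact Subtype.ext (congrArg (P B.unop).subtype
      (ConcreteCategory.congr_hom (f.naturality φ) x))

variable (X : ProperGCW.{u} G)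

/-- The intersection of a skeleton with a fixed point set. -/
abbrev ProperGCW.skelFix (n : ℕ) (A : Orb G) : Set X := X.skelLT n ∩ X.fixed A

theorem ProperGCW.isSubCoeff_chainsIn_skelFix (n k : ℕ) :
    IsSubCoeff (X.actChain k) fun A => chainsIn k (X.skelFix n A) :=
  isSubCoeff (fun _ _ _ hg _ hc => push_mem_chainsIn (smul_inter n hg) hc)
    fun _ => chainsIn_mono Set.inter_subset_right

theorem ProperGCW.isSubCoeff_relZ (n k : ℕ) :
    IsSubCoeff (X.actChain k) fun A => relZ k (X.skelFix (n + 1) A) (X.skelFix n A) :=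
  isSubCoeff (fun _ _ _ hg _ hc => push_mem_relZ (smul_inter _ hg) (smul_inter _ hg) hc)
    fun _ _ hc => chainsIn_mono Set.inter_subset_right hc.1

/-- The coefficient system of relative cycles of dimension `k` of the pair
`((X^{(n)})^H, (X^{(n-1)})^H)`. -/
def ProperGCW.relCoeff (n k : ℕ) : Coeff.{v, u} G :=
  subCoeff (X.actChain k) (fun A => relZ k (X.skelFix (n + 1) A) (X.skelFix n A))
    (X.isSubCoeff_relZ n k)

/-- The coefficient system of singular chains of the skeleta. -/
def ProperGCW.skelCoeff (n k : ℕ) : Coeff.{v, u} G :=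
  subCoeff (X.actChain k) (fun A => chainsIn k (X.skelFix n A)) (X.isSubCoeff_chainsIn_skelFix n k)

theorem ProperGCW.hasLifting_skelCoeff (n k : ℕ) : HasLifting (X.skelCoeff n k) :=
  ProperGCW.hasLifting_chainsIn (S := X.skelLT n) (fun g _ hx => ProperGCW.smul_skelLT g n hx)
    (fun _ => rfl) _

theorem ProperGCW.hasLifting_singCoeff (n : ℕ) : HasLifting (X.singCoeff n) :=
  ProperGCW.hasLifting_chainsIn (S := Set.univ) (fun _ _ _ => trivial)
    (fun _ => (Set.univ_inter _).symm) _

/-- The relative cycles of consecutive skeleta are projective up to the dimension of the skeleton: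
by acyclicity the chain `0 ← Z_k ← S_{k+1}(X^{(n)}) ⊕ S_k(X^{(n-1)}) ← Z_{k+1}` is exact, and it
splits if `Z_k` is projective. -/
theorem ProperGCW.hasLifting_relCoeff (n k : ℕ) (hk : k ≤ n) : HasLifting (X.relCoeff n k) := by
  induction k with
  | zero =>
    refine HasLifting.subCoeff_congr (funext fun A => ?_) (X.hasLifting_skelCoeff (n + 1) 0)
    refine le_antisymm (fun c hc => mem_relZ.2 ⟨hc, zero_mem _⟩) fun c hc => hc.1
  | succ k ih =>
    -- `p` is `(e, d) ↦ ∂e + d` and `s` is a section of it. The first component of the projection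
    -- `1 - s ∘ p` to the kernel of `p` is the retraction `r`, with section `i : c ↦ (c, -∂c)`.
    let d₁ : X.skelCoeff (n + 1) (k + 1) ⟶ X.relCoeff n k :=
      subMap (bdry k) (fun _ c => (push_bdry _ k c).symm) fun A c hc =>
        mem_relZ.2 ⟨bdry_mem_chainsIn hc, by rw [bdry'_bdry]; exact zero_mem _⟩
    let d₂ : X.skelCoeff n k ⟶ X.relCoeff n k :=
      subMap (AddMonoidHom.id _) (fun _ _ => rfl) fun A c hc =>
        chainsIn_le_relZ (Set.inter_subset_inter_left _ (X.skelLT_succ n)) hc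
    let p := prodDesc d₁ d₂
    obtain ⟨s, hs⟩ := ih (by omega) _ _ p (𝟙 _) fun A c => by
      obtain ⟨e, he, d, hd, hed⟩ := mem_relB.1
        (relAcyclic_skel (X := X) (X.cellClosed_fixed A.unop) (n := n) (k := k) (by omega) c.2)
      exact ⟨((⟨e, he⟩ : chainsIn (k + 1) (X.skelFix (n + 1) A.unop)),
        (⟨d, hd⟩ : chainsIn k (X.skelFix n A.unop))), Subtype.ext hed⟩
    have hps : ∀ A (x : (X.relCoeff n k).obj A), p.app A (s.app A x) = x := fun A x =>
      ConcreteCategory.congr_hom (NatTrans.congr_app hs A) x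
    let q := (𝟙 _ - p ≫ s) ≫ prodFst _ _
    have hq : ∀ A (x : (prodCoeff (X.skelCoeff (n + 1) (k + 1)) (X.skelCoeff n k)).obj A),
        q.app A x = x.1 - (s.app A (p.app A x)).1 := fun A x => prodFst_apply _ _ A _
    let r : prodCoeff (X.skelCoeff (n + 1) (k + 1)) (X.skelCoeff n k) ⟶ X.relCoeff n (k + 1) :=
      codRestrictCoeff (X.isSubCoeff_relZ n (k + 1)) q fun A x => by
        refine (congrArg (fun z : chainsIn (k + 1) (X.skelFix (n + 1) A.unop) =>
          z.1 ∈ relZ (k + 1) (X.skelFix (n + 1) A.unop) (X.skelFix n A.unop)) (hq A x)).mpr ?_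
        let y : chainsIn (k + 1) (X.skelFix (n + 1) A.unop) × chainsIn k (X.skelFix n A.unop) :=
          s.app A (p.app A x)
        refine mem_relZ.2 ⟨sub_mem x.1.2 y.1.2, ?_⟩
        have h1 : bdry k y.1.1 + y.2.1 = bdry k x.1.1 + x.2.1 :=
          congrArg Subtype.val (hps A (p.app A x))
        have h2 : bdry k (x.1.1 - y.1.1) = y.2.1 - x.2.1 := by
          rw [map_sub, sub_eq_sub_iff_add_eq_add, ← h1, add_comm]
        exact (congrArg (· ∈ chainsIn k (X.skelFix n A.unop)) h2).mpr (sub_mem y.2.2 x.2.2)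
    let i : X.relCoeff n (k + 1) ⟶ prodCoeff (X.skelCoeff (n + 1) (k + 1)) (X.skelCoeff n k) :=
      prodLift (subMap (AddMonoidHom.id _) (fun _ _ => rfl) fun A c hc => hc.1)
        (subMap (-bdry k) (fun _ c => congrArg Neg.neg (push_bdry _ k c).symm |>.trans
          (map_neg _ _).symm) fun A c hc => neg_mem (mem_relZ.1 hc).2)
    refine HasLifting.retract ((X.hasLifting_skelCoeff (n + 1) (k + 1)).prod
      (X.hasLifting_skelCoeff n k)) i r ?_
    ext A x
    refine Subtype.ext ?_
    have h1 : p.app A (i.app A x) = 0 := Subtype.ext (add_neg_cancel (bdry k x.1))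
    have h2 : q.app A (i.app A x) = (i.app A x).1 := by
      rw [hq, h1, map_zero]
      exact sub_zero (i.app A x).1
    exact congrArg (chainsIn (k + 1) (X.skelFix (n + 1) A.unop)).subtype h2

theorem ProperGCW.hasLifting_filtCoeff (n : ℕ) : HasLifting (X.filtCoeff n) :=
  X.hasLifting_relCoeff n n le_rfl

end RelCoeff

/-! ### Comparison of complexes of projective coefficient systems -/

section Cone

variable {G : Type v} [Group G]

/-- An exact bounded below complex of projective coefficient systems is contractible. -/
theorem exists_contraction {C : ℕ → Coeff.{v, u} G} (d : ∀ n, C (n + 1) ⟶ C n)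
    (hd : ∀ n, d (n + 1) ≫ d n = 0) (hC : ∀ n, HasLifting (C n))
    (h₀ : ∀ A (x : (C 0).obj A), ∃ y, (d 0).app A y = x)
    (h : ∀ n A (x : (C (n + 1)).obj A), (d n).app A x = 0 → ∃ y, (d (n + 1)).app A y = x) :
    ∃ s : ∀ n, C n ⟶ C (n + 1), s 0 ≫ d 0 = 𝟙 _ ∧
      ∀ n, s (n + 1) ≫ d (n + 1) + d n ≫ s n = 𝟙 _ := by
  obtain ⟨s₀, hs₀⟩ := hC 0 _ _ (d 0) (𝟙 _) fun A x => h₀ A x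
  -- The condition `d s d = d` says that the idempotent `1 - s d` takes values in cycles, so that it
  -- lifts along the next differential.
  have step : ∀ n (s : {s : C n ⟶ C (n + 1) // d n ≫ s ≫ d n = d n}),
      ∃ s' : {s' : C (n + 1) ⟶ C (n + 2) // d (n + 1) ≫ s' ≫ d (n + 1) = d (n + 1)},
        s'.1 ≫ d (n + 1) = 𝟙 _ - d n ≫ s.1 := fun n s => by
    have h1 : (𝟙 _ - d n ≫ s.1) ≫ d n = 0 := by
      rw [Preadditive.sub_comp, Category.id_comp, Category.assoc, s.2, sub_self]
    obtain ⟨s', hs'⟩ := hC (n + 1) _ _ (d (n + 1)) (𝟙 _ - d n ≫ s.1) fun A x => h n A _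
      (ConcreteCategory.congr_hom (NatTrans.congr_app h1 A) x)
    refine ⟨⟨s', ?_⟩, hs'⟩
    rw [hs', Preadditive.comp_sub, Category.comp_id, ← Category.assoc, hd, Limits.zero_comp,
      sub_zero]
  choose next hnext using step
  let s : ∀ n, {s : C n ⟶ C (n + 1) // d n ≫ s ≫ d n = d n} := fun n =>
    Nat.rec ⟨s₀, by rw [hs₀, Category.comp_id]⟩ (fun n s => next n s) n
  exact ⟨fun n => (s n).1, hs₀, fun n => by rw [hnext n (s n), sub_add_cancel]⟩

theorem NatHom.precomp_add {F F' : Coeff.{v, u} G} (f g : F ⟶ F') {M : Coeff.{v, w} G}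
    (a : NatHom F' M) :
    NatHom.precomp (f + g) M a = NatHom.precomp f M a + NatHom.precomp g M a := by
  ext A x
  exact map_add (a.1 A) (f.app (op A) x) (g.app (op A) x)

theorem NatHom.precomp_neg {F F' : Coeff.{v, u} G} (f : F ⟶ F') {M : Coeff.{v, w} G}
    (a : NatHom F' M) : NatHom.precomp (-f) M a = -NatHom.precomp f M a := by
  ext A x
  exact map_neg (a.1 A) (f.app (op A) x)

theorem NatHom.precomp_zero {F F' : Coeff.{v, u} G} {M : Coeff.{v, w} G} (a : NatHom F' M) :
    NatHom.precomp (0 : F ⟶ F') M a = 0 := by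
  ext A x
  exact map_zero (a.1 A)

theorem NatHom.precomp_id {F : Coeff.{v, u} G} {M : Coeff.{v, w} G} (a : NatHom F M) :
    NatHom.precomp (𝟙 F) M a = a := rfl

variable {K L : ChainComplex (Coeff.{v, u} G) ℕ} (θ : K ⟶ L)

/-- The terms of the mapping cone of a chain map. -/
def coneX (K L : ChainComplex (Coeff.{v, u} G) ℕ) : ℕ → Coeff.{v, u} G
  | 0 => L.X 0
  | n + 1 => prodCoeff (K.X n) (L.X (n + 1))

/-- The differential `(k, l) ↦ (-∂k, θk + ∂l)` of the mapping cone. -/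
def coneD : ∀ n, coneX K L (n + 1) ⟶ coneX K L n
  | 0 => prodDesc (θ.f 0) (L.d 1 0)
  | n + 1 => prodLift (prodDesc (-K.d (n + 1) n) 0) (prodDesc (θ.f (n + 1)) (L.d (n + 2) (n + 1)))

/-- The inclusion of the target in the mapping cone. -/
def coneInr (K L : ChainComplex (Coeff.{v, u} G) ℕ) : ∀ n, L.X n ⟶ coneX K L n
  | 0 => 𝟙 _
  | n + 1 => prodLift 0 (𝟙 (L.X (n + 1)))

/-- The inclusion of the source in the mapping cone. -/
def coneInl (K L : ChainComplex (Coeff.{v, u} G) ℕ) (n : ℕ) : K.X n ⟶ coneX K L (n + 1) :=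
  prodLift (𝟙 (K.X n)) 0

theorem coneInr_coneD (n : ℕ) :
    coneInr K L (n + 1) ≫ coneD θ n = L.d (n + 1) n ≫ coneInr K L n := by
  cases n with
  | zero =>
    ext A x
    have h : (θ.f 0).app A 0 + (L.d 1 0).app A x = (L.d 1 0).app A x := by
      rw [map_zero, zero_add]
    exact h
  | succ n =>
    ext A x
    refine Prod.ext (x := ((-(K.d (n + 1) n).app A 0 + 0, (θ.f (n + 1)).app A 0 +
      (L.d (n + 2) (n + 1)).app A x) : (K.X n).obj A × (L.X (n + 1)).obj A))
      (y := ((0, (L.d (n + 2) (n + 1)).app A x) : (K.X n).obj A × (L.X (n + 1)).obj A)) ?_ ?_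
    · simp
    · simp

theorem coneInl_coneD_zero : coneInl K L 0 ≫ coneD θ 0 = θ.f 0 ≫ coneInr K L 0 := by
  ext A x
  have h : (θ.f 0).app A x + (L.d 1 0).app A 0 = (θ.f 0).app A x := by
    rw [map_zero, add_zero]
  exact h

theorem coneInl_coneD_succ (n : ℕ) : coneInl K L (n + 1) ≫ coneD θ (n + 1) =
    -(K.d (n + 1) n ≫ coneInl K L n) + θ.f (n + 1) ≫ coneInr K L (n + 1) := by
  ext A x
  refine Prod.ext (x := ((-(K.d (n + 1) n).app A x + 0, (θ.f (n + 1)).app A x +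
    (L.d (n + 2) (n + 1)).app A 0) : (K.X n).obj A × (L.X (n + 1)).obj A))
    (y := ((-(K.d (n + 1) n).app A x + 0, -0 + (θ.f (n + 1)).app A x) :
      (K.X n).obj A × (L.X (n + 1)).obj A)) rfl ?_
  simp

theorem coneD_comp (n : ℕ) : coneD θ (n + 1) ≫ coneD θ n = 0 := by
  have hθ : ∀ A (x : (K.X (n + 1)).obj A), (L.d (n + 1) n).app A ((θ.f (n + 1)).app A x) =
      (θ.f n).app A ((K.d (n + 1) n).app A x) := fun A x =>
    ConcreteCategory.congr_hom (NatTrans.congr_app (θ.comm (n + 1) n) A) x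
  have hL : ∀ A (x : (L.X (n + 2)).obj A),
      (L.d (n + 1) n).app A ((L.d (n + 2) (n + 1)).app A x) = 0 := fun A x =>
    ConcreteCategory.congr_hom (NatTrans.congr_app (L.d_comp_d (n + 2) (n + 1) n) A) x
  have key : ∀ A (k : (K.X (n + 1)).obj A) (l : (L.X (n + 2)).obj A),
      (θ.f n).app A (-(K.d (n + 1) n).app A k + 0) +
        (L.d (n + 1) n).app A ((θ.f (n + 1)).app A k + (L.d (n + 2) (n + 1)).app A l) = 0 :=
    fun A k l => by
      rw [map_add, map_add, hθ, hL, map_neg, map_zero]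
      abel
  cases n with
  | zero =>
    ext A x
    exact key A x.1 x.2
  | succ n =>
    ext A x
    refine Prod.ext (x := ((-(K.d (n + 1) n).app A (-(K.d (n + 2) (n + 1)).app A x.1 + 0) + 0, _) :
      (K.X n).obj A × (L.X (n + 1)).obj A)) (y := ((0, 0) :
      (K.X n).obj A × (L.X (n + 1)).obj A)) ?_ (key A x.1 x.2)
    have hK : (K.d (n + 1) n).app A ((K.d (n + 2) (n + 1)).app A x.1) = 0 :=
      ConcreteCategory.congr_hom (NatTrans.congr_app (K.d_comp_d (n + 2) (n + 1) n) A) x.1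
    simp [hK]

/-- A chain map is a quasi-isomorphism at every orbit; the cycles are described so that there is no
condition in degree `0`. -/
structure IsQuasiIso : Prop where
  exists_cycle : ∀ n A (l : (L.X n).obj A), (∀ m, (L.d n m).app A l = 0) →
    ∃ k : (K.X n).obj A, (∀ m, (K.d n m).app A k = 0) ∧
      ∃ l' : (L.X (n + 1)).obj A, (θ.f n).app A k + (L.d (n + 1) n).app A l' = l
  exists_bdry : ∀ n A (k : (K.X n).obj A), (∀ m, (K.d n m).app A k = 0) →
    ∀ l : (L.X (n + 1)).obj A, (L.d (n + 1) n).app A l = (θ.f n).app A k →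
      ∃ k' : (K.X (n + 1)).obj A, (K.d (n + 1) n).app A k' = k

theorem ChainComplex.d_zero_apply (K : ChainComplex (Coeff.{v, u} G) ℕ) (A) (x : (K.X 0).obj A)
    (m : ℕ) : (K.d 0 m).app A x = 0 := by
  rw [K.shape 0 m (by simp)]
  rfl

theorem ChainComplex.d_apply_eq_zero_iff (K : ChainComplex (Coeff.{v, u} G) ℕ) {n : ℕ} {A}
    {x : (K.X (n + 1)).obj A} :
    (∀ m, (K.d (n + 1) m).app A x = 0) ↔ (K.d (n + 1) n).app A x = 0 := by
  refine ⟨fun h => h n, fun h m => ?_⟩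
  by_cases hm : m = n
  · rw [hm, h]
  · rw [K.shape (n + 1) m fun h' => hm (Nat.succ_injective h')]
    rfl

variable {θ}

/-- The mapping cone of a quasi-isomorphism is exact. -/
theorem IsQuasiIso.cone_exact (h : IsQuasiIso θ) (n : ℕ) (A) (k : (K.X n).obj A)
    (hk : ∀ m, (K.d n m).app A k = 0) (l : (L.X (n + 1)).obj A)
    (hl : (θ.f n).app A k + (L.d (n + 1) n).app A l = 0) :
    ∃ (k' : (K.X (n + 1)).obj A) (l' : (L.X (n + 2)).obj A), -(K.d (n + 1) n).app A k' = k ∧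
      (θ.f (n + 1)).app A k' + (L.d (n + 2) (n + 1)).app A l' = l := by
  have hθ : ∀ x : (K.X (n + 1)).obj A, (L.d (n + 1) n).app A ((θ.f (n + 1)).app A x) =
      (θ.f n).app A ((K.d (n + 1) n).app A x) := fun x =>
    ConcreteCategory.congr_hom (NatTrans.congr_app (θ.comm (n + 1) n) A) x
  obtain ⟨k₀, hk₀⟩ := h.exists_bdry n A k hk (-l) (by
    rw [map_neg, eq_comm, ← add_eq_zero_iff_eq_neg, hl])
  have hcyc : (L.d (n + 1) n).app A (l + (θ.f (n + 1)).app A k₀) = 0 := by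
    rw [map_add, hθ, hk₀, add_comm, hl]
  obtain ⟨k₁, hk₁, l', hl'⟩ := h.exists_cycle (n + 1) A _
    ((ChainComplex.d_apply_eq_zero_iff L).2 hcyc)
  refine ⟨k₁ - k₀, l', ?_, ?_⟩
  · rw [map_sub, hk₁ n, hk₀, zero_sub, neg_neg]
  · rw [map_sub, sub_add_eq_add_sub, hl', add_sub_cancel_right]

/-- A quasi-isomorphism between complexes of projective coefficient systems induces isomorphisms
in cohomology with arbitrary coefficients. -/
theorem IsQuasiIso.bijective_map (h : IsQuasiIso θ) (hK : ∀ n, HasLifting (K.X n))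
    (hL : ∀ n, HasLifting (L.X n)) (M : Coeff.{v, w} G) (n : ℕ) :
    Function.Bijective (Coh.map θ M n) := by
  obtain ⟨s, hs₀, hs⟩ := exists_contraction (C := coneX K L) (coneD θ) (coneD_comp θ)
    (fun n => by
      cases n with
      | zero => exact hL 0
      | succ n => exact (hK n).prod (hL (n + 1)))
    (fun A l => by
      obtain ⟨k, _, l', hl'⟩ := h.exists_cycle 0 A l (ChainComplex.d_zero_apply L A l)
      exact ⟨(k, l'), hl'⟩)
    (fun n A x hx => by
      cases n with
      | zero =>
        obtain ⟨k', l', h1, h2⟩ := h.cone_exact 0 A x.1 (ChainComplex.d_zero_apply K A x.1) x.2 hx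
        exact ⟨(k', l'), Prod.ext ((add_zero _).trans h1) h2⟩
      | succ n =>
        have hx1 : -(K.d (n + 1) n).app A x.1 + 0 = 0 := congrArg Prod.fst hx
        rw [add_zero, neg_eq_zero] at hx1
        obtain ⟨k', l', h1, h2⟩ := h.cone_exact (n + 1) A x.1
          ((ChainComplex.d_apply_eq_zero_iff K).2 hx1) x.2 (congrArg Prod.snd hx)
        exact ⟨(k', l'), Prod.ext ((add_zero _).trans h1) h2⟩)
  -- by the contraction, every cocycle of positive degree of the cone is a coboundary
  have hs' : ∀ n (F : NatHom (coneX K L (n + 1)) M), NatHom.precomp (coneD θ (n + 1)) M F = 0 →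
      NatHom.precomp (coneD θ n) M (NatHom.precomp (s n) M F) = F := fun n F hF => by
    have h1 := NatHom.precomp_add (s (n + 1) ≫ coneD θ (n + 1)) (coneD θ n ≫ s n) F
    rw [hs, NatHom.precomp_id, ← NatHom.precomp_comp, hF, map_zero, zero_add,
      ← NatHom.precomp_comp] at h1
    exact h1.symm
  constructor
  · rw [injective_iff_map_eq_zero]
    intro x hx
    induction x using QuotientAddGroup.induction_on with
    | H f =>
      obtain ⟨f, hf⟩ := f
      refine (QuotientAddGroup.eq_zero_iff _).2 ?_
      have h1 : NatHom.precomp (θ.f n) M f ∈ coboundaries K M n :=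
        (QuotientAddGroup.eq_zero_iff
          (⟨_, precomp_mem_cocycles θ hf⟩ : cocycles K M n)).1 hx
      change f ∈ coboundaries L M n
      have hf0 : NatHom.precomp (L.d (n + 1) n) M f = 0 := hf
      cases n with
      | zero =>
        have h2 : NatHom.precomp (θ.f 0) M f = 0 := h1
        -- In degree `0` the cone is `L`, and `f` vanishes on the image of its first differential, which
        -- is onto.
        let f' : NatHom (coneX K L 0) M := f
        have h3 : NatHom.precomp (coneD θ 0) M f' = 0 := by
          ext A x
          have h4 : f.1 A ((θ.f 0).app (op A) x.1) = 0 :=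
            DFunLike.congr_fun (congrFun (congrArg Subtype.val h2) A) x.1
          have h5 : f.1 A ((L.d 1 0).app (op A) x.2) = 0 :=
            DFunLike.congr_fun (congrFun (congrArg Subtype.val hf0) A) x.2
          refine (map_add (f.1 A) ((θ.f 0).app (op A) x.1) ((L.d 1 0).app (op A) x.2)).trans ?_
          rw [h4, h5, add_zero]
          rfl
        have h6 : NatHom.precomp (s 0 ≫ coneD θ 0) M f' = f' := by rw [hs₀, NatHom.precomp_id]
        rw [← NatHom.precomp_comp, h3, map_zero] at h6
        exact h6.symm
      | succ n =>
        obtain ⟨e, he⟩ := h1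
        -- If `θ^*f = δe`, then `(e, f)` is a cocycle of the cone, hence the coboundary of some `u`, and
        -- `f` is the coboundary of the restriction of `u` to `L`.
        let F : NatHom (coneX K L (n + 1)) M :=
          NatHom.precomp (prodFst _ _) M e + NatHom.precomp (prodSnd _ _) M f
        have hF : ∀ A (x : (K.X n).obj (op A)) (y : (L.X (n + 1)).obj (op A)),
            F.1 A ((x, y) : (K.X n).obj (op A) × (L.X (n + 1)).obj (op A)) =
              e.1 A x + f.1 A y := fun A x y =>
          congrArg₂ (· + ·) (congrArg (e.1 A) (prodFst_apply _ _ _ _))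
            (congrArg (f.1 A) (prodSnd_apply _ _ _ _))
        have h3 : NatHom.precomp (coneD θ (n + 1)) M F = 0 := by
          ext A x
          have h4 : e.1 A ((K.d (n + 1) n).app (op A) x.1) =
              f.1 A ((θ.f (n + 1)).app (op A) x.1) :=
            DFunLike.congr_fun (congrFun (congrArg Subtype.val he) A) x.1
          have h5 : f.1 A ((L.d (n + 2) (n + 1)).app (op A) x.2) = 0 :=
            DFunLike.congr_fun (congrFun (congrArg Subtype.val hf0) A) x.2
          refine (hF A (-(K.d (n + 1) n).app (op A) x.1 + 0) ((θ.f (n + 1)).app (op A) x.1 +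
            (L.d (n + 2) (n + 1)).app (op A) x.2)).trans ?_
          rw [map_add, map_add, h5, map_neg, h4, map_zero]
          change _ = 0
          abel
        refine ⟨NatHom.precomp (coneInr K L n) M (NatHom.precomp (s n) M F), ?_⟩
        rw [delta, NatHom.precomp_comp, ← coneInr_coneD θ, ← NatHom.precomp_comp, hs' n F h3]
        ext A x
        refine (hF A 0 x).trans ?_
        rw [map_zero, zero_add]
  · intro x
    induction x using QuotientAddGroup.induction_on with
    | H g =>
      obtain ⟨g, hg⟩ := g
      have hg0 : NatHom.precomp (K.d (n + 1) n) M g = 0 := hg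
      -- The cochain `(g, 0)` is a cocycle of the cone, hence the coboundary of some `u`. The restriction
      -- `f` of `u` to `L` is a cocycle, and `θ^*f - g` is the coboundary of the restriction to `K`.
      let F : NatHom (coneX K L (n + 1)) M := NatHom.precomp (prodFst _ _) M g
      have hF : ∀ A (x : (K.X n).obj (op A)) (y : (L.X (n + 1)).obj (op A)),
          F.1 A ((x, y) : (K.X n).obj (op A) × (L.X (n + 1)).obj (op A)) = g.1 A x :=
        fun A x y => congrArg (g.1 A) (prodFst_apply _ _ _ _)
      have h3 : NatHom.precomp (coneD θ (n + 1)) M F = 0 := by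
        ext A x
        have h4 : g.1 A ((K.d (n + 1) n).app (op A) x.1) = 0 :=
          DFunLike.congr_fun (congrFun (congrArg Subtype.val hg0) A) x.1
        refine (hF A (-(K.d (n + 1) n).app (op A) x.1 + 0) _).trans ?_
        rw [map_add, map_neg, h4, map_zero, neg_zero, add_zero]
        rfl
      have h4 := hs' n F h3
      let f : NatHom (L.X n) M := NatHom.precomp (coneInr K L n) M (NatHom.precomp (s n) M F)
      have hf : f ∈ cocycles L M n := by
        change NatHom.precomp (L.d (n + 1) n) M f = 0
        rw [NatHom.precomp_comp, ← coneInr_coneD θ, ← NatHom.precomp_comp, h4]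
        ext A x
        exact (hF A 0 x).trans (map_zero _)
      refine ⟨Coh.mk ⟨f, hf⟩, ?_⟩
      rw [Coh.map_mk]
      refine QuotientAddGroup.eq_iff_sub_mem.2 ?_
      change NatHom.precomp (θ.f n) M f - g ∈ coboundaries K M n
      have h5 : NatHom.precomp (coneInl K L n) M F = g := by
        ext A x
        exact hF A x 0
      have h7 : NatHom.precomp (coneInl K L n) M F =
          NatHom.precomp (coneInl K L n ≫ coneD θ n) M (NatHom.precomp (s n) M F) := by
        rw [← NatHom.precomp_comp, h4]
      have h8 : NatHom.precomp (θ.f n) M f =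
          NatHom.precomp (θ.f n ≫ coneInr K L n) M (NatHom.precomp (s n) M F) :=
        NatHom.precomp_comp _ _ M _
      rw [← h5, h7, h8]
      cases n with
      | zero =>
        rw [coneInl_coneD_zero, sub_self]
        exact zero_mem _
      | succ n =>
        refine ⟨NatHom.precomp (coneInl K L n) M (NatHom.precomp (s (n + 1)) M F), ?_⟩
        rw [coneInl_coneD_succ, NatHom.precomp_add, NatHom.precomp_neg, neg_add_eq_sub,
          sub_sub_cancel]
        exact NatHom.precomp_comp _ _ M _

end Cone

/-! ### Comparison of singular and cellular chains -/

section Comparison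

theorem eq_zero_of_mem_chainsIn_empty {X : Type u} [TopologicalSpace X] {n : ℕ} {c : SingChain X n}
    (hc : c ∈ chainsIn n (∅ : Set X)) : c = 0 := by
  suffices h : chainsIn n (∅ : Set X) ≤ ⊥ from h hc
  exact chainsIn_le_iff.2 fun σ hσ => absurd (hσ ⟨stdSimplex.vertex 0, rfl⟩) (Set.notMem_empty _)

variable {G : Type v} [Group G] {X Y : ProperGCW.{u} G}

/-- Cycles of a skeleton bound in it from the dimension above that of the skeleton on. -/
theorem ProperGCW.exists_bdry_eq {n k : ℕ} {A : Orb G} (hk : n ≤ k) {c : SingChain X k}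
    (hc : c ∈ chainsIn k (X.skelFix n A)) (h : bdry' k c = 0) :
    ∃ e ∈ chainsIn (k + 1) (X.skelFix n A), bdry k e = c := by
  have h1 : c ∈ relZ k (X.skelFix n A) ∅ := mem_relZ.2 ⟨hc, h ▸ zero_mem _⟩
  obtain ⟨e, he, d, hd, hed⟩ :=
    mem_relB.1 (relAcyclic_skel_empty (X := X) (X.cellClosed_fixed A) hk h1)
  refine ⟨e, he, ?_⟩
  rw [← hed, eq_zero_of_mem_chainsIn_empty hd, add_zero]

theorem ProperGCW.skelFix_mono {m n : ℕ} (h : m ≤ n) (A : Orb G) : X.skelFix m A ⊆ X.skelFix n A :=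
  Set.inter_subset_inter_left _ (skel_mono (X := X) h)

/-- Every chain whose boundary lies in a skeleton of at least its dimension is homologous, relative
to its boundary, to a chain in that skeleton. -/
theorem ProperGCW.exists_sub_bdry_mem {n k : ℕ} {A : Orb G} (hk : k < n) {c : SingChain X k}
    (hc : c ∈ chainsIn k (X.fixed A)) (h : bdry' k c ∈ chainsIn (k - 1) (X.skelFix n A)) :
    ∃ e ∈ chainsIn (k + 1) (X.fixed A), ∃ d ∈ chainsIn k (X.skelFix n A), bdry k e + d = c := by
  obtain ⟨N, hN⟩ := exists_mem_chainsIn_skel (X := X) hc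
  have h1 : c ∈ relZ k (X.skelFix (max n N) A) (X.skelFix n A) :=
    mem_relZ.2 ⟨chainsIn_mono (ProperGCW.skelFix_mono (le_max_right _ _) A) hN, h⟩
  obtain ⟨e, he, d, hd, hed⟩ := mem_relB.1
    (relAcyclic_skel_of_lt (X := X) (X.cellClosed_fixed A) (le_max_left n N) hk h1)
  exact ⟨e, chainsIn_mono Set.inter_subset_right he, d, hd, hed⟩

theorem ProperGCW.bdry'_eq_zero_of_sing {n : ℕ} {A : (Orb G)ᵒᵖ} (c : chainsIn n (X.fixed A.unop))
    (h : ∀ m, (X.sing.d n m).app A (c : (X.singCoeff n).obj A) = 0) : bdry' n c.1 = 0 := by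
  cases n with
  | zero => rfl
  | succ n =>
    have h1 := h n
    rw [X.sing_d] at h1
    exact congrArg Subtype.val h1

theorem ProperGCW.filt_cycle_iff {n : ℕ} {A : (Orb G)ᵒᵖ} (c : X.relCycles n A.unop) :
    (∀ m, (X.filt.d n m).app A (c : (X.filtCoeff n).obj A) = 0) ↔ bdry' n c.1 = 0 := by
  cases n with
  | zero => exact ⟨fun _ => rfl, fun _ => ChainComplex.d_zero_apply X.filt A c⟩
  | succ n =>
    refine (ChainComplex.d_apply_eq_zero_iff X.filt).trans ?_
    rw [X.filt_d]
    exact ⟨fun h => congrArg Subtype.val h, fun h => Subtype.ext h⟩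

/-- The inclusion of the filtered subcomplex in the singular chains is a quasi-isomorphism. -/
theorem ProperGCW.isQuasiIso_filtToSing (X : ProperGCW.{u} G) : IsQuasiIso X.filtToSing where
  exists_cycle n A l hl := by
    have h1 := ProperGCW.bdry'_eq_zero_of_sing l hl
    obtain ⟨e, he, d, hd, hed⟩ := ProperGCW.exists_sub_bdry_mem (n := n + 1) n.lt_succ_self l.2
      (h1 ▸ zero_mem _)
    have h2 : bdry' n d = 0 := by
      rw [← h1, ← hed, map_add, bdry'_bdry, zero_add]
    have hd' : d ∈ X.relCycles n A.unop := X.mem_relCycles.2 ⟨hd, by rw [h2]; exact zero_mem _⟩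
    refine ⟨(⟨d, hd'⟩ : X.relCycles n A.unop), (ProperGCW.filt_cycle_iff _).2 h2,
      (⟨e, he⟩ : chainsIn (n + 1) (X.fixed A.unop)), ?_⟩
    rw [X.sing_d]
    exact Subtype.ext ((add_comm _ _).trans hed)
  exists_bdry n A k hk l hl := by
    rw [X.sing_d] at hl
    have h1 : bdry n l.1 = k.1 := congrArg Subtype.val hl
    have h2 : bdry' (n + 1) l.1 ∈ chainsIn n (X.skelFix (n + 1) A.unop) :=
      (congrArg (· ∈ chainsIn n (X.skelFix (n + 1) A.unop)) h1).mpr (X.mem_relCycles.1 k.2).1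
    obtain ⟨e, he, d, hd, hed⟩ := ProperGCW.exists_sub_bdry_mem (n := n + 2) (n + 1).lt_succ_self
      l.2 (chainsIn_mono (ProperGCW.skelFix_mono (Nat.le_succ _) _) h2)
    have h3 : bdry n d = k.1 := by rw [← h1, ← hed, map_add, bdry_bdry, zero_add]
    refine ⟨(⟨d, hd, ?_⟩ : X.relCycles (n + 1) A.unop), ?_⟩
    · exact (congrArg (· ∈ chainsIn n (X.skelFix (n + 1) A.unop)) h3).mpr
        (X.mem_relCycles.1 k.2).1
    · rw [X.filt_d]
      exact Subtype.ext h3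

/-- The projection of the filtered subcomplex to the cellular chains is a quasi-isomorphism. -/
theorem ProperGCW.isQuasiIso_filtToCellular (X : ProperGCW.{u} G) :
    IsQuasiIso X.filtToCellular where
  exists_cycle n A l hl := by
    induction l using QuotientAddGroup.induction_on with
    | H c =>
      -- a relative cycle whose boundary is trivial in `H_{n-1}(X^{(n-1)}, X^{(n-2)})` is corrected by a
      -- chain of the `(n-1)`-skeleton to an absolute cycle, first modulo the `(n-2)`-skeleton, in which
      -- the remaining boundary is itself a boundary for dimensional reasons
      obtain ⟨e, he, hce⟩ : ∃ e ∈ chainsIn n (X.skelFix n A.unop), bdry' n (c.1 - e) = 0 := by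
        cases n with
        | zero => exact ⟨0, zero_mem _, rfl⟩
        | succ n =>
          have h1 := hl n
          rw [X.cellular_d] at h1
          have h2 : bdry n c.1 ∈ X.relBoundaries n A.unop := (QuotientAddGroup.eq_zero_iff
            (⟨bdry n c.1, X.bdry_mem_relCycles n A.unop c.1 c.2⟩ : X.relCycles n A.unop)).1 h1
          obtain ⟨e, he, d, hd, hed⟩ := mem_relB.1 h2
          have h3 : bdry' n d = 0 := by
            have h4 : d = bdry n (c.1 - e) := by rw [map_sub, ← hed, add_sub_cancel_left]
            rw [h4, bdry'_bdry]
          obtain ⟨y, hy, hyd⟩ := ProperGCW.exists_bdry_eq le_rfl hd h3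
          refine ⟨e + y, add_mem he (chainsIn_mono
            (ProperGCW.skelFix_mono n.le_succ _) hy), ?_⟩
          change bdry n (c.1 - (e + y)) = 0
          rw [map_sub, map_add, hyd, hed, sub_self]
      have he' : e ∈ X.relCycles n A.unop := chainsIn_le_relZ (X.skelFix_mono n.le_succ _) he
      refine ⟨c - (⟨e, he'⟩ : X.relCycles n A.unop), (ProperGCW.filt_cycle_iff _).2 hce, 0, ?_⟩
      rw [map_zero, add_zero]
      refine QuotientAddGroup.eq_iff_sub_mem.2 ?_
      rw [sub_sub_cancel_left]
      exact neg_mem (chainsIn_le_relB (U := X.skelFix (n + 1) A.unop) he)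
  exists_bdry n A k hk l hl := by
    have hk' := (ProperGCW.filt_cycle_iff k).1 hk
    induction l using QuotientAddGroup.induction_on with
    | H c =>
      rw [X.cellular_d] at hl
      have h1 : bdry n c.1 - k.1 ∈ X.relBoundaries n A.unop := (QuotientAddGroup.eq_iff_sub_mem
        (x := (⟨bdry n c.1, X.bdry_mem_relCycles n A.unop c.1 c.2⟩ : X.relCycles n A.unop))).1 hl
      obtain ⟨e, he, d, hd, hed⟩ := mem_relB.1 h1
      have h3 : bdry' n d = 0 := by
        have h4 : d = bdry n (c.1 - e) - k.1 := by
          rw [map_sub, sub_right_comm, ← hed, add_sub_cancel_left]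
        rw [h4, map_sub, bdry'_bdry, hk', sub_zero]
      obtain ⟨y, hy, hyd⟩ := ProperGCW.exists_bdry_eq le_rfl hd h3
      have hey : e + y ∈ X.relCycles (n + 1) A.unop :=
        chainsIn_le_relZ (X.skelFix_mono (n + 1).le_succ _)
          (add_mem he (chainsIn_mono (X.skelFix_mono n.le_succ _) hy))
      refine ⟨c - (⟨e + y, hey⟩ : X.relCycles (n + 1) A.unop), ?_⟩
      rw [X.filt_d]
      refine Subtype.ext ?_
      change bdry n (c.1 - (e + y)) = k.1
      rw [map_sub, map_add, hyd, hed, sub_sub_cancel]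

variable (X) in
/-- The comparison of the Bredon cohomology with the cohomology of singular cochains. -/
def ProperGCW.toSing (M : Coeff.{v, w} G) (n : ℕ) : Bredon X M n ≃+ Coh X.sing M n :=
  (AddEquiv.ofBijective (Coh.map X.filtToCellular M n)
    (X.isQuasiIso_filtToCellular.bijective_map X.hasLifting_filtCoeff X.hasLifting_cellCoeff M
      n)).trans
  (AddEquiv.ofBijective (Coh.map X.filtToSing M n)
    (X.isQuasiIso_filtToSing.bijective_map X.hasLifting_filtCoeff X.hasLifting_singCoeff M n)).symm

theorem map_filtToSing_toSing {M : Coeff.{v, w} G} {n : ℕ} (x : Bredon X M n) :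
    Coh.map X.filtToSing M n (X.toSing M n x) = Coh.map X.filtToCellular M n x :=
  (AddEquiv.ofBijective (Coh.map X.filtToSing M n) (X.isQuasiIso_filtToSing.bijective_map
    X.hasLifting_filtCoeff X.hasLifting_singCoeff M n)).apply_symm_apply _

theorem toSing_eq_iff {M : Coeff.{v, w} G} {n : ℕ} {x : Bredon X M n} {y : Coh X.sing M n} :
    X.toSing M n x = y ↔ Coh.map X.filtToSing M n y = Coh.map X.filtToCellular M n x := by
  rw [← map_filtToSing_toSing]
  exact ⟨fun h => h ▸ rfl, fun h => ((X.isQuasiIso_filtToSing.bijective_map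
    X.hasLifting_filtCoeff X.hasLifting_singCoeff M n).1 h).symm⟩

/-- A cochain represents `x` if and only if it is a cocycle whose class corresponds to `x` in singular
cohomology. -/
theorem represents_iff {M : Coeff.{v, w} G} {n : ℕ} {s : NatHom (X.sing.X n) M}
    {x : Bredon X M n} : Represents s x ↔
      ∃ hs : s ∈ cocycles X.sing M n, X.toSing M n x = Coh.mk ⟨s, hs⟩ :=
  exists_congr fun _ => toSing_eq_iff.symm

theorem exists_represents {M : Coeff.{v, w} G} {n : ℕ} (x : Bredon X M n) :
    ∃ s : NatHom (X.sing.X n) M, Represents s x := by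
  obtain ⟨⟨s, hs⟩, h⟩ := QuotientAddGroup.mk'_surjective _ (X.toSing M n x)
  exact ⟨s, represents_iff.2 ⟨hs, h.symm⟩⟩

/-- The chain map of filtered subcomplexes induced by a cellular map. -/
def GMap.filt (f : GMap X Y) (hf : f.IsCellular) : X.filt ⟶ Y.filt :=
  ChainComplex.ofHom
    (fun n => (subMap (push f.toMap n) (f.push_smul n) (f.push_mem_relCycles hf n) :
      X.filtCoeff n ⟶ Y.filtCoeff n))
    fun n => by
      rw [ProperGCW.filt_d, ProperGCW.filt_d]
      ext A x
      exact Subtype.ext (push_bdry f.toMap n x.1).symm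

theorem Coh.map_comp {K L N : ChainComplex (Coeff.{v, w₁} G) ℕ} (θ : K ⟶ L) (θ' : L ⟶ N)
    {M : Coeff.{v, w₂} G} {n : ℕ} (x : Coh N M n) :
    Coh.map θ M n (Coh.map θ' M n x) = Coh.map (θ ≫ θ') M n x := by
  induction x using QuotientAddGroup.induction_on with
  | H x => rfl

/-- The comparison with singular cohomology is natural for cellular maps. -/
theorem toSing_pullback (f : GMap X Y) (hf : f.IsCellular) {M : Coeff.{v, w} G} {n : ℕ}
    (x : Bredon Y M n) :
    X.toSing M n (f.pullback hf M n x) = Coh.map f.sing M n (Y.toSing M n x) := by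
  have h1 : f.filt hf ≫ Y.filtToSing = X.filtToSing ≫ f.sing := rfl
  have h2 : f.filt hf ≫ Y.filtToCellular = X.filtToCellular ≫ f.cellular hf := rfl
  rw [toSing_eq_iff, GMap.pullback, Coh.map_comp, Coh.map_comp, ← h1, ← h2, ← Coh.map_comp,
    ← Coh.map_comp, map_filtToSing_toSing]

theorem isPullback_iff (f : GMap X Y) {M : Coeff.{v, w} G} {n : ℕ} {x : Bredon Y M n}
    {x' : Bredon X M n} :
    IsPullback f x x' ↔ X.toSing M n x' = Coh.map f.sing M n (Y.toSing M n x) := by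
  constructor
  · rintro ⟨s, hs, hs'⟩
    obtain ⟨hc, h⟩ := represents_iff.1 hs
    obtain ⟨hc', h'⟩ := represents_iff.1 hs'
    rw [h, h', Coh.map_mk]
  · intro h
    obtain ⟨s, hs⟩ := exists_represents x
    refine ⟨s, hs, represents_iff.2 ?_⟩
    obtain ⟨hc, h'⟩ := represents_iff.1 hs
    rw [h, h', Coh.map_mk]
    exact ⟨precomp_mem_cocycles f.sing hc, rfl⟩

end Comparison

/-! ### The cup product of singular cochains -/

section SingularCochains

variable {G : Type v} [Group G] {X Y : ProperGCW.{u} G} {α β α' : Z2 G} {n m n' : ℕ}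

/-- Singular cochains are determined by their values on singular simplices. -/
theorem singCochain_ext {s t : NatHom (X.sing.X n) (repCoeff α)}
    (hst : ∀ (A : Orb G) (σ : C(stdSimplex ℝ (Fin (n + 1)), X)) (h : Set.range σ ⊆ X.fixed A),
      evalSimplex s A σ h = evalSimplex t A σ h) : s = t := by
  refine Subtype.ext (funext fun A => AddMonoidHom.ext ?_)
  let f : chainsIn n (X.fixed A) →+ RepGroup α A.H := s.1 A
  let g : chainsIn n (X.fixed A) →+ RepGroup α A.H := t.1 A
  suffices h : chainsIn n (X.fixed A) ≤ (f - g).ker.map (chainsIn n (X.fixed A)).subtype by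
    rintro ⟨c, hc⟩
    obtain ⟨d, hd, rfl⟩ := h hc
    exact sub_eq_zero.1 hd
  exact chainsIn_le_iff.2 fun σ hσ =>
    ⟨⟨_, single_mem_chainsIn hσ⟩, sub_eq_zero.2 (hst A σ hσ), rfl⟩

theorem evalSimplex_congr (s : NatHom (X.sing.X n) (repCoeff α)) {A : Orb G}
    {σ τ : C(stdSimplex ℝ (Fin (n + 1)), X)} (hστ : σ = τ) (h : Set.range σ ⊆ X.fixed A)
    (h' : Set.range τ ⊆ X.fixed A) : evalSimplex s A σ h = evalSimplex s A τ h' := by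
  subst hστ
  rfl

theorem evalSimplex_add (s s' : NatHom (X.sing.X n) (repCoeff α)) (A : Orb G)
    (σ : C(stdSimplex ℝ (Fin (n + 1)), X)) (h : Set.range σ ⊆ X.fixed A) :
    evalSimplex (s + s') A σ h = evalSimplex s A σ h + evalSimplex s' A σ h := rfl

theorem evalSimplex_zsmul (k : ℤ) (s : NatHom (X.sing.X n) (repCoeff α)) (A : Orb G)
    (σ : C(stdSimplex ℝ (Fin (n + 1)), X)) (h : Set.range σ ⊆ X.fixed A) :
    evalSimplex (k • s) A σ h = k • evalSimplex s A σ h := rfl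

theorem evalSimplex_zero (A : Orb G) (σ : C(stdSimplex ℝ (Fin (n + 1)), X))
    (h : Set.range σ ⊆ X.fixed A) :
    evalSimplex (0 : NatHom (X.sing.X n) (repCoeff α)) A σ h = 0 := rfl

theorem evalSimplex_delta (s : NatHom (X.sing.X n) (repCoeff α)) (A : Orb G)
    (σ : C(stdSimplex ℝ (Fin (n + 2)), X)) (h : Set.range σ ⊆ X.fixed A) :
    evalSimplex (delta X.sing (repCoeff α) n s) A σ h = ∑ i : Fin (n + 2), (-1 : ℤ) ^ (i : ℕ) •
      evalSimplex s A (σ.comp (simplexMap i.succAbove)) (range_comp_subset h _) := by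
  change s.1 A ((X.sing.d (n + 1) n).app (op A) (⟨Finsupp.single σ 1, single_mem_chainsIn h⟩ :
    chainsIn (n + 1) (X.fixed A))) = _
  rw [X.sing_d]
  let f : chainsIn n (X.fixed A) →+ RepGroup α A.H := s.1 A
  change f ⟨bdry n (Finsupp.single σ 1), _⟩ = ∑ i : Fin (n + 2), (-1 : ℤ) ^ (i : ℕ) •
    f ⟨Finsupp.single (σ.comp (simplexMap i.succAbove)) 1, _⟩
  simp only [← map_zsmul, ← map_sum]
  refine congrArg f (Subtype.ext ?_)
  rw [AddSubgroup.val_finsetSum]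
  exact bdry_single n σ 1

theorem evalSimplex_precomp (f : GMap X Y) (s : NatHom (Y.sing.X n) (repCoeff α)) (A : Orb G)
    (σ : C(stdSimplex ℝ (Fin (n + 1)), X)) (h : Set.range σ ⊆ X.fixed A)
    (h' : Set.range (f.toMap.comp σ) ⊆ Y.fixed A) :
    evalSimplex (NatHom.precomp (f.sing.f n) _ s) A σ h = evalSimplex s A (f.toMap.comp σ) h' :=
  congrArg (s.1 A) (Subtype.ext (push_single f.toMap σ 1))

theorem evalSimplex_cup (s : NatHom (X.sing.X n) (repCoeff α))
    (t : NatHom (X.sing.X m) (repCoeff β)) (A : Orb G)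
    (σ : C(stdSimplex ℝ (Fin (n + m + 1)), X)) (h : Set.range σ ⊆ X.fixed A) :
    evalSimplex (cupCochain s t) A σ h =
      RepGroup.tensor (evalSimplex s A (σ.comp (frontFace n m)) (range_comp_subset h _))
        (evalSimplex t A (σ.comp (backFace n m)) (range_comp_subset h _)) := by
  refine (cupLin_single s t A σ).trans ?_
  rw [cupVal, dif_pos h]

theorem cupCochain_add_left (s s' : NatHom (X.sing.X n) (repCoeff α))
    (t : NatHom (X.sing.X m) (repCoeff β)) :
    cupCochain (s + s') t = cupCochain s t + cupCochain s' t :=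
  singCochain_ext fun A σ h => by
    rw [evalSimplex_add]
    simp only [evalSimplex_cup, evalSimplex_add, map_add, AddMonoidHom.add_apply]

theorem cupCochain_add_right (s : NatHom (X.sing.X n) (repCoeff α))
    (t t' : NatHom (X.sing.X m) (repCoeff β)) :
    cupCochain s (t + t') = cupCochain s t + cupCochain s t' :=
  singCochain_ext fun A σ h => by
    rw [evalSimplex_add]
    simp only [evalSimplex_cup, evalSimplex_add, map_add]

theorem cupCochain_zero_left (t : NatHom (X.sing.X m) (repCoeff β)) :
    cupCochain (0 : NatHom (X.sing.X n) (repCoeff α)) t = 0 :=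
  singCochain_ext fun A σ h => by
    simp only [evalSimplex_cup, evalSimplex_zero, map_zero, AddMonoidHom.zero_apply]

theorem cupCochain_zero_right (s : NatHom (X.sing.X n) (repCoeff α)) :
    cupCochain s (0 : NatHom (X.sing.X m) (repCoeff β)) = 0 :=
  singCochain_ext fun A σ h => by
    simp only [evalSimplex_cup, evalSimplex_zero, map_zero]

/-- The cup product of cochains is natural for all equivariant maps. -/
theorem precomp_cupCochain (f : GMap X Y) (s : NatHom (Y.sing.X n) (repCoeff α))
    (t : NatHom (Y.sing.X m) (repCoeff β)) :
    NatHom.precomp (f.sing.f (n + m)) _ (cupCochain s t) =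
      cupCochain (NatHom.precomp (f.sing.f n) _ s) (NatHom.precomp (f.sing.f m) _ t) :=
  singCochain_ext fun A σ h => by
    have h' : Set.range (f.toMap.comp σ) ⊆ Y.fixed A := by
      rintro _ ⟨x, rfl⟩
      exact f.map_fixed A (h ⟨x, rfl⟩)
    rw [evalSimplex_precomp f _ A σ h h', evalSimplex_cup, evalSimplex_cup]
    exact congrArg₂ (fun a b => RepGroup.tensor a b)
      (evalSimplex_precomp f s A (σ.comp (frontFace n m)) (range_comp_subset h _)
        (range_comp_subset h' (frontFace n m))).symm
      (evalSimplex_precomp f t A (σ.comp (backFace n m)) (range_comp_subset h _)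
        (range_comp_subset h' (backFace n m))).symm

/-! ### Change of the degree and of the twisting along equalities -/

/-- The identification of representation groups coming from an equality of the twisting. -/
def RepGroup.cast (hα : α = α') (H : Subgroup G) : RepGroup α H →+ RepGroup α' H := by
  subst hα
  exact AddMonoidHom.id _

/-- The identification of groups of singular cochains coming from equalities of the twisting and of
the degree. -/
def castCochain (hα : α = α') (hn : n = n') :
    NatHom (X.sing.X n) (repCoeff α) →+ NatHom (X.sing.X n') (repCoeff α') := by
  subst hα
  subst hn
  exact AddMonoidHom.id _

theorem evalSimplex_castCochain (hα : α = α') (hn : n = n') (s : NatHom (X.sing.X n) (repCoeff α))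
    (A : Orb G) (σ : C(stdSimplex ℝ (Fin (n' + 1)), X)) (h : Set.range σ ⊆ X.fixed A) :
    evalSimplex (castCochain hα hn s) A σ h = RepGroup.cast hα A.H
      (evalSimplex s A (σ.comp (simplexMap (Fin.cast (congrArg (· + 1) hn))))
        (range_comp_subset h _)) := by
  subst hα
  subst hn
  refine evalSimplex_congr s ?_ h (range_comp_subset h _)
  ext x
  exact congrArg σ (stdSimplex.map_id_apply x).symm

theorem Represents.cast (hα : α = α') (hn : n = n') {s : NatHom (X.sing.X n) (repCoeff α)}
    {x : TwistedCoh X α n} (h : Represents s x) :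
    Represents (castCochain hα hn s) (TwistedCoh.cast hα hn x) := by
  subst hα
  subst hn
  exact h

theorem castCochain_delta_mem_coboundaries (hn : n + 1 = n')
    (s : NatHom (X.sing.X n) (repCoeff α)) :
    castCochain rfl hn (delta X.sing _ n s) ∈ coboundaries X.sing (repCoeff α) n' := by
  subst hn
  exact ⟨s, rfl⟩

theorem castCochain_castCochain (hn : n = n') (hn' : n' = n)
    (s : NatHom (X.sing.X n) (repCoeff α)) :
    castCochain rfl hn' (castCochain (α' := α) rfl hn s) = s := by
  subst hn
  rfl

/-! ### The Leibniz rule -/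

theorem val_succAbove {k : ℕ} (i : Fin (k + 1)) (j : Fin k) :
    (i.succAbove j : ℕ) = if (j : ℕ) < i then (j : ℕ) else j + 1 := by
  rw [Fin.succAbove]
  split_ifs <;> simp_all [Fin.lt_def]

/-- The Leibniz rule `δ(s ∪ t) = δs ∪ t + (-1)ⁿ s ∪ δt`. -/
theorem delta_cupCochain (s : NatHom (X.sing.X n) (repCoeff α))
    (t : NatHom (X.sing.X m) (repCoeff β)) :
    delta X.sing _ (n + m) (cupCochain s t) =
      castCochain rfl (Nat.add_right_comm n 1 m) (cupCochain (delta X.sing _ n s) t) +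
        (-1 : ℤ) ^ n • cupCochain s (delta X.sing _ m t) := by
  refine singCochain_ext fun A σ h => ?_
  rw [evalSimplex_add, evalSimplex_zsmul, evalSimplex_castCochain, evalSimplex_delta]
  change _ = evalSimplex (cupCochain (delta X.sing _ n s) t) A _ (range_comp_subset h _) +
    (-1 : ℤ) ^ n • evalSimplex (cupCochain s (delta X.sing _ m t)) A σ h
  simp only [evalSimplex_cup, evalSimplex_delta, frontFace, backFace, ContinuousMap.comp_assoc,
    simplexMap_comp]
  -- the values of `s` and `t` on the faces of `σ`, as functions of the sequence of vertices
  let S (f : Fin (n + 1) → Fin (n + m + 1 + 1)) : RepGroup α A.H :=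
    evalSimplex s A (σ.comp (simplexMap f)) (range_comp_subset h _)
  let T (f : Fin (m + 1) → Fin (n + m + 1 + 1)) : RepGroup β A.H :=
    evalSimplex t A (σ.comp (simplexMap f)) (range_comp_subset h _)
  have hS (f) : evalSimplex s A (σ.comp (simplexMap f)) (range_comp_subset h _) = S f := rfl
  have hT (f) : evalSimplex t A (σ.comp (simplexMap f)) (range_comp_subset h _) = T f := rfl
  simp only [hS, hT]
  rw [← Fin.sum_congr' _ (show n + 1 + (m + 1) = n + m + 1 + 1 by omega), Fin.sum_univ_add,
    Fin.sum_univ_castSucc (n := n + 1), Fin.sum_univ_succ (n := m + 1)]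
  simp only [map_add, map_sum, map_zsmul, AddMonoidHom.add_apply, AddMonoidHom.finsetSum_apply,
    AddMonoidHom.smul_apply, smul_add, Finset.smul_sum, smul_smul]
  have key {k l : ℤ} {f f' : Fin (n + 1) → Fin (n + m + 1 + 1)}
      {g g' : Fin (m + 1) → Fin (n + m + 1 + 1)} (hk : k = l) (hf : ∀ i, (f i : ℕ) = f' i)
      (hg : ∀ i, (g i : ℕ) = g' i) :
      k • RepGroup.tensor (S f) (T g) = l • RepGroup.tensor (S f') (T g') := by
    rw [hk, funext fun i => Fin.ext (hf i), funext fun i => Fin.ext (hg i)]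
  -- the last face of the front and the zeroth face of the back give the same terms with
  -- opposite signs
  have cancel {a b c d : RepGroup (α + β) A.H} (hbc : b + c = 0) : a + b + (c + d) = a + d := by
    rw [add_assoc, ← add_assoc b, hbc, zero_add]
  rw [cancel]
  · refine congrArg₂ (· + ·) (Finset.sum_congr rfl fun i _ => key rfl (fun j => ?_) fun j => ?_)
      (Finset.sum_congr rfl fun i _ => key ?_ (fun j => ?_) fun j => ?_)
    all_goals simp only [Function.comp_apply, val_succAbove, Fin.val_cast, Fin.val_castLE,
      Fin.val_castAdd, Fin.val_natAdd, Fin.val_castSucc, Fin.val_succ]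
    · split_ifs <;> omega
    · rw [← pow_add]
      congr 1
      omega
    · split_ifs <;> omega
    · split_ifs <;> omega
  · refine add_eq_zero_iff_eq_neg.2 ((key ?_ (fun j => ?_) fun j => ?_).trans (neg_smul _ _))
    · rw [Fin.val_last, Fin.val_zero, pow_succ]
      ring
    · simp only [Function.comp_apply, Fin.succAbove_last, Fin.val_cast, Fin.val_castLE,
        Fin.val_castSucc]
    · simp only [Function.comp_apply, Fin.zero_succAbove, Fin.val_cast, Fin.val_natAdd,
        Fin.val_succ]
      omega

end SingularCochains

/-! ### The cup product in twisted Bredon cohomology -/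

section CupProduct

variable {G : Type v} [Group G] {X Y : ProperGCW.{u} G} {α β α' : Z2 G} {n m n' : ℕ}

theorem cupCochain_mem_cocycles {s : NatHom (X.sing.X n) (repCoeff α)}
    {t : NatHom (X.sing.X m) (repCoeff β)} (hs : s ∈ cocycles X.sing (repCoeff α) n)
    (ht : t ∈ cocycles X.sing (repCoeff β) m) :
    cupCochain s t ∈ cocycles X.sing (repCoeff (α + β)) (n + m) := by
  have hs' : delta X.sing _ n s = 0 := hs
  have ht' : delta X.sing _ m t = 0 := ht
  change delta X.sing _ (n + m) (cupCochain s t) = 0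
  rw [delta_cupCochain, hs', ht', cupCochain_zero_left, cupCochain_zero_right, map_zero, smul_zero,
    add_zero]

theorem cupCochain_mem_coboundaries_left {s : NatHom (X.sing.X n) (repCoeff α)}
    {t : NatHom (X.sing.X m) (repCoeff β)} (hs : s ∈ coboundaries X.sing (repCoeff α) n)
    (ht : t ∈ cocycles X.sing (repCoeff β) m) :
    cupCochain s t ∈ coboundaries X.sing (repCoeff (α + β)) (n + m) := by
  cases n with
  | zero =>
    rw [show s = 0 from hs, cupCochain_zero_left]
    exact zero_mem _
  | succ n =>
    obtain ⟨e, rfl⟩ : ∃ e, delta X.sing _ n e = s := hs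
    have ht' : delta X.sing _ m t = 0 := ht
    have h := delta_cupCochain e t
    rw [ht', cupCochain_zero_right, smul_zero, add_zero] at h
    rw [← castCochain_castCochain (Nat.add_right_comm n 1 m) (Nat.add_right_comm n m 1)
      (cupCochain _ t), ← h]
    exact castCochain_delta_mem_coboundaries _ _

theorem cupCochain_mem_coboundaries_right {s : NatHom (X.sing.X n) (repCoeff α)}
    {t : NatHom (X.sing.X m) (repCoeff β)} (hs : s ∈ cocycles X.sing (repCoeff α) n)
    (ht : t ∈ coboundaries X.sing (repCoeff β) m) :
    cupCochain s t ∈ coboundaries X.sing (repCoeff (α + β)) (n + m) := by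
  cases m with
  | zero =>
    rw [show t = 0 from ht, cupCochain_zero_right]
    exact zero_mem _
  | succ m =>
    obtain ⟨e, rfl⟩ : ∃ e, delta X.sing _ m e = t := ht
    have hs' : delta X.sing _ n s = 0 := hs
    have h := delta_cupCochain s e
    rw [hs', cupCochain_zero_left, map_zero, zero_add] at h
    refine ⟨(-1 : ℤ) ^ n • cupCochain s e, ?_⟩
    refine (map_zsmul (delta X.sing (repCoeff (α + β)) (n + m)) _ _).trans ?_
    rw [h, smul_smul, ← mul_pow, neg_one_mul, neg_neg, one_pow, one_smul]

section Represents

variable {M : Coeff.{v, w} G}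

theorem Represents.mem_cocycles {s : NatHom (X.sing.X n) M} {x : Bredon X M n}
    (h : Represents s x) : s ∈ cocycles X.sing M n := h.1

/-- A cocycle represents at most one class, since the comparison with singular cohomology is
injective. -/
theorem Represents.unique {s : NatHom (X.sing.X n) M} {x x' : Bredon X M n}
    (h : Represents s x) (h' : Represents s x') : x = x' := by
  obtain ⟨hs, e⟩ := represents_iff.1 h
  obtain ⟨_, e'⟩ := represents_iff.1 h'
  exact (X.toSing M n).injective (e.trans e'.symm)

theorem Represents.add {s s' : NatHom (X.sing.X n) M} {x x' : Bredon X M n}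
    (h : Represents s x) (h' : Represents s' x') : Represents (s + s') (x + x') := by
  obtain ⟨hs, e⟩ := represents_iff.1 h
  obtain ⟨hs', e'⟩ := represents_iff.1 h'
  refine represents_iff.2 ⟨add_mem hs hs', ?_⟩
  rw [map_add, e, e']
  rfl

theorem Represents.zsmul {s : NatHom (X.sing.X n) M} {x : Bredon X M n}
    (h : Represents s x) (k : ℤ) : Represents (k • s) (k • x) := by
  obtain ⟨hs, e⟩ := represents_iff.1 h
  refine represents_iff.2 ⟨zsmul_mem hs k, ?_⟩
  rw [map_zsmul, e]
  rfl

theorem coh_mk_eq_iff {K : ChainComplex (Coeff.{v, w} G) ℕ} {M : Coeff.{v, w₂} G}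
    {s t : cocycles K M n} : Coh.mk s = Coh.mk t ↔ s.1 - t.1 ∈ coboundaries K M n :=
  QuotientAddGroup.eq_iff_sub_mem

theorem Represents.of_sub_mem {s s' : NatHom (X.sing.X n) M} {x : Bredon X M n}
    (h : Represents s x) (h' : s' - s ∈ coboundaries X.sing M n)
    (hs' : s' ∈ cocycles X.sing M n) : Represents s' x := by
  obtain ⟨hs, e⟩ := represents_iff.1 h
  exact represents_iff.2 ⟨hs', e.trans (coh_mk_eq_iff.2 h').symm⟩

theorem Represents.sub_mem {s s' : NatHom (X.sing.X n) M} {x : Bredon X M n}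
    (h : Represents s x) (h' : Represents s' x) : s' - s ∈ coboundaries X.sing M n := by
  obtain ⟨hs, e⟩ := represents_iff.1 h
  obtain ⟨hs', e'⟩ := represents_iff.1 h'
  exact coh_mk_eq_iff.1 (e'.symm.trans e)

end Represents

/-- By the Leibniz rule, the class of a cup product of cocycles depends only on their classes. -/
theorem exists_represents_cup (x : TwistedCoh X α n) (y : TwistedCoh X β m) :
    ∃ z : TwistedCoh X (α + β) (n + m), ∀ (s : NatHom (X.sing.X n) (repCoeff α))
      (t : NatHom (X.sing.X m) (repCoeff β)), Represents s x → Represents t y →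
        Represents (cupCochain s t) z := by
  obtain ⟨s, hs⟩ := exists_represents x
  obtain ⟨t, ht⟩ := exists_represents y
  have hz := cupCochain_mem_cocycles hs.mem_cocycles ht.mem_cocycles
  refine ⟨(X.toSing _ _).symm (Coh.mk ⟨_, hz⟩), fun s' t' hs' ht' => ?_⟩
  refine (represents_iff.2 ⟨hz, AddEquiv.apply_symm_apply _ _⟩ : Represents (cupCochain s t) _)
    |>.of_sub_mem ?_ (cupCochain_mem_cocycles hs'.mem_cocycles ht'.mem_cocycles)
  have e : cupCochain s' t' - cupCochain s t =
      cupCochain (s' - s) t' + cupCochain s (t' - t) := by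
    have e₁ := cupCochain_add_left (s' - s) s t'
    have e₂ := cupCochain_add_right s (t' - t) t
    rw [sub_add_cancel] at e₁ e₂
    rw [e₁, e₂]
    abel
  rw [e]
  exact add_mem (cupCochain_mem_coboundaries_left (hs.sub_mem hs') ht'.mem_cocycles)
    (cupCochain_mem_coboundaries_right hs.mem_cocycles (ht.sub_mem ht'))

/-- The cup product of two classes: the class represented by the cup products of the representing
singular cocycles. -/
def cupClass (x : TwistedCoh X α n) (y : TwistedCoh X β m) : TwistedCoh X (α + β) (n + m) :=
  (exists_represents_cup x y).choose

theorem Represents.cup {x : TwistedCoh X α n} {y : TwistedCoh X β m}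
    {s : NatHom (X.sing.X n) (repCoeff α)} {t : NatHom (X.sing.X m) (repCoeff β)}
    (hs : Represents s x) (ht : Represents t y) : Represents (cupCochain s t) (cupClass x y) :=
  (exists_represents_cup x y).choose_spec s t hs ht

theorem cupClass_add_left (x x' : TwistedCoh X α n) (y : TwistedCoh X β m) :
    cupClass (x + x') y = cupClass x y + cupClass x' y := by
  obtain ⟨s, hs⟩ := exists_represents x
  obtain ⟨s', hs'⟩ := exists_represents x'
  obtain ⟨t, ht⟩ := exists_represents y
  refine ((hs.add hs').cup ht).unique ?_
  rw [cupCochain_add_left]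
  exact (hs.cup ht).add (hs'.cup ht)

theorem cupClass_add_right (x : TwistedCoh X α n) (y y' : TwistedCoh X β m) :
    cupClass x (y + y') = cupClass x y + cupClass x y' := by
  obtain ⟨s, hs⟩ := exists_represents x
  obtain ⟨t, ht⟩ := exists_represents y
  obtain ⟨t', ht'⟩ := exists_represents y'
  refine (hs.cup (ht.add ht')).unique ?_
  rw [cupCochain_add_right]
  exact (hs.cup ht).add (hs.cup ht')

variable (X α β n m) in
/-- The cup product, as a homomorphism on the tensor product. -/
def cupHom : TwistedCoh X α n ⊗[ℤ] TwistedCoh X β m →+ TwistedCoh X (α + β) (n + m) :=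
  TensorProduct.liftAddHom
    (AddMonoidHom.mk' (fun x => AddMonoidHom.mk' (cupClass x) (cupClass_add_right x))
      fun x x' => AddMonoidHom.ext (cupClass_add_left x x'))
    fun k x y => by rw [map_zsmul, map_zsmul, AddMonoidHom.smul_apply]

theorem cupHom_tmul (x : TwistedCoh X α n) (y : TwistedCoh X β m) :
    cupHom X α β n m (x ⊗ₜ[ℤ] y) = cupClass x y :=
  TensorProduct.liftAddHom_tmul _ _ _ _

theorem IsPullback.cup {f : GMap X Y} {x : TwistedCoh Y α n} {y : TwistedCoh Y β m}
    {x' : TwistedCoh X α n} {y' : TwistedCoh X β m} (hx : IsPullback f x x')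
    (hy : IsPullback f y y') : IsPullback f (cupClass x y) (cupClass x' y') := by
  obtain ⟨s, hs, hs'⟩ := hx
  obtain ⟨t, ht, ht'⟩ := hy
  refine ⟨cupCochain s t, hs.cup ht, ?_⟩
  rw [precomp_cupCochain]
  exact hs'.cup ht'

/-- Naturality for cellular maps, a case of the naturality for all equivariant maps. -/
theorem pullback_cupClass (f : GMap X Y) (hf : f.IsCellular) (x : TwistedCoh Y α n)
    (y : TwistedCoh Y β m) :
    f.pullback hf (repCoeff (α + β)) (n + m) (cupClass x y) =
      cupClass (f.pullback hf (repCoeff α) n x) (f.pullback hf (repCoeff β) m y) :=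
  (X.toSing _ _).injective ((toSing_pullback f hf _).trans ((isPullback_iff f).1
    (((isPullback_iff f).2 (toSing_pullback f hf x)).cup
      ((isPullback_iff f).2 (toSing_pullback f hf y)))).symm)

end CupProduct

/-! ### Natural operators homotopic to the identity -/

section GradedCommutativity

variable {G : Type v} [Group G] {X : ProperGCW.{u} G} {α β α' : Z2 G} {n m k : ℕ}

variable (X) in
/-- The natural operator on singular chains given by a universal chain, as a morphism of coefficient
systems. -/
def natMor (a : SingChain (Simplex n) k) : X.sing.X n ⟶ X.sing.X k :=
  (subMap (natEnd a) (fun g c => (push_natEnd a (X.smulMap g) c).symm)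
    fun _ _ hc => natEnd_mem_chainsIn a hc : X.singCoeff n ⟶ X.singCoeff k)

theorem coboundaries_le_cocycles (K : ChainComplex (Coeff.{v, w₁} G) ℕ) (M : Coeff.{v, w₂} G)
    (n : ℕ) : coboundaries K M n ≤ cocycles K M n := by
  cases n with
  | zero => exact bot_le
  | succ n =>
    rintro _ ⟨e, rfl⟩
    change delta K M (n + 1) (delta K M n e) = 0
    rw [delta, delta, NatHom.precomp_comp, K.d_comp_d, NatHom.precomp_zero]

/-- Natural operators that satisfy the hypotheses of `exists_homotopy_id` do not change the class of
a cocycle. -/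
theorem Represents.precomp_natMor {M : Coeff.{v, w} G} {a : ∀ n, SingChain (Simplex n) n}
    (hmem : ∀ n, a n ∈ affChains (Simplex n) n) (h₀ : a 0 = iota 0)
    (ha : ∀ n, bdry n (a (n + 1)) = natEnd (a n) (bdry n (iota (n + 1))))
    {s : NatHom (X.sing.X n) M} {x : Bredon X M n} (hs : Represents s x) :
    Represents (NatHom.precomp (natMor X (a n)) M s) x := by
  have hs' : delta X.sing M n s = 0 := hs.mem_cocycles
  obtain ⟨T, hT⟩ := exists_homotopy_id.{u} hmem h₀ ha
  -- the value of `s` on a boundary vanishes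
  have hb (A : Orb G) (c : chainsIn (n + 1) (X.fixed A)) :
      s.1 A (⟨bdry n c.1, bdry_mem_chainsIn c.2⟩ : chainsIn n (X.fixed A)) = 0 := by
    have h := DFunLike.congr_fun (congrFun (congrArg Subtype.val hs') A) c
    change s.1 A ((X.sing.d (n + 1) n).app (op A) c) = 0 at h
    rwa [X.sing_d] at h
  have h : NatHom.precomp (natMor X (a n)) M s - s ∈ coboundaries X.sing M n := by
    cases n with
    | zero =>
      refine (sub_eq_zero.2 (Subtype.ext (funext fun A => AddMonoidHom.ext fun c => ?_)) :
        NatHom.precomp (natMor X (a 0)) M s - s = 0)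
      let f : chainsIn 0 (X.fixed A) →+ M.obj (op A) := s.1 A
      let c' : chainsIn 0 (X.fixed A) := c
      refine sub_eq_zero.1 (Eq.trans ?_ (hb A ⟨_, natEnd_mem_chainsIn (T 0) c'.2⟩))
      change f ⟨natEnd (a 0) c'.1, natEnd_mem_chainsIn _ c'.2⟩ - f c' = f _
      rw [← map_sub]
      exact congrArg f (Subtype.ext (hT.1 c'.1).symm)
    | succ n =>
      refine ⟨NatHom.precomp (natMor X (T n)) M s, ?_⟩
      refine Subtype.ext (funext fun A => AddMonoidHom.ext fun c => ?_)
      let f : chainsIn (n + 1) (X.fixed A) →+ M.obj (op A) := s.1 A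
      let c' : chainsIn (n + 1) (X.fixed A) := c
      change s.1 A ((natMor X (T n)).app (op A) ((X.sing.d (n + 1) n).app (op A) c)) = _
      rw [X.sing_d]
      change f ⟨natEnd (T n) (bdry n c'.1), natEnd_mem_chainsIn _ (bdry_mem_chainsIn c'.2)⟩ =
        f ⟨natEnd (a (n + 1)) c'.1, natEnd_mem_chainsIn _ c'.2⟩ - f c'
      have h1 := hb A ⟨_, natEnd_mem_chainsIn (T (n + 1)) c'.2⟩
      change f _ = 0 at h1
      rw [← map_sub, ← zero_add (f _), ← h1, ← map_add]
      exact congrArg f (Subtype.ext (hT.2 n c'.1))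
  refine hs.of_sub_mem h ?_
  have h' := add_mem (coboundaries_le_cocycles _ _ _ h) hs.mem_cocycles
  rwa [sub_add_cancel] at h'

/-! ### Graded commutativity -/

/-- The sign `(-1)^{n(n+1)/2}` of the reversal of the vertices of an `n`-simplex. -/
def revSign (n : ℕ) : ℤ := (-1) ^ (n + 1).choose 2

theorem revSign_succ (n : ℕ) : revSign (n + 1) = (-1) ^ (n + 1) * revSign n := by
  rw [revSign, Nat.choose_succ_succ', Nat.choose_one_right, pow_add, revSign]

theorem revSign_add (n m : ℕ) : revSign (n + m) = (-1) ^ (n * m) * (revSign n * revSign m) := by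
  induction m with
  | zero => simp [revSign]
  | succ m ih =>
    rw [← add_assoc, revSign_succ, ih, revSign_succ]
    ring

/-- The universal chain of the reversal operator: it sends a singular simplex to the simplex with the
vertices in the opposite order, up to the sign which makes it a chain map. -/
def revChain (n : ℕ) : SingChain (Simplex n) n :=
  revSign n • Finsupp.single (simplexMap Fin.rev) 1

theorem revChain_mem (n : ℕ) : revChain n ∈ affChains (Simplex n) n := by
  rw [revChain, simplexMap_eq_comb]
  exact zsmul_mem (single_aff_mem _) _

theorem revChain_zero : revChain 0 = iota 0 := by
  have h : (Fin.rev : Fin (0 + 1) → Fin (0 + 1)) = id :=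
    funext fun _ => Subsingleton.elim (α := Fin 1) _ _
  rw [revChain, iota, h, simplexMap_id]
  simp [revSign]

theorem natEnd_revChain {Z : Type*} [TopologicalSpace Z] (σ : C(Simplex n, Z)) :
    natEnd (revChain n) (Finsupp.single σ 1) =
      revSign n • Finsupp.single (σ.comp (simplexMap Fin.rev)) 1 := by
  rw [natEnd_single, revChain, map_zsmul, push_single]

theorem bdry_revChain (n : ℕ) :
    bdry n (revChain (n + 1)) = natEnd (revChain n) (bdry n (iota (n + 1))) := by
  rw [revChain, map_zsmul, bdry_single, iota, bdry_single, map_sum, Finset.smul_sum]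
  refine Fintype.sum_equiv Fin.revPerm _ _ fun i => ?_
  have h : (Fin.rev ∘ i.succAbove : Fin (n + 1) → Fin (n + 2)) = i.rev.succAbove ∘ Fin.rev :=
    funext fun j => Fin.rev_succAbove i j
  rw [map_zsmul, natEnd_revChain, simplexMap_comp, h, smul_smul, smul_smul, Fin.revPerm_apply,
    ContinuousMap.id_comp, simplexMap_comp]
  congr 1
  have hi : n + 1 = (i.rev : ℕ) + i := by
    rw [Fin.val_rev]
    omega
  rw [revSign_succ, hi, pow_add, mul_right_comm, mul_assoc _ _ ((-1 : ℤ) ^ (i : ℕ)), ← pow_add,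
    Even.neg_one_pow ⟨_, rfl⟩, mul_one]

theorem evalSimplex_rev (s : NatHom (X.sing.X n) (repCoeff α)) (A : Orb G)
    (σ : C(stdSimplex ℝ (Fin (n + 1)), X)) (h : Set.range σ ⊆ X.fixed A) :
    evalSimplex (NatHom.precomp (natMor X (revChain n)) _ s) A σ h = revSign n •
      evalSimplex s A (σ.comp (simplexMap Fin.rev)) (range_comp_subset h _) := by
  let f : chainsIn n (X.fixed A) →+ RepGroup α A.H := s.1 A
  change f ⟨natEnd (revChain n) (Finsupp.single σ 1), _⟩ =
    revSign n • f ⟨Finsupp.single (σ.comp (simplexMap Fin.rev)) 1, _⟩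
  rw [← map_zsmul]
  exact congrArg f (Subtype.ext (natEnd_revChain σ))

theorem Represents.rev {s : NatHom (X.sing.X n) (repCoeff α)} {x : TwistedCoh X α n}
    (hs : Represents s x) : Represents (NatHom.precomp (natMor X (revChain n)) _ s) x :=
  hs.precomp_natMor revChain_mem revChain_zero bdry_revChain

theorem RepGroup.cast_repClass (hα : α = α') {H : Subgroup G} {R : TwistedRep α H}
    {S : TwistedRep α' H} (f : R.V ≃ₗ[ℂ] S.V) (hf : ∀ (x : H) (v : R.V), f (R.ρ x v) = S.ρ x (f v)) :
    RepGroup.cast hα H (repClass R) = repClass S := by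
  subst hα
  exact repClass_eq ⟨f, hf⟩

/-- The tensor product of twisted representations is commutative. -/
theorem RepGroup.cast_tensor {H : Subgroup G} (a : RepGroup α H) (b : RepGroup β H) :
    RepGroup.cast (add_comm β α) H (RepGroup.tensor b a) = RepGroup.tensor a b := by
  have h : ((AddMonoidHom.compHom (RepGroup.cast (add_comm β α) H)).comp RepGroup.tensor).flip =
      RepGroup.tensor (α := α) (β := β) := by
    refine RepGroup.hom_ext fun R => RepGroup.hom_ext fun S => ?_
    change RepGroup.cast (add_comm β α) H (RepGroup.tensor (repClass S) (repClass R)) = _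
    rw [RepGroup.tensor_class, RepGroup.tensor_class]
    refine RepGroup.cast_repClass _ (TensorProduct.comm ℂ S.V R.V) fun x v => ?_
    change TensorProduct.comm ℂ S.V R.V (TensorProduct.congr (S.ρ x) (R.ρ x) v) =
      TensorProduct.congr (R.ρ x) (S.ρ x) (TensorProduct.comm ℂ S.V R.V v)
    induction v using TensorProduct.induction_on with
    | zero => simp only [map_zero]
    | tmul a b => rfl
    | add a b ha hb => simp only [map_add, ha, hb]
  exact DFunLike.congr_fun (DFunLike.congr_fun h a) b

/-- Reversing the vertices exchanges the front and the back faces, so the cup product of the reversed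
cochains is, up to sign and the symmetry of the tensor product, the reversal of the cup product in
the opposite order. -/
theorem cupCochain_rev (s : NatHom (X.sing.X n) (repCoeff α))
    (t : NatHom (X.sing.X m) (repCoeff β)) :
    cupCochain (NatHom.precomp (natMor X (revChain n)) _ s)
        (NatHom.precomp (natMor X (revChain m)) _ t) =
      (-1 : ℤ) ^ (n * m) • NatHom.precomp (natMor X (revChain (n + m))) _
        (castCochain (add_comm β α) (add_comm m n) (cupCochain t s)) := by
  refine singCochain_ext fun A σ h => ?_
  rw [evalSimplex_zsmul, evalSimplex_rev, evalSimplex_castCochain, evalSimplex_cup,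
    evalSimplex_cup, RepGroup.cast_tensor, evalSimplex_rev, evalSimplex_rev, map_zsmul, map_zsmul,
    AddMonoidHom.smul_apply, smul_smul, smul_smul, revSign_add, ← mul_assoc, ← pow_add,
    Even.neg_one_pow ⟨_, rfl⟩, one_mul, mul_comm]
  simp only [frontFace, backFace, ContinuousMap.comp_assoc, simplexMap_comp]
  refine congrArg₂ (fun a b => (revSign n * revSign m) • RepGroup.tensor a b)
    (evalSimplex_congr s ?_ _ _) (evalSimplex_congr t ?_ _ _)
  · congr 2
    funext i
    apply Fin.ext
    simp only [Function.comp_apply, Fin.val_castLE, Fin.val_rev, Fin.val_cast, Fin.val_natAdd]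
    omega
  · congr 2
    funext i
    apply Fin.ext
    simp only [Function.comp_apply, Fin.val_castLE, Fin.val_rev, Fin.val_cast, Fin.val_natAdd]
    omega

/-- Graded commutativity: reversed cocycles represent the same classes, and their cup product is given
by `cupCochain_rev`. -/
theorem cupClass_comm (x : TwistedCoh X α n) (y : TwistedCoh X β m) :
    cupClass x y = (-1 : ℤ) ^ (n * m) •
      TwistedCoh.cast (add_comm β α) (add_comm m n) (cupClass y x) := by
  obtain ⟨s, hs⟩ := exists_represents x
  obtain ⟨t, ht⟩ := exists_represents y
  refine (hs.rev.cup ht.rev).unique ?_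
  rw [cupCochain_rev]
  exact (((ht.cup hs).cast (add_comm β α) (add_comm m n)).rev).zsmul _

end GradedCommutativity

end TwistedBredon

end

theorem mainTheorem6 (G : Type v) [Group G] :
    ∃ cup : ∀ (X : ProperGCW.{u} G) (α β : Z2 G) (n m : ℕ),
        TwistedCoh X α n ⊗[ℤ] TwistedCoh X β m →+ TwistedCoh X (α + β) (n + m),
      -- `cup` is the cup product, given by the front face / back face formula on representatives
      (∀ (X : ProperGCW.{u} G) (α β : Z2 G) (n m : ℕ) (x : TwistedCoh X α n) (y : TwistedCoh X β m),
        (∃ s : NatHom (X.sing.X n) (repCoeff α), Represents s x) ∧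
        (∃ t : NatHom (X.sing.X m) (repCoeff β), Represents t y) ∧
        ∀ (s : NatHom (X.sing.X n) (repCoeff α)) (t : NatHom (X.sing.X m) (repCoeff β)),
          Represents s x → Represents t y →
            Represents (cupCochain s t) (cup X α β n m (x ⊗ₜ[ℤ] y))) ∧
      -- naturality in `X` for cellular `G`-maps
      (∀ (X Y : ProperGCW.{u} G) (f : GMap X Y) (hf : f.IsCellular) (α β : Z2 G) (n m : ℕ)
          (x : TwistedCoh Y α n) (y : TwistedCoh Y β m),
        f.pullback hf (repCoeff (α + β)) (n + m) (cup Y α β n m (x ⊗ₜ[ℤ] y)) =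
          cup X α β n m
            (f.pullback hf (repCoeff α) n x ⊗ₜ[ℤ] f.pullback hf (repCoeff β) m y)) ∧
      -- naturality in `X` for arbitrary `G`-maps
      (∀ (X Y : ProperGCW.{u} G) (f : GMap X Y) (α β : Z2 G) (n m : ℕ)
          (x : TwistedCoh Y α n) (y : TwistedCoh Y β m)
          (x' : TwistedCoh X α n) (y' : TwistedCoh X β m),
        IsPullback f x x' → IsPullback f y y' →
          IsPullback f (cup Y α β n m (x ⊗ₜ[ℤ] y)) (cup X α β n m (x' ⊗ₜ[ℤ] y'))) ∧
      -- graded commutativity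
      (∀ (X : ProperGCW.{u} G) (α β : Z2 G) (n m : ℕ) (x : TwistedCoh X α n)
          (y : TwistedCoh X β m),
        cup X α β n m (x ⊗ₜ[ℤ] y) =
          (-1 : ℤ) ^ (n * m) •
            TwistedCoh.cast (add_comm β α) (add_comm m n) (cup X β α m n (y ⊗ₜ[ℤ] x))) := by
  refine ⟨cupHom, fun X α β n m x y => ⟨exists_represents x, exists_represents y,
    fun s t hs ht => ?_⟩, fun X Y f hf α β n m x y => ?_, fun X Y f α β n m x y x' y' hx hy => ?_,
    fun X α β n m x y => ?_⟩
  · rw [cupHom_tmul]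
    exact hs.cup ht
  · rw [cupHom_tmul, cupHom_tmul]
    exact pullback_cupClass f hf x y
  · rw [cupHom_tmul, cupHom_tmul]
    exact hx.cup hy
  · rw [cupHom_tmul, cupHom_tmul]
    exact cupClass_comm x y
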